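/- **Setting.** Let $n,d,m\ge 1$ be integers with $d\le m$. Let $A\in\mathbb R^{d\times m}$ have rank $d$, i.e. its smallest singular value $\sigma_{\min}(A)$ (the $d$-th largest one) is positive; let $\sigma_{\max}(A)$ be its largest singular value and $\kappa=\sigma_{\max}(A)/\sigma_{\min}(A)$. Let $O_1,\dots,O_n\in O(d)$ and $\sigma\ge 0$, and suppose we observe $A_i=O_iA+\sigma W_i\in\mathbb R^{d\times m}$, $1\le i\le n$, where all entries of $W_1,\dots,W_n$ are independent $\mathcal N(0,1)$ random variables. For $X\in\mathbb R^{nd\times k}$ let $X_i\in\mathbb R^{d\times k}$ be its $i$-th block of $d$ consecutive rows. Let $O(d)^{\otimes n}$ be the set of $S\in\mathbb R^{nd\times d}$ with all $S_i\in O(d)$, let $D\in\mathbb R^{nd\times m}$ be the matrix with blocks $D_i=A_i$, and let $C=DD^\top$. For $X\in\mathbb R^{d\times d}$ let $\mathcal P(X)=UV^\top$, where $X=U\Sigma V^\top$ is a singular value decomposition (any choice is allowed if $X$ is singular), and let $\mathcal P_n$ apply $\mathcal P$ to each $d\times d$ block of a matrix in $\mathbb R^{nd\times d}$. Put $d_F(X,Y)=\min_{Q\in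 O(d)}\|X-YQ\|_F$ for $X,Y\in\mathbb R^{nd\times d}$. The generalized power method (GPM) with spectral initialization is $S^0=\mathcal P_n(U)$, where the columns of $U\in\mathbb R^{nd\times d}$ are orthonormal top $d$ left singular vectors of $D$, and $S^{t+1}=\mathcal P_n(CS^t)$ for $t\ge 0$. Consider also the two programs $$\text{(P)}\quad \max_{S\in O(d)^{\otimes n}}\ \sum_{i<j}\langle A_iA_j^\top,\,S_iS_j^\top\rangle ,\qquad\qquad \text{(SDP)}\quad \max\ \langle C,G\rangle\ \text{ over } G\in\mathbb R^{nd\times nd},\ G\succeq 0,\ G_{ii}=I_d\ (1\le i\le n),$$ where $\langle X,Y\rangle=\operatorname{Tr}(X^\top Y)$ and $G_{ii}$ is the $i$-th diagonal $d\times d$ block of $G$. **Theorem.** There are absolute constants $c>0$, $C_0>0$ and $\rho\in(0,1)$ such that in this setting, for every $\gamma>0$ with $$\sigma\ \le\ c\,\frac{\sigma_{\min}(A)}{\kappa^4}\cdot\frac{\sqrt n}{\sqrt d\,\bigl(\sqrt{nd}+\sqrt m+\sqrt{2\gamma n\log n}\bigr)},$$ the following holds with probability at least $1-C_0n^{-\gamma+2}$.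 There is $S^\infty\in O(d)^{\otimes n}$ such that: 1. $S^\infty$ is a fixed point of the GPM: $\mathcal P_n(CS^\infty)$ is uniquely determined and equals $S^\infty$. 2. Every GPM sequence $\{S^t\}_{t\ge0}$ with spectral initialization converges linearly to $S^\infty$: $$d_F(S^t,S^\infty)\le\rho^t\,d_F(S^0,S^\infty)\qquad\text{for all } t\ge 0,$$ and the limit is unique up to a global orthogonal transform: if $S'\in O(d)^{\otimes n}$ and $d_F(S^t,S')\to0$ for such a sequence, then $S'=S^\infty Q$ for some $Q\in O(d)$. 3. $S^\infty$ is a global maximizer of (P), and every global maximizer of (P) is of the form $S^\infty Q$ with $Q\in O(d)$. 4. $S^\infty(S^\infty)^\top$ is the unique global maximizer of (SDP); in particular the relaxation is tight. -/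

import Mathlib

open Matrix MeasureTheory ProbabilityTheory Filter Topology

noncomputable section

namespace Procrustes

variable {n d m k : ℕ}

/-- The `nd × k` matrix whose `i`-th `d × k` block is `X i`. -/
def stack (X : Fin n → Matrix (Fin d) (Fin k) ℝ) : Matrix (Fin n × Fin d) (Fin k) ℝ :=
  Matrix.of fun p b => X p.1 p.2 b

/-- The `i`-th `d × k` block of an `nd × k` matrix. -/
def block (X : Matrix (Fin n × Fin d) (Fin k) ℝ) (i : Fin n) : Matrix (Fin d) (Fin k) ℝ :=
  X.submatrix (fun a => (i, a)) id

/-- `O(d)^{⊗ n}`: the `nd × d` matrices all of whose `d × d` blocks are orthogonal. -/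
def orthStack (n d : ℕ) : Set (Matrix (Fin n × Fin d) (Fin d) ℝ) :=
  {S | ∀ i, block S i ∈ Matrix.orthogonalGroup (Fin d) ℝ}

/-- `sv X j` is the `j`-th largest singular value of `X`, counted from `j = 0`. -/
def sv {ι κ : Type*} [Fintype ι] [Fintype κ] [DecidableEq ι] [DecidableEq κ]
    (X : Matrix ι κ ℝ) (j : ℕ) : ℝ :=
  (Matrix.toEuclideanLin X).singularValues j

/-- The largest singular value. -/
def sigmaMax (A : Matrix (Fin d) (Fin m) ℝ) : ℝ := sv A 0

/-- The smallest singular value (the `d`-th largest one) of a `d × m` matrix, where `1 ≤ d ≤ m`. -/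
def sigmaMin (A : Matrix (Fin d) (Fin m) ℝ) : ℝ := sv A (d - 1)

/-- The condition number of `A`. -/
def condNumber (A : Matrix (Fin d) (Fin m) ℝ) : ℝ := sigmaMax A / sigmaMin A

/-- The trace inner product `⟨X, Y⟩ = Tr(Xᵀ Y)`. -/
def innerF {ι κ : Type*} [Fintype ι] [Fintype κ] (X Y : Matrix ι κ ℝ) : ℝ := (Xᵀ * Y).trace

/-- The Frobenius norm. -/
def normF {ι κ : Type*} [Fintype ι] [Fintype κ] (X : Matrix ι κ ℝ) : ℝ :=
  √(∑ i, ∑ j, X i j ^ 2)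

/-- `d_F(X, Y)`, the minimum over `Q ∈ O(d)` of `‖X - Y Q‖_F`
(the infimum is attained, `O(d)` being compact and nonempty). -/
def dF (X Y : Matrix (Fin n × Fin d) (Fin d) ℝ) : ℝ :=
  ⨅ Q : Matrix.orthogonalGroup (Fin d) ℝ, normF (X - Y * (Q : Matrix (Fin d) (Fin d) ℝ))

/-- `Q` is a value of `𝒫(X)`: `Q = U Vᵀ` for some singular value decomposition `X = U Σ Vᵀ`.
If `X` is invertible there is exactly one such `Q`; otherwise every admissible choice is allowed. -/
def IsPolar (X Q : Matrix (Fin d) (Fin d) ℝ) : Prop :=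
  ∃ U ∈ Matrix.orthogonalGroup (Fin d) ℝ, ∃ V ∈ Matrix.orthogonalGroup (Fin d) ℝ,
    ∃ s : Fin d → ℝ, (∀ a, 0 ≤ s a) ∧ X = U * Matrix.diagonal s * Vᵀ ∧ Q = U * Vᵀ

/-- `S` is a value of `𝒫ₙ(X)`: `𝒫` is applied to every `d × d` block. -/
def IsPolarStack (X S : Matrix (Fin n × Fin d) (Fin d) ℝ) : Prop :=
  ∀ i, IsPolar (block X i) (block S i)

/-- The columns of `U` are top `d` left singular vectors of `D`: they are orthonormal and, together
with some orthonormal right singular vectors (the columns of `V`), belong to the `d` largest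
singular values of `D`. -/
def IsTopLeftSingular (D : Matrix (Fin n × Fin d) (Fin m) ℝ)
    (U : Matrix (Fin n × Fin d) (Fin d) ℝ) : Prop :=
  Uᵀ * U = 1 ∧ ∃ V : Matrix (Fin m) (Fin d) ℝ, Vᵀ * V = 1 ∧
    D * V = U * Matrix.diagonal (fun j : Fin d => sv D j) ∧
    Dᵀ * U = V * Matrix.diagonal (fun j : Fin d => sv D j)

/-- `T` is the result of one step of the generalized power method from `S`, for the matrix
`C = D Dᵀ`. -/
def IsGPMStep (D : Matrix (Fin n × Fin d) (Fin m) ℝ)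
    (S T : Matrix (Fin n × Fin d) (Fin d) ℝ) : Prop :=
  IsPolarStack (D * Dᵀ * S) T

/-- `S` is a sequence of iterates of the generalized power method with spectral initialization. -/
def IsSpectralGPM (D : Matrix (Fin n × Fin d) (Fin m) ℝ)
    (S : ℕ → Matrix (Fin n × Fin d) (Fin d) ℝ) : Prop :=
  (∃ U, IsTopLeftSingular D U ∧ IsPolarStack U (S 0)) ∧ ∀ t, IsGPMStep D (S t) (S (t + 1))

/-- The objective `∑_{i<j} ⟨A_i A_jᵀ, S_i S_jᵀ⟩` of the program (P) for the point clouds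
`A_1, …, A_n`. -/
def objP (A : Fin n → Matrix (Fin d) (Fin m) ℝ) (S : Matrix (Fin n × Fin d) (Fin d) ℝ) : ℝ :=
  ∑ i, ∑ j ∈ Finset.Ioi i, innerF (A i * (A j)ᵀ) (block S i * (block S j)ᵀ)

/-- The feasible set of the semidefinite relaxation: `G ⪰ 0` with identity diagonal blocks. -/
def sdpFeasible (n d : ℕ) : Set (Matrix (Fin n × Fin d) (Fin n × Fin d) ℝ) :=
  {G | G.PosSemidef ∧ ∀ i, G.submatrix (fun a => (i, a)) (fun a => (i, a)) = 1}

/-- The objective `⟨C, G⟩`, with `C = D Dᵀ`, of the semidefinite relaxation. -/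
def objSDP (D : Matrix (Fin n × Fin d) (Fin m) ℝ)
    (G : Matrix (Fin n × Fin d) (Fin n × Fin d) ℝ) : ℝ :=
  innerF (D * Dᵀ) G

/-- The observed point clouds `A_i = O_i A + σ W_i`. -/
def data (A : Matrix (Fin d) (Fin m) ℝ) (O : Fin n → Matrix (Fin d) (Fin d) ℝ) (σ : ℝ)
    (W : Fin n → Matrix (Fin d) (Fin m) ℝ) (i : Fin n) : Matrix (Fin d) (Fin m) ℝ :=
  O i * A + σ • W i

/-- The entries of the `n` noise matrices are independent standard normal random variables. -/
structure IsGaussianNoise {Ω : Type*} [MeasurableSpace Ω] (μ : Measure Ω)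
    (W : Ω → Fin n → Matrix (Fin d) (Fin m) ℝ) : Prop where
  law : ∀ i a b, HasLaw (fun ω => W ω i a b) (gaussianReal 0 1) μ
  indep : iIndepFun (fun (p : Fin n × Fin d × Fin m) ω => W ω p.1 p.2.1 p.2.2) μ

/-- For the point clouds `A_1, …, A_n`, the stacked orthogonal matrix `Sinf` is a fixed point of the
generalized power method, to which every run with spectral initialization converges at the linear
rate `ρ` in `d_F`, and which is, up to a global orthogonal transform, the only limit in `d_F` of such
a run and the only maximizer of (P); moreover `Sinf Sinfᵀ` is the only maximizer of the semidefinite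
relaxation. -/
structure IsGPMSolution (A : Fin n → Matrix (Fin d) (Fin m) ℝ) (ρ : ℝ)
    (Sinf : Matrix (Fin n × Fin d) (Fin d) ℝ) : Prop where
  mem : Sinf ∈ orthStack n d
  fixed : ∀ T, IsGPMStep (stack A) Sinf T ↔ T = Sinf
  linear_conv : ∀ S, IsSpectralGPM (stack A) S → ∀ t, dF (S t) Sinf ≤ ρ ^ t * dF (S 0) Sinf
  unique_limit : ∀ S, IsSpectralGPM (stack A) S → ∀ S' ∈ orthStack n d,
    Tendsto (fun t => dF (S t) S') atTop (𝓝 0) →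
      ∃ Q ∈ Matrix.orthogonalGroup (Fin d) ℝ, S' = Sinf * Q
  max_P : IsMaxOn (objP A) (orthStack n d) Sinf
  unique_P : ∀ S' ∈ orthStack n d, IsMaxOn (objP A) (orthStack n d) S' →
    ∃ Q ∈ Matrix.orthogonalGroup (Fin d) ℝ, S' = Sinf * Q
  feasible_SDP : Sinf * Sinfᵀ ∈ sdpFeasible n d
  max_SDP : IsMaxOn (objSDP (stack A)) (sdpFeasible n d) (Sinf * Sinfᵀ)
  unique_SDP : ∀ G ∈ sdpFeasible n d, IsMaxOn (objSDP (stack A)) (sdpFeasible n d) G →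
    G = Sinf * Sinfᵀ

end Procrustes

end

/-! ### Frobenius norm and trace inner product -/

set_option linter.unusedSectionVars false

namespace Procrustes

section Frobenius

variable {ι κ l : Type*} [Fintype ι] [Fintype κ] [Fintype l]

/-! Write Z for the stack of the O_i, N for the scaled noise, D = ZA + N, C = DDᵀ and a for the
smallest singular value of A. The proof is deterministic apart from two facts: ‖N‖√d is small
against a√n, and each noise block is incoherent with certain iterates independent of it.

The candidate is a global maximizer S of (P), which exists by compactness. Against the aligned
ground truth, S loses signal quadratically in its distance and gains noise only linearly, so it lies
within `radius`, of order √n/κ², of Z (`dF_max_le`); convexity of the objective makes it a fixed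
point (`isPolarStack_of_isMax`). Everything then rests on the bound S_iᵀ(CS)_i ⪰ (na²/2)·1 for all
blocks (`posSemidef_max`), which is used twice.

Convergence: the perturbation bound `normF_polar_sub_le` for polar factors needs nondegeneracy of
only one of the two matrices, here the one at S. By `normF_contract`, C is small on an aligned
difference T - SQ, because Sᵀ(T - SQ) is of second order. So a step halves the distance to S from
any T within twice the radius, even if T has degenerate blocks or depends on all the noise. The
spectral initialization lies in that ball by a Wedin-type argument (`dF_spectral_le`).

Tightness: the block diagonal matrix with blocks (CS)_i S_iᵀ is a dual certificate. It agrees with C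
on the range of S and is at least na²/2, while C is at most na²/4 on the orthogonal complement
(`normF_data_orth_le`). The duality gap `objSDP_add_gap_le` makes SSᵀ the only solution of (SDP),
hence S the only solution of (P) up to a global rotation.

The block bound itself cannot be had from norms alone: N_i Dᵀ S would be overestimated by a factor
√n, and S depends on N_i. The remedy is leave-one-out. Run the power method from the deterministic
point Z, once with all the data and once with the i-th noise block deleted. The second run is
independent of N_i, so a Gaussian tail bound gives incoherence (`measure_block_mul_iterate_gt_le`);
the two runs stay within distance 1 (`polarIter_invariant`), over which incoherence can be
transferred (`incoherent_of_close`). The full run halves its distance to S at every step, so after n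
- 1 steps it is within 1 of S, and S inherits incoherence. The n blocks times n steps account for
the factor n² in the failure probability. -/

/-- A matrix as a vector of a Euclidean space; this turns `innerF` and `normF` into the standard
inner product and norm. -/
def vecF : Matrix ι κ ℝ →ₗ[ℝ] EuclideanSpace ℝ (ι × κ) where
  toFun X := WithLp.toLp 2 fun p => X p.1 p.2
  map_add' _ _ := rfl
  map_smul' _ _ := rfl

lemma vecF_apply (X : Matrix ι κ ℝ) (p : ι × κ) : vecF X p = X p.1 p.2 := rfl

lemma innerF_eq_sum (X Y : Matrix ι κ ℝ) : innerF X Y = ∑ i, ∑ j, X i j * Y i j := by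
  simp only [innerF, trace, diag_apply, mul_apply, transpose_apply]
  exact Finset.sum_comm

lemma innerF_eq_inner (X Y : Matrix ι κ ℝ) : innerF X Y = inner ℝ (vecF X) (vecF Y) := by
  rw [innerF_eq_sum, PiLp.inner_apply, Fintype.sum_prod_type]
  simp [vecF_apply, mul_comm]

lemma normF_eq_norm (X : Matrix ι κ ℝ) : normF X = ‖vecF X‖ := by
  rw [EuclideanSpace.norm_eq, normF, Fintype.sum_prod_type]
  simp [vecF_apply]

lemma normF_sq (X : Matrix ι κ ℝ) : normF X ^ 2 = innerF X X := by
  rw [normF_eq_norm, innerF_eq_inner, real_inner_self_eq_norm_sq]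

lemma normF_nonneg (X : Matrix ι κ ℝ) : 0 ≤ normF X := Real.sqrt_nonneg _

lemma normF_add_le (X Y : Matrix ι κ ℝ) : normF (X + Y) ≤ normF X + normF Y := by
  simp only [normF_eq_norm, map_add]; exact norm_add_le _ _

lemma normF_sub_le (X Y : Matrix ι κ ℝ) : normF (X - Y) ≤ normF X + normF Y := by
  simp only [normF_eq_norm, map_sub]; exact norm_sub_le _ _

lemma normF_sub_comm (X Y : Matrix ι κ ℝ) : normF (X - Y) = normF (Y - X) := by
  simp only [normF_eq_norm, map_sub]; exact norm_sub_rev _ _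

lemma normF_sub_triangle (X Y Z : Matrix ι κ ℝ) :
    normF (X - Z) ≤ normF (X - Y) + normF (Y - Z) := by
  simpa using normF_add_le (X - Y) (Y - Z)

lemma normF_smul (r : ℝ) (X : Matrix ι κ ℝ) : normF (r • X) = |r| * normF X := by
  simp [normF_eq_norm, norm_smul]

lemma normF_zero : normF (0 : Matrix ι κ ℝ) = 0 := by simp [normF]

lemma normF_eq_zero {X : Matrix ι κ ℝ} : normF X = 0 ↔ X = 0 := by
  refine ⟨fun h => ?_, fun h => h ▸ normF_zero⟩
  rw [normF_eq_norm, norm_eq_zero] at h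
  ext i j
  exact congrArg (fun v : EuclideanSpace ℝ (ι × κ) => v (i, j)) h

lemma normF_transpose (X : Matrix ι κ ℝ) : normF Xᵀ = normF X := by
  unfold normF; rw [Finset.sum_comm]; rfl

lemma innerF_comm (X Y : Matrix ι κ ℝ) : innerF X Y = innerF Y X := by
  simp only [innerF_eq_sum, mul_comm]

lemma innerF_add_left (X Y Z : Matrix ι κ ℝ) : innerF (X + Y) Z = innerF X Z + innerF Y Z := by
  simp [innerF_eq_inner, inner_add_left]

lemma innerF_add_right (X Y Z : Matrix ι κ ℝ) : innerF X (Y + Z) = innerF X Y + innerF X Z := by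
  simp [innerF_eq_inner, inner_add_right]

lemma innerF_sub_left (X Y Z : Matrix ι κ ℝ) : innerF (X - Y) Z = innerF X Z - innerF Y Z := by
  simp [innerF_eq_inner, inner_sub_left]

lemma innerF_sub_right (X Y Z : Matrix ι κ ℝ) : innerF X (Y - Z) = innerF X Y - innerF X Z := by
  simp [innerF_eq_inner, inner_sub_right]

lemma innerF_smul_left (r : ℝ) (X Y : Matrix ι κ ℝ) : innerF (r • X) Y = r * innerF X Y := by
  simp [innerF_eq_inner, real_inner_smul_left]

lemma innerF_smul_right (r : ℝ) (X Y : Matrix ι κ ℝ) : innerF X (r • Y) = r * innerF X Y := by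
  simp [innerF_eq_inner, real_inner_smul_right]

lemma innerF_transpose (X Y : Matrix ι κ ℝ) : innerF Xᵀ Yᵀ = innerF X Y := by
  simp only [innerF_eq_sum, transpose_apply]; exact Finset.sum_comm

lemma innerF_mul_left (A : Matrix l ι ℝ) (X : Matrix ι κ ℝ) (Y : Matrix l κ ℝ) :
    innerF (A * X) Y = innerF X (Aᵀ * Y) := by
  simp [innerF, Matrix.mul_assoc]

lemma innerF_mul_right (X : Matrix ι κ ℝ) (A : Matrix κ l ℝ) (Y : Matrix ι l ℝ) :
    innerF (X * A) Y = innerF X (Y * Aᵀ) := by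
  rw [← innerF_transpose, transpose_mul, innerF_mul_left, ← innerF_transpose]
  simp

lemma normF_transpose_mul_sq (D : Matrix ι l ℝ) (X : Matrix ι κ ℝ) :
    normF (Dᵀ * X) ^ 2 = innerF (D * Dᵀ * X) X := by
  rw [normF_sq, Matrix.mul_assoc D, innerF_mul_left D]

lemma abs_innerF_le (X Y : Matrix ι κ ℝ) : |innerF X Y| ≤ normF X * normF Y := by
  simp only [innerF_eq_inner, normF_eq_norm]; exact abs_real_inner_le_norm _ _

lemma innerF_le (X Y : Matrix ι κ ℝ) : innerF X Y ≤ normF X * normF Y :=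
  (le_abs_self _).trans (abs_innerF_le X Y)

lemma normF_sub_sq (X Y : Matrix ι κ ℝ) :
    normF (X - Y) ^ 2 = normF X ^ 2 - 2 * innerF X Y + normF Y ^ 2 := by
  simp only [innerF_eq_inner, normF_eq_norm, map_sub]; exact norm_sub_sq_real _ _

lemma normF_add_sq (X Y : Matrix ι κ ℝ) :
    normF (X + Y) ^ 2 = normF X ^ 2 + 2 * innerF X Y + normF Y ^ 2 := by
  simp only [innerF_eq_inner, normF_eq_norm, map_add]; exact norm_add_sq_real _ _

lemma normF_le_of_sq_le {X : Matrix ι κ ℝ} {r : ℝ} (hr : 0 ≤ r) (h : normF X ^ 2 ≤ r ^ 2) :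
    normF X ≤ r :=
  le_of_sq_le_sq h hr

lemma innerF_self_nonneg (X : Matrix ι κ ℝ) : 0 ≤ innerF X X := by
  rw [← normF_sq]; positivity

lemma trace_eq_innerF_one [DecidableEq ι] (X : Matrix ι ι ℝ) : X.trace = innerF 1 X := by
  simp [innerF]

lemma exists_eq_transpose_mul_self {K : Matrix κ κ ℝ} (hK : K.PosSemidef) :
    ∃ (r : ℕ) (B : Matrix (Fin r) κ ℝ), K = Bᵀ * B := by
  obtain ⟨r, v, rfl⟩ := posSemidef_iff_eq_sum_vecMulVec.1 hK
  refine ⟨r, Matrix.of v, ?_⟩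
  ext i j
  simp [Matrix.sum_apply, vecMulVec_apply, mul_apply]

lemma innerF_mul_posSemidef_nonneg {K : Matrix κ κ ℝ} (hK : K.PosSemidef) (E : Matrix ι κ ℝ) :
    0 ≤ innerF (E * K) E := by
  obtain ⟨r, B, rfl⟩ := exists_eq_transpose_mul_self hK
  have : innerF (E * (Bᵀ * B)) E = innerF (E * Bᵀ) (E * Bᵀ) := by
    rw [← Matrix.mul_assoc, innerF_mul_right]
  rw [this]; exact innerF_self_nonneg _

lemma innerF_posSemidef_mul_nonneg {K : Matrix ι ι ℝ} (hK : K.PosSemidef) (E : Matrix ι κ ℝ) :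
    0 ≤ innerF (K * E) E := by
  have h := innerF_mul_posSemidef_nonneg hK Eᵀ
  rw [← innerF_transpose] at h
  have hs : Kᵀ = K := by simpa [conjTranspose_eq_transpose_of_trivial] using hK.1.eq
  simpa [transpose_mul, hs] using h

lemma normF_replicateCol_sq (x : ι → ℝ) : normF (replicateCol (Fin 1) x) ^ 2 = x ⬝ᵥ x := by
  rw [normF_sq, innerF_eq_sum]; simp [dotProduct]

lemma posSemidef_of_innerF {K : Matrix ι ι ℝ} (hK : Kᵀ = K)
    (h : ∀ E : Matrix ι (Fin 1) ℝ, 0 ≤ innerF (K * E) E) : K.PosSemidef := by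
  refine PosSemidef.of_dotProduct_mulVec_nonneg
    (by simpa [IsHermitian, conjTranspose_eq_transpose_of_trivial] using hK) fun x => ?_
  have := h (replicateCol (Fin 1) x)
  rw [innerF_comm, innerF_eq_sum] at this
  simpa [dotProduct, mul_apply, mulVec] using this

lemma normF_sq_eq_sum_col (X : Matrix ι κ ℝ) :
    normF X ^ 2 = ∑ j, ‖WithLp.toLp 2 (X.col j)‖ ^ 2 := by
  rw [normF, Real.sq_sqrt (by positivity), Finset.sum_comm]
  simp [EuclideanSpace.norm_sq_eq]

/-! ### Operator norm against Frobenius norm. -/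

section OpNorm

open scoped Matrix.Norms.L2Operator

variable [DecidableEq ι] [DecidableEq κ]

lemma normF_mul_le_op (N : Matrix ι κ ℝ) (X : Matrix κ l ℝ) :
    normF (N * X) ≤ ‖N‖ * normF X := by
  refine normF_le_of_sq_le (mul_nonneg (norm_nonneg _) (normF_nonneg _)) ?_
  rw [mul_pow, normF_sq_eq_sum_col, normF_sq_eq_sum_col, Finset.mul_sum]
  refine Finset.sum_le_sum fun j _ => ?_
  rw [← mul_pow]
  gcongr
  exact l2_opNorm_mulVec N (WithLp.toLp 2 (X.col j))

lemma norm_transpose (N : Matrix ι κ ℝ) : ‖Nᵀ‖ = ‖N‖ := by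
  rw [← conjTranspose_eq_transpose_of_trivial, l2_opNorm_conjTranspose]

lemma normF_mul_le_op' (X : Matrix l ι ℝ) (N : Matrix ι κ ℝ) :
    normF (X * N) ≤ normF X * ‖N‖ := by
  rw [← normF_transpose, transpose_mul, mul_comm, ← normF_transpose X, ← norm_transpose N]
  exact normF_mul_le_op _ _

/-- Single columns already test the operator norm, so operator-norm bounds can be reached through
`normF` without passing to vectors. -/
lemma opNorm_le_of_normF {N : Matrix ι κ ℝ} {r : ℝ} (hr : 0 ≤ r)
    (h : ∀ E : Matrix κ (Fin 1) ℝ, normF (N * E) ≤ r * normF E) : ‖N‖ ≤ r := by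
  rw [l2_opNorm_def]
  refine ContinuousLinearMap.opNorm_le_bound _ hr fun x => ?_
  have h1 := h (replicateCol (Fin 1) x)
  have e1 : normF (N * replicateCol (Fin 1) (x : κ → ℝ)) = ‖WithLp.toLp 2 (N *ᵥ x)‖ := by
    rw [← pow_left_inj₀ (normF_nonneg _) (norm_nonneg _) two_ne_zero, normF_sq_eq_sum_col]
    simp [EuclideanSpace.norm_sq_eq, mul_apply, mulVec, dotProduct]
  have e2 : normF (replicateCol (Fin 1) (x : κ → ℝ)) = ‖x‖ := by
    rw [← pow_left_inj₀ (normF_nonneg _) (norm_nonneg _) two_ne_zero, normF_sq_eq_sum_col]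
    simp [EuclideanSpace.norm_sq_eq]
  rw [e1, e2] at h1
  exact h1

lemma opNorm_le_normF (N : Matrix ι κ ℝ) : ‖N‖ ≤ normF N := by
  refine opNorm_le_of_normF (normF_nonneg _) fun E => ?_
  rw [← Real.sqrt_sq (normF_nonneg (N * E))]
  rw [Real.sqrt_le_left (mul_nonneg (normF_nonneg _) (normF_nonneg _)), mul_pow]
  simp only [normF]
  rw [Real.sq_sqrt (by positivity), Real.sq_sqrt (by positivity), Real.sq_sqrt (by positivity)]
  simp only [Fin.sum_univ_one, mul_apply]
  rw [Finset.sum_mul]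
  exact Finset.sum_le_sum fun i _ => Finset.sum_mul_sq_le_sq_mul_sq _ _ _

lemma normF_mul_le (X : Matrix ι κ ℝ) (Y : Matrix κ l ℝ) : normF (X * Y) ≤ normF X * normF Y :=
  (normF_mul_le_op X Y).trans (mul_le_mul_of_nonneg_right (opNorm_le_normF X) (normF_nonneg _))

lemma normF_one_fin (d : ℕ) : normF (1 : Matrix (Fin d) (Fin d) ℝ) = √d := by
  simp [normF, one_apply]

lemma normF_le_sqrt_mul_op {d : ℕ} (X : Matrix ι (Fin d) ℝ) : normF X ≤ √d * ‖X‖ := by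
  have := normF_mul_le_op X (1 : Matrix (Fin d) (Fin d) ℝ)
  rwa [Matrix.mul_one, normF_one_fin, mul_comm] at this

end OpNorm

end Frobenius

/-! ### Orthogonal matrices and blocks -/

section Orthogonal

variable {n d m k : ℕ} {ι : Type*} [Fintype ι]

lemma transpose_mul_self_of_mem {Q : Matrix (Fin d) (Fin d) ℝ}
    (hQ : Q ∈ Matrix.orthogonalGroup (Fin d) ℝ) : Qᵀ * Q = 1 := by
  have := (mem_orthogonalGroup_iff' (Fin d) ℝ).1 hQ
  simpa [star_eq_conjTranspose, conjTranspose_eq_transpose_of_trivial] using this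

lemma mul_transpose_self_of_mem {Q : Matrix (Fin d) (Fin d) ℝ}
    (hQ : Q ∈ Matrix.orthogonalGroup (Fin d) ℝ) : Q * Qᵀ = 1 := by
  have := (mem_orthogonalGroup_iff (Fin d) ℝ).1 hQ
  simpa [star_eq_conjTranspose, conjTranspose_eq_transpose_of_trivial] using this

lemma mem_orthogonal_of_mul_transpose {Q : Matrix (Fin d) (Fin d) ℝ} (h : Q * Qᵀ = 1) :
    Q ∈ Matrix.orthogonalGroup (Fin d) ℝ := by
  rw [mem_orthogonalGroup_iff]
  simpa [star_eq_conjTranspose, conjTranspose_eq_transpose_of_trivial] using h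

lemma transpose_mem_orthogonal {Q : Matrix (Fin d) (Fin d) ℝ}
    (hQ : Q ∈ Matrix.orthogonalGroup (Fin d) ℝ) : Qᵀ ∈ Matrix.orthogonalGroup (Fin d) ℝ :=
  mem_orthogonal_of_mul_transpose (by simpa using transpose_mul_self_of_mem hQ)

lemma normF_mul_orthogonal {Q : Matrix (Fin d) (Fin d) ℝ}
    (hQ : Q ∈ Matrix.orthogonalGroup (Fin d) ℝ) (X : Matrix ι (Fin d) ℝ) :
    normF (X * Q) = normF X := by
  rw [← pow_left_inj₀ (normF_nonneg _) (normF_nonneg _) two_ne_zero, normF_sq, normF_sq,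
    innerF_mul_right, Matrix.mul_assoc, mul_transpose_self_of_mem hQ, Matrix.mul_one]

lemma normF_isometry_mul {U : Matrix ι (Fin d) ℝ} {r : ℝ} (hU : Uᵀ * U = r • 1) (hr : 0 ≤ r)
    (X : Matrix (Fin d) (Fin k) ℝ) : normF (U * X) = √r * normF X := by
  rw [← pow_left_inj₀ (normF_nonneg _) (mul_nonneg (Real.sqrt_nonneg _) (normF_nonneg _))
    two_ne_zero, mul_pow, Real.sq_sqrt hr, normF_sq, normF_sq,
    innerF_mul_left, ← Matrix.mul_assoc, hU, smul_mul, Matrix.one_mul, innerF_smul_right]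

lemma normF_orthogonal_mul {Q : Matrix (Fin d) (Fin d) ℝ}
    (hQ : Q ∈ Matrix.orthogonalGroup (Fin d) ℝ) (X : Matrix (Fin d) (Fin k) ℝ) :
    normF (Q * X) = normF X := by
  simpa using normF_isometry_mul (r := 1) (by simpa using transpose_mul_self_of_mem hQ)
    zero_le_one X

lemma normF_orthogonal {Q : Matrix (Fin d) (Fin d) ℝ}
    (hQ : Q ∈ Matrix.orthogonalGroup (Fin d) ℝ) : normF Q = √d := by
  have := normF_orthogonal_mul hQ (1 : Matrix (Fin d) (Fin d) ℝ)
  rwa [Matrix.mul_one, normF_one_fin] at this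

lemma block_mul (X : Matrix (Fin n × Fin d) (Fin k) ℝ) (Y : Matrix (Fin k) (Fin m) ℝ) (i : Fin n) :
    block (X * Y) i = block X i * Y := rfl

lemma block_add (X Y : Matrix (Fin n × Fin d) (Fin k) ℝ) (i : Fin n) :
    block (X + Y) i = block X i + block Y i := rfl

lemma block_sub (X Y : Matrix (Fin n × Fin d) (Fin k) ℝ) (i : Fin n) :
    block (X - Y) i = block X i - block Y i := rfl

lemma block_smul (r : ℝ) (X : Matrix (Fin n × Fin d) (Fin k) ℝ) (i : Fin n) :
    block (r • X) i = r • block X i := rfl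

lemma block_stack (X : Fin n → Matrix (Fin d) (Fin k) ℝ) (i : Fin n) : block (stack X) i = X i :=
  rfl

lemma block_ext {X Y : Matrix (Fin n × Fin d) (Fin k) ℝ} (h : ∀ i, block X i = block Y i) :
    X = Y := by
  ext ⟨i, a⟩ b
  exact congrFun (congrFun (h i) a) b

lemma innerF_eq_sum_block (X Y : Matrix (Fin n × Fin d) (Fin k) ℝ) :
    innerF X Y = ∑ i, innerF (block X i) (block Y i) := by
  simp only [innerF_eq_sum, Fintype.sum_prod_type]; rfl

lemma normF_sq_eq_sum_block (X : Matrix (Fin n × Fin d) (Fin k) ℝ) :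
    normF X ^ 2 = ∑ i, normF (block X i) ^ 2 := by
  simp only [normF_sq, innerF_eq_sum_block X X]

lemma normF_block_le (X : Matrix (Fin n × Fin d) (Fin k) ℝ) (i : Fin n) :
    normF (block X i) ≤ normF X := by
  refine normF_le_of_sq_le (normF_nonneg _) ?_
  rw [normF_sq_eq_sum_block X]
  exact Finset.single_le_sum (f := fun i => normF (block X i) ^ 2) (fun _ _ => by positivity)
    (Finset.mem_univ i)

lemma transpose_mul_eq_sum_block (X : Matrix (Fin n × Fin d) (Fin k) ℝ)
    (Y : Matrix (Fin n × Fin d) (Fin m) ℝ) : Xᵀ * Y = ∑ i, (block X i)ᵀ * block Y i := by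
  ext a b
  simp [mul_apply, Matrix.sum_apply, Fintype.sum_prod_type, block]

lemma normF_le_of_block_le {X Y : Matrix (Fin n × Fin d) (Fin k) ℝ} {r : ℝ} (hr : 0 ≤ r)
    (h : ∀ i, normF (block X i) ≤ r * normF (block Y i)) : normF X ≤ r * normF Y := by
  refine normF_le_of_sq_le (mul_nonneg hr (normF_nonneg _)) ?_
  rw [mul_pow, normF_sq_eq_sum_block X, normF_sq_eq_sum_block Y, Finset.mul_sum]
  refine Finset.sum_le_sum fun i _ => ?_
  rw [← mul_pow]
  have := normF_nonneg (block X i)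
  gcongr
  exact h i

variable {S : Matrix (Fin n × Fin d) (Fin d) ℝ}

lemma transpose_mul_self_of_mem_orthStack (hS : S ∈ orthStack n d) : Sᵀ * S = (n : ℝ) • 1 := by
  rw [transpose_mul_eq_sum_block, Finset.sum_congr rfl fun i _ => transpose_mul_self_of_mem (hS i)]
  simp [← Nat.cast_smul_eq_nsmul ℝ]

lemma normF_orthStack_mul (hS : S ∈ orthStack n d) (X : Matrix (Fin d) (Fin k) ℝ) :
    normF (S * X) = √n * normF X :=
  normF_isometry_mul (transpose_mul_self_of_mem_orthStack hS) (Nat.cast_nonneg n) X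

lemma normF_orthStack (hS : S ∈ orthStack n d) : normF S = √n * √d := by
  rw [← normF_one_fin d, ← normF_orthStack_mul hS, Matrix.mul_one]

lemma mul_mem_orthStack (hS : S ∈ orthStack n d) {Q : Matrix (Fin d) (Fin d) ℝ}
    (hQ : Q ∈ Matrix.orthogonalGroup (Fin d) ℝ) : S * Q ∈ orthStack n d := fun i => by
  rw [block_mul]; exact mul_mem (hS i) hQ

open scoped Matrix.Norms.L2Operator in
lemma norm_orthStack_le (hS : S ∈ orthStack n d) : ‖S‖ ≤ √n :=
  opNorm_le_of_normF (Real.sqrt_nonneg _) fun E => (normF_orthStack_mul hS E).le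

end Orthogonal

/-! ### Polar factors -/

section Polar

variable {n d : ℕ}

lemma isHermitian_iff_transpose {ι : Type*} {H : Matrix ι ι ℝ} : H.IsHermitian ↔ Hᵀ = H := by
  rw [IsHermitian, conjTranspose_eq_transpose_of_trivial]

/-- Orthogonality gives ⟨P, PH⟩ = ⟨Q, QH⟩ = tr H, so only the cross terms survive. Thus the loss in
⟨·, PH⟩ on moving from P to Q is exactly quadratic in P - Q, which is the source of the optimality
and perturbation bounds for polar factors. -/
lemma innerF_sub_orthogonal {P Q H : Matrix (Fin d) (Fin d) ℝ}
    (hP : P ∈ Matrix.orthogonalGroup (Fin d) ℝ) (hQ : Q ∈ Matrix.orthogonalGroup (Fin d) ℝ)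
    (hH : Hᵀ = H) :
    innerF (P - Q) (P * H) = 1 / 2 * innerF ((P - Q) * H) (P - Q) := by
  have h1 : ∀ R ∈ Matrix.orthogonalGroup (Fin d) ℝ, innerF R (R * H) = innerF 1 H := by
    intro R hR
    rw [innerF_comm, innerF_mul_left, transpose_mul_self_of_mem hR, innerF_comm]
  have h2 : innerF Q (P * H) = innerF P (Q * H) := by
    rw [innerF_comm, innerF_mul_right, hH]
  have h3 : innerF (P * H) P = innerF 1 H := by rw [innerF_comm, h1 P hP]
  have h4 : innerF (Q * H) Q = innerF 1 H := by rw [innerF_comm, h1 Q hQ]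
  have h5 : innerF (P * H) Q = innerF Q (P * H) := innerF_comm _ _
  have h6 : innerF (Q * H) P = innerF P (Q * H) := innerF_comm _ _
  rw [Matrix.sub_mul, innerF_sub_left, innerF_sub_right, innerF_sub_left, innerF_sub_left,
    h1 P hP, h3, h4, h5, h6, h2]
  ring

lemma innerF_vecMulVec (u v : Fin d → ℝ) (M : Matrix (Fin d) (Fin d) ℝ) :
    innerF (vecMulVec u v) M = u ⬝ᵥ M *ᵥ v := by
  rw [innerF_eq_sum]
  simp only [vecMulVec_apply, dotProduct, mulVec, Finset.mul_sum]
  exact Finset.sum_congr rfl fun i _ => Finset.sum_congr rfl fun j _ => by ring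

/-- The reflection in the hyperplane orthogonal to `u`. -/
noncomputable def householder (u : Fin d → ℝ) : Matrix (Fin d) (Fin d) ℝ :=
  1 - (2 / (u ⬝ᵥ u)) • vecMulVec u u

lemma householder_mem {u : Fin d → ℝ} (hu : u ⬝ᵥ u ≠ 0) :
    householder u ∈ Matrix.orthogonalGroup (Fin d) ℝ := by
  refine mem_orthogonal_of_mul_transpose ?_
  have hT : (householder u)ᵀ = householder u := by
    simp [householder, transpose_vecMulVec]
  rw [hT, householder]
  simp only [Matrix.sub_mul, Matrix.mul_sub, Matrix.one_mul, Matrix.mul_one, smul_mul, Matrix.mul_smul,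
    vecMulVec_mul_vecMulVec, smul_smul, vecMulVec_smul]
  rw [div_mul_cancel₀ _ hu]
  module

/-- First-order optimality on O(d), tested only on reflections and products of two reflections. A
product of two nearby reflections is a small rotation and yields symmetry; a single reflection
yields nonnegativity of the quadratic form. Polar factors can then be obtained by compactness. -/
lemma posSemidef_of_forall_innerF_le {M : Matrix (Fin d) (Fin d) ℝ}
    (h : ∀ R ∈ Matrix.orthogonalGroup (Fin d) ℝ, innerF R M ≤ innerF 1 M) : M.PosSemidef := by
  have hne : ∀ u : Fin d → ℝ, u ≠ 0 → 0 < u ⬝ᵥ u := fun u hu => by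
    simpa using dotProduct_star_self_pos_iff.2 hu
  refine PosSemidef.of_dotProduct_mulVec_nonneg ?_ fun u => ?_
  · rw [isHermitian_iff_transpose]
    ext q p
    rw [transpose_apply]
    -- The rotation in the plane of p and q, obtained by reflecting in e_p and in e_p + ε e_q: the
    -- first order in ε sees the antisymmetric part of M, and the error is quadratic.
    have key : ∀ ε : ℝ, ε * (M q p - M p q) ≤ ε ^ 2 * (M p p + M q q) := by
      intro ε
      by_cases hpq : p = q
      · subst hpq
        have h1 := hne (Pi.single p 1) (by simp)
        have h2 := h _ (householder_mem h1.ne')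
        rw [householder, innerF_sub_left, innerF_smul_left, innerF_vecMulVec] at h2
        simp at h2
        nlinarith [sq_nonneg ε]
      set v : Fin d → ℝ := Pi.single p 1 with hv
      set u : Fin d → ℝ := Pi.single p 1 + Pi.single q ε with hu
      have huu : u ⬝ᵥ u = 1 + ε ^ 2 := by
        simp [hu, dotProduct_add, hpq, Ne.symm hpq]; ring
      have hvv : v ⬝ᵥ v = 1 := by simp [hv]
      have huv : u ⬝ᵥ v = 1 := by simp [hu, hv, Ne.symm hpq]
      have huu0 : (0 : ℝ) < 1 + ε ^ 2 := by positivity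
      have h1 := h _ (mul_mem (householder_mem (u := u) (by rw [huu]; exact huu0.ne'))
        (householder_mem (u := v) (by rw [hvv]; exact one_ne_zero)))
      have e : householder u * householder v = 1 - (2 / (1 + ε ^ 2)) • vecMulVec u u
          - (2 : ℝ) • vecMulVec v v + (4 / (1 + ε ^ 2)) • vecMulVec u v := by
        rw [householder, householder, huu, hvv]
        simp only [Matrix.sub_mul, Matrix.mul_sub, Matrix.one_mul, Matrix.mul_one, smul_mul,
          Matrix.mul_smul, vecMulVec_mul_vecMulVec, huv, one_smul, div_one]
        module
      rw [e] at h1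
      simp only [innerF_add_left, innerF_sub_left, innerF_smul_left, innerF_vecMulVec] at h1
      have e1 : u ⬝ᵥ M *ᵥ u = M p p + ε * (M p q + M q p) + ε ^ 2 * M q q := by
        simp [hu, add_dotProduct, mulVec_add, dotProduct_add, mulVec_single]; ring
      have e2 : v ⬝ᵥ M *ᵥ v = M p p := by simp [hv]
      have e3 : u ⬝ᵥ M *ᵥ v = M p p + ε * M q p := by
        simp [hu, hv, add_dotProduct]
      rw [e1, e2, e3] at h1
      have h2 : (4 / (1 + ε ^ 2)) * (M p p + ε * M q p) -
        (2 / (1 + ε ^ 2)) * (M p p + ε * (M p q + M q p) + ε ^ 2 * M q q) - 2 * M p p ≤ 0 := by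
        linarith
      have h3 := mul_le_mul_of_nonneg_left h2 huu0.le
      have h4 : (1 + ε ^ 2) * ((4 / (1 + ε ^ 2)) * (M p p + ε * M q p) -
        (2 / (1 + ε ^ 2)) * (M p p + ε * (M p q + M q p) + ε ^ 2 * M q q) - 2 * M p p) =
        4 * (M p p + ε * M q p) - 2 * (M p p + ε * (M p q + M q p) + ε ^ 2 * M q q)
          - 2 * M p p * (1 + ε ^ 2) := by
        field_simp
      rw [h4] at h3
      nlinarith
    set α := M q p - M p q with hα
    set β := M p p + M q q with hβ
    have hα0 : α = 0 := by
      by_contra hne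
      -- This ε has the sign of α and is so small that the quadratic term cannot compensate the
      -- linear one.
      have k1 := key (α / (|β| + 1))
      have hb : 0 < |β| + 1 := by positivity
      have k2 : α / (|β| + 1) * α = α ^ 2 / (|β| + 1) := by ring
      have k3 : (α / (|β| + 1)) ^ 2 * β ≤ α ^ 2 / (|β| + 1) * (|β| / (|β| + 1)) := by
        rw [div_pow, div_mul_div_comm, ← pow_two, div_mul_eq_mul_div]
        gcongr
        exact le_abs_self β
      have k4 : |β| / (|β| + 1) < 1 := by rw [div_lt_one hb]; linarith
      have k5 : 0 < α ^ 2 / (|β| + 1) := by positivity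
      nlinarith
    linarith
  · by_cases hu : u = 0
    · simp [hu]
    have h1 := hne u hu
    have h2 := h _ (householder_mem h1.ne')
    rw [householder, innerF_sub_left, innerF_smul_left, innerF_vecMulVec] at h2
    have h3 : 0 ≤ 2 / (u ⬝ᵥ u) * (u ⬝ᵥ M *ᵥ u) := by linarith
    have h4 : 0 < 2 / (u ⬝ᵥ u) := by positivity
    simpa using nonneg_of_mul_nonneg_right h3 h4

lemma isCompact_of_isClosed_of_entries {ι κ : Type*} {s : Set (Matrix ι κ ℝ)} (hs : IsClosed s)
    (h : ∀ M ∈ s, ∀ i j, M i j ∈ Set.Icc (-1 : ℝ) 1) : IsCompact s := by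
  have hK : IsCompact (Set.univ.pi fun _ : ι => Set.univ.pi fun _ : κ => Set.Icc (-1 : ℝ) 1) :=
    isCompact_univ_pi fun _ => isCompact_univ_pi fun _ => isCompact_Icc
  exact hK.of_isClosed_subset hs fun M hM i _ j _ => h M hM i j

lemma isClosed_orthogonal :
    IsClosed {Q : Matrix (Fin d) (Fin d) ℝ | Q ∈ Matrix.orthogonalGroup (Fin d) ℝ} := by
  have : {Q : Matrix (Fin d) (Fin d) ℝ | Q ∈ Matrix.orthogonalGroup (Fin d) ℝ} =
      {Q | Q * Qᵀ = 1} := by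
    ext Q; exact ⟨mul_transpose_self_of_mem, mem_orthogonal_of_mul_transpose⟩
  rw [this]
  exact isClosed_eq (by fun_prop) continuous_const

lemma entry_mem_of_orthogonal {Q : Matrix (Fin d) (Fin d) ℝ}
    (hQ : Q ∈ Matrix.orthogonalGroup (Fin d) ℝ) (i j : Fin d) : Q i j ∈ Set.Icc (-1 : ℝ) 1 := by
  have := entry_norm_bound_of_unitary (𝕜 := ℝ) hQ i j
  rwa [Real.norm_eq_abs, abs_le] at this

lemma isCompact_orthogonal :
    IsCompact {Q : Matrix (Fin d) (Fin d) ℝ | Q ∈ Matrix.orthogonalGroup (Fin d) ℝ} :=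
  isCompact_of_isClosed_of_entries isClosed_orthogonal fun _ h => entry_mem_of_orthogonal h

lemma isCompact_orthStack : IsCompact (orthStack n d) := by
  refine isCompact_of_isClosed_of_entries ?_ fun S hS p j => entry_mem_of_orthogonal (hS p.1) p.2 j
  have : orthStack n d = ⋂ i, (fun S => block S i) ⁻¹'
      {Q : Matrix (Fin d) (Fin d) ℝ | Q ∈ Matrix.orthogonalGroup (Fin d) ℝ} := by
    ext S; simp [orthStack]
  rw [this]
  refine isClosed_iInter fun i => isClosed_orthogonal.preimage ?_
  exact continuous_id.matrix_submatrix _ _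

lemma posSemidef_of_forall_innerF_le' {P X : Matrix (Fin d) (Fin d) ℝ}
    (hP : P ∈ Matrix.orthogonalGroup (Fin d) ℝ)
    (h : ∀ R ∈ Matrix.orthogonalGroup (Fin d) ℝ, innerF R X ≤ innerF P X) :
    (Pᵀ * X).PosSemidef := by
  refine posSemidef_of_forall_innerF_le fun R hR => ?_
  have h1 := h _ (mul_mem hP hR)
  rw [innerF_mul_left] at h1
  rwa [← innerF_mul_left P 1 X, Matrix.mul_one]

/-- A maximizer of ⟨·, X⟩ over the compact group O(d) works, also for singular X. -/
lemma exists_polar (X : Matrix (Fin d) (Fin d) ℝ) :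
    ∃ P ∈ Matrix.orthogonalGroup (Fin d) ℝ, (Pᵀ * X).PosSemidef := by
  obtain ⟨P, hP, hmax⟩ := (isCompact_orthogonal (d := d)).exists_isMaxOn ⟨1, one_mem (Matrix.orthogonalGroup (Fin d) ℝ)⟩
    (f := fun Q => innerF Q X) (by unfold innerF; fun_prop)
  exact ⟨P, hP, posSemidef_of_forall_innerF_le' hP fun R hR => hmax hR⟩

lemma innerF_le_of_posSemidef {P Q X : Matrix (Fin d) (Fin d) ℝ}
    (hP : P ∈ Matrix.orthogonalGroup (Fin d) ℝ) (hQ : Q ∈ Matrix.orthogonalGroup (Fin d) ℝ)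
    (h : (Pᵀ * X).PosSemidef) : innerF Q X ≤ innerF P X := by
  have h1 := innerF_sub_orthogonal hP hQ (isHermitian_iff_transpose.1 h.1)
  rw [← Matrix.mul_assoc, mul_transpose_self_of_mem hP, Matrix.one_mul, innerF_sub_left] at h1
  have := innerF_mul_posSemidef_nonneg h (P - Q)
  linarith

/-- The working form of 𝒫: no singular value decomposition appears, and singular X needs no separate
case. Conversely, a decomposition of X comes from diagonalizing PᵀX. -/
lemma isPolar_iff {X P : Matrix (Fin d) (Fin d) ℝ} :
    IsPolar X P ↔ P ∈ Matrix.orthogonalGroup (Fin d) ℝ ∧ (Pᵀ * X).PosSemidef := by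
  constructor
  · rintro ⟨U, hU, V, hV, s, hs, rfl, rfl⟩
    refine ⟨mul_mem hU (transpose_mem_orthogonal hV), ?_⟩
    have : (U * Vᵀ)ᵀ * (U * diagonal s * Vᵀ) = V * diagonal s * Vᴴ := by
      rw [transpose_mul, transpose_transpose, conjTranspose_eq_transpose_of_trivial,
        show V * Uᵀ * (U * diagonal s * Vᵀ) = V * (Uᵀ * U) * diagonal s * Vᵀ by
          simp only [Matrix.mul_assoc], transpose_mul_self_of_mem hU, Matrix.mul_one]
    rw [this]
    exact (PosSemidef.diagonal hs).mul_mul_conjTranspose_same V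
  · rintro ⟨hP, h⟩
    have hV : (h.1.eigenvectorUnitary : Matrix (Fin d) (Fin d) ℝ) ∈
      Matrix.orthogonalGroup (Fin d) ℝ := h.1.eigenvectorUnitary.2
    set V : Matrix (Fin d) (Fin d) ℝ := (h.1.eigenvectorUnitary : unitaryGroup (Fin d) ℝ).1 with hVdef
    refine ⟨P * V, mul_mem hP hV, V, hV, h.1.eigenvalues, h.eigenvalues_nonneg, ?_, ?_⟩
    · have hs : Pᵀ * X = V * diagonal h.1.eigenvalues * Vᵀ := by
        have := h.1.spectral_theorem
        rw [Unitary.conjStarAlgAut_apply] at this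
        simpa [star_eq_conjTranspose, conjTranspose_eq_transpose_of_trivial, hVdef,
          Function.comp_def] using this
      rw [Matrix.mul_assoc, Matrix.mul_assoc, ← Matrix.mul_assoc V, ← hs, ← Matrix.mul_assoc,
        mul_transpose_self_of_mem hP, Matrix.one_mul]
    · rw [Matrix.mul_assoc, mul_transpose_self_of_mem hV, Matrix.mul_one]

/-- Perturbation bound for polar factors; only one of the two matrices is assumed to be
nonsingular. -/
lemma normF_polar_sub_le {X Y P Q : Matrix (Fin d) (Fin d) ℝ} {s : ℝ} (hs : 0 < s)
    (hP : P ∈ Matrix.orthogonalGroup (Fin d) ℝ) (hX : (Pᵀ * X).PosSemidef)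
    (hQ : Q ∈ Matrix.orthogonalGroup (Fin d) ℝ) (hY : (Qᵀ * Y - s • 1).PosSemidef) :
    normF (P - Q) ≤ 2 / s * normF (X - Y) := by
  have h1 := innerF_le_of_posSemidef hP hQ hX
  have hsym : (Qᵀ * Y)ᵀ = Qᵀ * Y := by
    have := isHermitian_iff_transpose.1 hY.1
    rw [transpose_sub] at this
    simpa using this
  have h2 := innerF_sub_orthogonal hQ hP hsym
  rw [← Matrix.mul_assoc Q, mul_transpose_self_of_mem hQ, Matrix.one_mul] at h2
  have h3 := innerF_mul_posSemidef_nonneg hY (Q - P)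
  rw [Matrix.mul_sub, innerF_sub_left, Matrix.mul_smul, Matrix.mul_one, innerF_smul_left,
    ← normF_sq] at h3
  -- Strong convexity at Y bounds ⟨Q - P, Y⟩ below, and optimality of P for X gives ⟨Q - P, X⟩ ≤ 0;
  -- no lower bound on X is used.
  have h4 : s / 2 * normF (P - Q) ^ 2 ≤ innerF (Q - P) (Y - X) := by
    rw [innerF_sub_right, h2, innerF_sub_left Q P X, normF_sub_comm P Q]
    linarith
  have h5 := h4.trans (innerF_le _ _)
  rw [normF_sub_comm Q P, normF_sub_comm Y X] at h5
  rw [div_mul_eq_mul_div, le_div_iff₀ hs]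
  by_contra hlt
  push Not at hlt
  have h0 := normF_nonneg (P - Q)
  have h0' := normF_nonneg (X - Y)
  have hpos : 0 < normF (P - Q) := by
    rcases h0.lt_or_eq with h | h
    · exact h
    · rw [← h] at hlt; nlinarith
  nlinarith

lemma normF_mul_ge_of_posSemidef {Y Q : Matrix (Fin d) (Fin d) ℝ} {s : ℝ} {k : ℕ}
    (hQ : Q ∈ Matrix.orthogonalGroup (Fin d) ℝ) (hY : (Qᵀ * Y - s • 1).PosSemidef)
    (E : Matrix (Fin d) (Fin k) ℝ) : s * normF E ≤ normF (Y * E) := by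
  have h1 := innerF_posSemidef_mul_nonneg hY E
  rw [Matrix.sub_mul, innerF_sub_left, smul_mul, Matrix.one_mul, innerF_smul_left, ← normF_sq] at h1
  have h2 := innerF_le (Qᵀ * Y * E) E
  rw [Matrix.mul_assoc, normF_orthogonal_mul (transpose_mem_orthogonal hQ)] at h2
  rw [Matrix.mul_assoc] at h1
  have h0 := normF_nonneg E
  rcases h0.lt_or_eq with h | h
  · nlinarith
  · rw [← h, mul_zero]; exact normF_nonneg _

/-- The eigenvalues of PᵀX are nonnegative and P preserves norms, so on a unit eigenvector v the
eigenvalue is |Xv|. -/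
lemma posSemidef_sub_of_normF_mul_ge {X P : Matrix (Fin d) (Fin d) ℝ} {s : ℝ}
    (hP : P ∈ Matrix.orthogonalGroup (Fin d) ℝ) (hX : (Pᵀ * X).PosSemidef)
    (h : ∀ E : Matrix (Fin d) (Fin 1) ℝ, s * normF E ≤ normF (X * E)) :
    (Pᵀ * X - s • 1).PosSemidef := by
  have hH : (Pᵀ * X - s • 1).IsHermitian := by
    rw [isHermitian_iff_transpose, transpose_sub, isHermitian_iff_transpose.1 hX.1]; simp
  rw [hH.posSemidef_iff_eigenvalues_nonneg]
  intro j
  set v : Fin d → ℝ := (hH.eigenvectorBasis j).ofLp with hv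
  set E : Matrix (Fin d) (Fin 1) ℝ := replicateCol (Fin 1) v
  have hvv : v ⬝ᵥ v = 1 := by
    have := hH.eigenvectorBasis.norm_eq_one j
    rw [← sq_eq_sq₀ (norm_nonneg _) zero_le_one, EuclideanSpace.norm_sq_eq] at this
    simpa [dotProduct, ← pow_two, hv] using this
  have hE : normF E = 1 := by
    rw [← pow_left_inj₀ (normF_nonneg _) zero_le_one two_ne_zero, normF_replicateCol_sq, hvv]
    norm_num
  have h1 : (Pᵀ * X) * E = (hH.eigenvalues j + s) • E := by
    have := hH.mulVec_eigenvectorBasis j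
    rw [Matrix.sub_mulVec, smul_mulVec, one_mulVec, sub_eq_iff_eq_add, ← add_smul] at this
    rw [← replicateCol_mulVec, this, replicateCol_smul]
  have h2 : 0 ≤ hH.eigenvalues j + s := by
    have := innerF_posSemidef_mul_nonneg hX E
    rwa [h1, innerF_smul_left, ← normF_sq, hE, one_pow, mul_one] at this
  have h3 := h E
  rw [hE, ← normF_orthogonal_mul (transpose_mem_orthogonal hP), ← Matrix.mul_assoc, h1, normF_smul,
    hE, abs_of_nonneg h2] at h3
  simp only [Pi.zero_apply]
  linarith

lemma det_ne_zero_of_normF_mul_ge {X : Matrix (Fin d) (Fin d) ℝ} {s : ℝ} (hs : 0 < s)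
    (h : ∀ E : Matrix (Fin d) (Fin 1) ℝ, s * normF E ≤ normF (X * E)) : X.det ≠ 0 := by
  intro h0
  obtain ⟨v, hv, hXv⟩ := exists_mulVec_eq_zero_iff.2 h0
  have h1 := h (replicateCol (Fin 1) v)
  rw [← replicateCol_mulVec, hXv] at h1
  have h2 : normF (replicateCol (Fin 1) v) = 0 := by
    have h3 : normF (replicateCol (Fin 1) (0 : Fin d → ℝ)) = 0 := by
      rw [normF_eq_zero]; rfl
    rw [h3] at h1
    have := normF_nonneg (replicateCol (Fin 1) v)
    nlinarith
  rw [normF_eq_zero] at h2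
  exact hv (funext fun i => congrFun (congrFun h2 i) 0)

/-- A choice of polar factor, set to `1` at singular matrices to make it measurable. -/
noncomputable def polar (X : Matrix (Fin d) (Fin d) ℝ) : Matrix (Fin d) (Fin d) ℝ :=
  if X.det = 0 then 1 else (exists_polar X).choose

lemma polar_mem (X : Matrix (Fin d) (Fin d) ℝ) : polar X ∈ Matrix.orthogonalGroup (Fin d) ℝ := by
  unfold polar
  split_ifs
  · exact one_mem _
  · exact (exists_polar X).choose_spec.1

lemma polar_posSemidef {X : Matrix (Fin d) (Fin d) ℝ} (h : X.det ≠ 0) :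
    ((polar X)ᵀ * X).PosSemidef := by
  rw [polar, if_neg h]
  exact (exists_polar X).choose_spec.2

lemma exists_pos_normF_mul_ge {X : Matrix (Fin d) (Fin d) ℝ} (h : X.det ≠ 0) :
    ∃ s, 0 < s ∧ ∀ E : Matrix (Fin d) (Fin 1) ℝ, s * normF E ≤ normF (X * E) := by
  have hu : IsUnit X.det := isUnit_iff_ne_zero.2 h
  refine ⟨1 / (normF X⁻¹ + 1), by have := normF_nonneg X⁻¹; positivity, fun E => ?_⟩
  have h1 := normF_mul_le X⁻¹ (X * E)
  rw [← Matrix.mul_assoc, nonsing_inv_mul _ hu, Matrix.one_mul] at h1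
  have := normF_nonneg X⁻¹
  have := normF_nonneg (X * E)
  rw [div_mul_eq_mul_div, one_mul, div_le_iff₀ (by positivity)]
  nlinarith

end Polar

/-! ### The distance `dF` -/

section Distance

variable {n d m : ℕ} {S T R : Matrix (Fin n × Fin d) (Fin d) ℝ}

lemma dF_nonneg (S T : Matrix (Fin n × Fin d) (Fin d) ℝ) : 0 ≤ dF S T :=
  Real.iInf_nonneg fun _ => normF_nonneg _

lemma dF_le (S T : Matrix (Fin n × Fin d) (Fin d) ℝ) {Q : Matrix (Fin d) (Fin d) ℝ}
    (hQ : Q ∈ Matrix.orthogonalGroup (Fin d) ℝ) : dF S T ≤ normF (S - T * Q) := by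
  have hb : BddBelow (Set.range fun Q : Matrix.orthogonalGroup (Fin d) ℝ =>
      normF (S - T * (Q : Matrix (Fin d) (Fin d) ℝ))) :=
    ⟨0, by rintro _ ⟨Q, rfl⟩; exact normF_nonneg _⟩
  exact ciInf_le hb (⟨Q, hQ⟩ : Matrix.orthogonalGroup (Fin d) ℝ)

/-- The optimal rotation is a polar factor of TᵀS; its positivity condition is what later arguments
use about alignment. -/
lemma exists_align (S T : Matrix (Fin n × Fin d) (Fin d) ℝ) :
    ∃ Q ∈ Matrix.orthogonalGroup (Fin d) ℝ, (Qᵀ * (Tᵀ * S)).PosSemidef ∧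
      dF S T = normF (S - T * Q) := by
  obtain ⟨Q, hQ, hH⟩ := exists_polar (Tᵀ * S)
  refine ⟨Q, hQ, hH, le_antisymm (dF_le S T hQ) ?_⟩
  have : Nonempty (Matrix.orthogonalGroup (Fin d) ℝ) := ⟨1⟩
  refine le_ciInf fun Q' => ?_
  rw [← sq_le_sq₀ (normF_nonneg _) (normF_nonneg _), normF_sub_sq, normF_sub_sq, normF_mul_orthogonal hQ, normF_mul_orthogonal Q'.2]
  have h1 := innerF_le_of_posSemidef hQ Q'.2 hH
  rw [← innerF_mul_left, ← innerF_mul_left, innerF_comm, innerF_comm (T * Q)] at h1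
  linarith

lemma dF_comm (S T : Matrix (Fin n × Fin d) (Fin d) ℝ) : dF S T = dF T S := by
  have key : ∀ S T : Matrix (Fin n × Fin d) (Fin d) ℝ, dF S T ≤ dF T S := by
    intro S T
    obtain ⟨Q, hQ, -, h⟩ := exists_align T S
    rw [h]
    refine (dF_le S T (transpose_mem_orthogonal hQ)).trans ?_
    rw [← normF_mul_orthogonal hQ, Matrix.sub_mul, Matrix.mul_assoc, transpose_mul_self_of_mem hQ,
      Matrix.mul_one, normF_sub_comm]
  exact le_antisymm (key S T) (key T S)

lemma dF_triangle (S T R : Matrix (Fin n × Fin d) (Fin d) ℝ) : dF S R ≤ dF S T + dF T R := by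
  obtain ⟨Q, hQ, -, h⟩ := exists_align S T
  obtain ⟨Q', hQ', -, h'⟩ := exists_align T R
  rw [h, h']
  refine (dF_le S R (mul_mem hQ' hQ)).trans ((normF_sub_triangle _ (T * Q) _).trans ?_)
  rw [← normF_mul_orthogonal hQ (T - R * Q'), Matrix.sub_mul, Matrix.mul_assoc]

/-- Alignment makes QᵀTᵀS symmetric, so both cross terms of (S - TQ)ᵀ(S - TQ) coincide. -/
lemma transpose_mul_sub_align (hS : S ∈ orthStack n d) (hT : T ∈ orthStack n d)
    {Q : Matrix (Fin d) (Fin d) ℝ} (hQ : Q ∈ Matrix.orthogonalGroup (Fin d) ℝ)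
    (hH : (Qᵀ * (Tᵀ * S)).PosSemidef) :
    (n : ℝ) • 1 - Qᵀ * (Tᵀ * S) = (1 / 2 : ℝ) • ((S - T * Q)ᵀ * (S - T * Q)) := by
  have h1 := isHermitian_iff_transpose.1 hH.1
  have h2 : Sᵀ * (T * Q) = Qᵀ * (Tᵀ * S) := by
    rw [← h1]; simp [transpose_mul, Matrix.mul_assoc]
  have h3 : (T * Q)ᵀ * S = Qᵀ * (Tᵀ * S) := by simp [transpose_mul, Matrix.mul_assoc]
  rw [transpose_sub, Matrix.sub_mul, Matrix.mul_sub, Matrix.mul_sub,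
    transpose_mul_self_of_mem_orthStack hS,
    transpose_mul_self_of_mem_orthStack (mul_mem_orthStack hT hQ), h2, h3]
  module

/-- The component of an aligned difference along T is of second order. This is why the large signal
part of C hardly acts on it. -/
lemma normF_transpose_mul_sub_le (hS : S ∈ orthStack n d) (hT : T ∈ orthStack n d)
    {Q : Matrix (Fin d) (Fin d) ℝ} (hQ : Q ∈ Matrix.orthogonalGroup (Fin d) ℝ)
    (hH : (Qᵀ * (Tᵀ * S)).PosSemidef) :
    normF (Tᵀ * (S - T * Q)) ≤ 1 / 2 * normF (S - T * Q) ^ 2 := by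
  have h1 : Tᵀ * (S - T * Q) = -(Q * ((n : ℝ) • 1 - Qᵀ * (Tᵀ * S))) := by
    rw [Matrix.mul_sub, Matrix.mul_sub, ← Matrix.mul_assoc Q, mul_transpose_self_of_mem hQ,
      Matrix.one_mul, ← Matrix.mul_assoc, transpose_mul_self_of_mem_orthStack hT]
    simp
  rw [h1, ← neg_one_smul ℝ, normF_smul, normF_orthogonal_mul hQ, transpose_mul_sub_align hS hT hQ hH,
    normF_smul, abs_neg, abs_one, one_mul, abs_of_nonneg (by norm_num), pow_two]
  gcongr
  exact (normF_mul_le _ _).trans (by rw [normF_transpose])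

lemma isPolarStack_iff {X S : Matrix (Fin n × Fin d) (Fin d) ℝ} :
    IsPolarStack X S ↔ S ∈ orthStack n d ∧ ∀ i, ((block S i)ᵀ * block X i).PosSemidef := by
  simp only [IsPolarStack, isPolar_iff, orthStack, Set.mem_ofPred_eq, forall_and]

lemma normF_polarStack_sub_le {X Y P T : Matrix (Fin n × Fin d) (Fin d) ℝ} {s : ℝ} (hs : 0 < s)
    (hP : IsPolarStack X P) (hT : T ∈ orthStack n d)
    (hY : ∀ i, ((block T i)ᵀ * block Y i - s • 1).PosSemidef) :
    normF (P - T) ≤ 2 / s * normF (X - Y) := by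
  rw [isPolarStack_iff] at hP
  exact normF_le_of_block_le (by positivity) fun i =>
    normF_polar_sub_le hs (hP.1 i) (hP.2 i) (hT i) (hY i)

lemma posSemidef_conj_orthogonal {T Y : Matrix (Fin d) (Fin d) ℝ} {s : ℝ}
    (h : (Tᵀ * Y - s • 1).PosSemidef)
    {Q : Matrix (Fin d) (Fin d) ℝ} (hQ : Q ∈ Matrix.orthogonalGroup (Fin d) ℝ) :
    ((T * Q)ᵀ * (Y * Q) - s • 1).PosSemidef := by
  have := h.mul_mul_conjTranspose_same Qᵀ
  rw [conjTranspose_eq_transpose_of_trivial, transpose_transpose, Matrix.mul_sub, Matrix.sub_mul,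
    Matrix.mul_smul, Matrix.mul_one, smul_mul, transpose_mul_self_of_mem hQ] at this
  simpa [transpose_mul, Matrix.mul_assoc] using this

/-- A (possibly degenerate) polar step `S ↦ P` with the matrix `C` is compared with a nondegenerate
one `T ↦ T'` with the matrix `C'`. -/
lemma dF_polarStack_le {C C' : Matrix (Fin n × Fin d) (Fin n × Fin d) ℝ}
    {S P T T' : Matrix (Fin n × Fin d) (Fin d) ℝ}
    {s : ℝ} (hs : 0 < s) (hP : IsPolarStack (C * S) P) (hT' : T' ∈ orthStack n d)
    (hY : ∀ i, ((block T' i)ᵀ * block (C' * T) i - s • 1).PosSemidef)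
    {Q : Matrix (Fin d) (Fin d) ℝ} (hQ : Q ∈ Matrix.orthogonalGroup (Fin d) ℝ) :
    dF P T' ≤ 2 / s * normF (C * S - C' * T * Q) := by
  refine (dF_le P T' hQ).trans (normF_polarStack_sub_le hs hP (mul_mem_orthStack hT' hQ) fun i => ?_)
  exact posSemidef_conj_orthogonal (hY i) hQ

end Distance

/-! ### Deterministic analysis around the ground truth -/

open scoped Matrix.Norms.L2Operator

/-- A matrix `Z A + N` with a well-conditioned signal `Z A` and small noise `N`. -/
structure SmallNoise {n d m : ℕ} (Z : Matrix (Fin n × Fin d) (Fin d) ℝ)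
    (A : Matrix (Fin d) (Fin m) ℝ) (N : Matrix (Fin n × Fin d) (Fin m) ℝ) (a κ : ℝ) : Prop where
  n_pos : 1 ≤ n
  d_pos : 1 ≤ d
  a_pos : 0 < a
  one_le : 1 ≤ κ
  mem : Z ∈ orthStack n d
  lower : (A * Aᵀ - a ^ 2 • 1).PosSemidef
  upper : ‖A‖ ≤ κ * a
  noise : ‖N‖ * √d ≤ a * √n / (1024 * κ ^ 4)

namespace SmallNoise

variable {n d m : ℕ} {Z : Matrix (Fin n × Fin d) (Fin d) ℝ} {A : Matrix (Fin d) (Fin m) ℝ}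
  {N : Matrix (Fin n × Fin d) (Fin m) ℝ} {a κ : ℝ}

lemma sqrt_n (h : SmallNoise Z A N a κ) : 1 ≤ √(n : ℝ) := by
  rw [Real.one_le_sqrt]; exact_mod_cast h.n_pos

lemma sqrt_d (h : SmallNoise Z A N a κ) : 1 ≤ √(d : ℝ) := by
  rw [Real.one_le_sqrt]; exact_mod_cast h.d_pos

lemma noise' (h : SmallNoise Z A N a κ) : ‖N‖ ≤ a * √n / (1024 * κ ^ 4) :=
  (le_mul_of_one_le_right (norm_nonneg _) h.sqrt_d).trans h.noise

lemma noise_pow (h : SmallNoise Z A N a κ) {j : ℕ} (hj : j ≤ 4) :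
    a * √n / (1024 * κ ^ 4) ≤ a * √n / (1024 * κ ^ j) := by
  have := h.a_pos
  have := h.one_le
  gcongr

lemma noise_le (h : SmallNoise Z A N a κ) : ‖N‖ ≤ a * √n / 1024 := by
  simpa using h.noise'.trans (h.noise_pow (Nat.zero_le 4))

lemma norm_signal_le (h : SmallNoise Z A N a κ) : ‖Z * A‖ ≤ √n * (κ * a) :=
  (l2_opNorm_mul _ _).trans (mul_le_mul (norm_orthStack_le h.mem) h.upper (norm_nonneg _)
    (Real.sqrt_nonneg _))

lemma norm_data_le (h : SmallNoise Z A N a κ) : ‖Z * A + N‖ ≤ 2 * √n * (κ * a) := by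
  have h1 := (norm_add_le (Z * A) N).trans (add_le_add h.norm_signal_le h.noise_le)
  have := h.sqrt_n
  have := h.a_pos
  have := h.one_le
  have : a * √n ≤ √n * (κ * a) := by nlinarith [mul_pos h.a_pos (zero_lt_one.trans_le h.sqrt_n)]
  have : 0 < a * √n := by positivity
  linarith

/-- The perturbation of the Gram matrix. -/
lemma perturbation_le (h : SmallNoise Z A N a κ) :
    ‖(Z * A + N) * (Z * A + N)ᵀ - Z * A * (Z * A)ᵀ‖ * √d ≤ 3 * (n * a ^ 2) / (1024 * κ ^ 3) := by
  have e : (Z * A + N) * (Z * A + N)ᵀ - Z * A * (Z * A)ᵀ = Z * A * Nᵀ + N * (Z * A + N)ᵀ := by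
    simp only [transpose_add, Matrix.add_mul, Matrix.mul_add]; abel
  have h1 : ‖Z * A * Nᵀ‖ ≤ √n * (κ * a) * ‖N‖ := by
    refine (l2_opNorm_mul _ _).trans ?_
    rw [norm_transpose]
    exact mul_le_mul_of_nonneg_right h.norm_signal_le (norm_nonneg _)
  have h2 : ‖N * (Z * A + N)ᵀ‖ ≤ ‖N‖ * (2 * √n * (κ * a)) := by
    refine (l2_opNorm_mul _ _).trans ?_
    rw [norm_transpose]
    exact mul_le_mul_of_nonneg_left h.norm_data_le (norm_nonneg _)
  rw [e]
  have := h.a_pos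
  have := h.one_le
  have hn : √(n : ℝ) * √n = n := Real.mul_self_sqrt (Nat.cast_nonneg n)
  calc _ ≤ (√n * (κ * a) * ‖N‖ + ‖N‖ * (2 * √n * (κ * a))) * √d := by
        gcongr; exact (norm_add_le _ _).trans (add_le_add h1 h2)
    _ = 3 * √n * (κ * a) * (‖N‖ * √d) := by ring
    _ ≤ 3 * √n * (κ * a) * (a * √n / (1024 * κ ^ 4)) := by
        gcongr; exact h.noise
    _ = 3 * ((√n * √n) * a ^ 2) / (1024 * κ ^ 3) := by field_simp
    _ = _ := by rw [hn]

lemma perturbation_le' (h : SmallNoise Z A N a κ) :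
    ‖(Z * A + N) * (Z * A + N)ᵀ - Z * A * (Z * A)ᵀ‖ ≤ 3 * (n * a ^ 2) / 1024 := by
  refine (le_mul_of_one_le_right (norm_nonneg _) h.sqrt_d).trans (h.perturbation_le.trans ?_)
  refine div_le_div_of_nonneg_left (by positivity) (by norm_num) ?_
  have := one_le_pow₀ h.one_le (n := 3)
  linarith

lemma normF_gram_mul_le (h : SmallNoise Z A N a κ) {k : ℕ} (X : Matrix (Fin d) (Fin k) ℝ) :
    normF (A * Aᵀ * X) ≤ (κ * a) ^ 2 * normF X := by
  refine (normF_mul_le_op _ _).trans (mul_le_mul_of_nonneg_right ?_ (normF_nonneg _))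
  refine (l2_opNorm_mul _ _).trans ?_
  rw [norm_transpose, pow_two]
  exact mul_le_mul h.upper h.upper (norm_nonneg _) ((norm_nonneg _).trans h.upper)

/-- The radius of the basin of attraction. -/
noncomputable def radius (n : ℕ) (κ : ℝ) : ℝ := √n / (32 * κ ^ 2)

lemma radius_nonneg : 0 ≤ radius n κ := by unfold radius; positivity

lemma radius_le (h : SmallNoise Z A N a κ) : radius n κ ≤ √n / 32 := by
  unfold radius
  refine div_le_div_of_nonneg_left (by positivity) (by norm_num) ?_
  have := one_le_pow₀ h.one_le (n := 2)
  linarith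

/-- The κ² in the denominator of the radius is there to cancel ‖AAᵀ‖ ≤ (κa)², leaving a fixed
fraction of na². -/
lemma sq_mul_radius (h : SmallNoise Z A N a κ) : (κ * a) ^ 2 * (√n * radius n κ) = n * a ^ 2 / 32 := by
  have := h.one_le
  have hn : √(n : ℝ) ^ 2 = n := Real.sq_sqrt (Nat.cast_nonneg n)
  unfold radius
  field_simp
  rw [hn]

/-- The signal sees E = S - TQ only through ZᵀE, which is a rotation of TᵀE (second order) up to the
error T - ZR (at most the radius). The rest of C is small in operator norm. With blocks bounded
below by na²/2, the polar bound multiplies by 4/(na²), so the distance is halved. No incoherence is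
needed here. -/
lemma normF_contract (h : SmallNoise Z A N a κ) {S T : Matrix (Fin n × Fin d) (Fin d) ℝ}
    (hS : S ∈ orthStack n d) (hT : T ∈ orthStack n d) {Q : Matrix (Fin d) (Fin d) ℝ}
    (hQ : Q ∈ Matrix.orthogonalGroup (Fin d) ℝ) (hH : (Qᵀ * (Tᵀ * S)).PosSemidef)
    (hd : dF S T = normF (S - T * Q)) (hTZ : dF T Z ≤ radius n κ)
    (hST : dF S T ≤ 2 * radius n κ) :
    normF ((Z * A + N) * (Z * A + N)ᵀ * (S - T * Q)) ≤ n * a ^ 2 / 8 * dF S T := by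
  set E := S - T * Q with hE
  obtain ⟨R, hR, -, hRd⟩ := exists_align T Z
  set F := T - Z * R with hF
  have hd0 := dF_nonneg S T
  have hZ : Zᵀ * E = R * (Tᵀ * E - Fᵀ * E) := by
    rw [hF, ← Matrix.sub_mul, transpose_sub, sub_sub_cancel, transpose_mul, ← Matrix.mul_assoc,
      ← Matrix.mul_assoc, mul_transpose_self_of_mem hR, Matrix.one_mul]
  have h1 : normF (Zᵀ * E) ≤ 2 * radius n κ * dF S T := by
    rw [hZ, normF_orthogonal_mul hR]
    refine (normF_sub_le _ _).trans ?_
    have e1 := normF_transpose_mul_sub_le hS hT hQ hH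
    have e2 := normF_mul_le Fᵀ E
    rw [normF_transpose, ← hRd, ← hd] at e2
    rw [← hE, ← hd] at e1
    have e3 : dF T Z * dF S T ≤ radius n κ * dF S T := mul_le_mul_of_nonneg_right hTZ hd0
    nlinarith
  have h2 : normF (Z * A * (Z * A)ᵀ * E) ≤ n * a ^ 2 / 16 * dF S T := by
    have e1 : Z * A * (Z * A)ᵀ * E = Z * (A * Aᵀ * (Zᵀ * E)) := by
      simp only [transpose_mul, Matrix.mul_assoc]
    rw [e1, normF_orthStack_mul h.mem]
    calc √n * normF (A * Aᵀ * (Zᵀ * E)) ≤ √n * ((κ * a) ^ 2 * (2 * radius n κ * dF S T)) := by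
          gcongr
          exact (h.normF_gram_mul_le _).trans (by gcongr)
      _ = 2 * ((κ * a) ^ 2 * (√n * radius n κ)) * dF S T := by ring
      _ = _ := by rw [h.sq_mul_radius]; ring
  have h3 : normF (((Z * A + N) * (Z * A + N)ᵀ - Z * A * (Z * A)ᵀ) * E) ≤
      3 * (n * a ^ 2) / 1024 * dF S T := by
    refine (normF_mul_le_op _ _).trans ?_
    rw [hd]
    exact mul_le_mul_of_nonneg_right h.perturbation_le' (normF_nonneg _)
  have h4 := normF_add_le (((Z * A + N) * (Z * A + N)ᵀ - Z * A * (Z * A)ᵀ) * E)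
    (Z * A * (Z * A)ᵀ * E)
  rw [← Matrix.add_mul, sub_add_cancel] at h4
  have : 0 ≤ n * a ^ 2 * dF S T := by positivity
  nlinarith

/-- The ground truth is an approximate fixed point of the power method, attracting its
neighbourhood. -/
lemma dF_step_truth (h : SmallNoise Z A N a κ) {S P : Matrix (Fin n × Fin d) (Fin d) ℝ}
    (hS : S ∈ orthStack n d) (hSZ : dF S Z ≤ radius n κ)
    (hP : IsPolarStack ((Z * A + N) * (Z * A + N)ᵀ * S) P) : dF P Z ≤ radius n κ := by
  obtain ⟨Q, hQ, hH, hd⟩ := exists_align S Z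
  have ha := h.a_pos
  have hκ := h.one_le
  have hn0 : (0 : ℝ) < n := by exact_mod_cast h.n_pos
  have hn : √(n : ℝ) * √n = n := Real.mul_self_sqrt (Nat.cast_nonneg n)
  have hs : 0 < n * a ^ 2 := by positivity
  -- The comparison step is the noiseless one at Z, whose blocks are n·AAᵀ after rotation; the noisy
  -- step may therefore be degenerate.
  have hY : ∀ i, ((block Z i)ᵀ * block (Z * A * (Z * A)ᵀ * Z) i -
      ((n : ℝ) * a ^ 2) • 1).PosSemidef := by
    intro i
    have e : (block Z i)ᵀ * block (Z * A * (Z * A)ᵀ * Z) i = (n : ℝ) • (A * Aᵀ) := by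
      have : Z * A * (Z * A)ᵀ * Z = Z * (A * Aᵀ * (Zᵀ * Z)) := by
        simp only [transpose_mul, Matrix.mul_assoc]
      rw [this, transpose_mul_self_of_mem_orthStack h.mem, block_mul, ← Matrix.mul_assoc,
        transpose_mul_self_of_mem (h.mem i)]
      simp
    rw [e, ← smul_smul, ← smul_sub]
    exact h.lower.smul hn0.le
  refine (dF_polarStack_le hs hP h.mem hY hQ).trans ?_
  set E := S - Z * Q with hE
  have e : (Z * A + N) * (Z * A + N)ᵀ * S - Z * A * (Z * A)ᵀ * Z * Q =
      Z * (A * Aᵀ * (Zᵀ * E)) + ((Z * A + N) * (Z * A + N)ᵀ - Z * A * (Z * A)ᵀ) * S := by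
    rw [hE, Matrix.sub_mul _ _ S]
    simp only [transpose_mul, Matrix.mul_assoc, Matrix.mul_sub]
    abel
  have h1 : normF (Z * (A * Aᵀ * (Zᵀ * E))) ≤ n * a ^ 2 / 64 * radius n κ := by
    rw [normF_orthStack_mul h.mem]
    have e1 := normF_transpose_mul_sub_le hS h.mem hQ hH
    rw [← hE, ← hd] at e1
    have e2 : dF S Z ^ 2 ≤ radius n κ ^ 2 := by
      have := dF_nonneg S Z
      gcongr
    calc √n * normF (A * Aᵀ * (Zᵀ * E)) ≤ √n * ((κ * a) ^ 2 * (1 / 2 * radius n κ ^ 2)) := by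
          gcongr
          refine (h.normF_gram_mul_le _).trans ?_
          gcongr
          linarith
      _ = 1 / 2 * ((κ * a) ^ 2 * (√n * radius n κ)) * radius n κ := by ring
      _ = _ := by rw [h.sq_mul_radius]; ring
  have h2 : normF (((Z * A + N) * (Z * A + N)ᵀ - Z * A * (Z * A)ᵀ) * S) ≤
      n * a ^ 2 * (3 / 32) * radius n κ := by
    refine (normF_mul_le_op _ _).trans ?_
    rw [normF_orthStack hS]
    have e1 := mul_le_mul_of_nonneg_right h.perturbation_le (Real.sqrt_nonneg (n : ℝ))
    have e2 : 3 * (n * a ^ 2) / (1024 * κ ^ 3) * √n ≤ n * a ^ 2 * (3 / 32) * radius n κ := by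
      have : n * a ^ 2 * (3 / 32) * radius n κ = 3 * (n * a ^ 2) / (1024 * κ ^ 2) * √n := by
        unfold radius; field_simp; ring
      rw [this]
      gcongr
      norm_num
    linarith
  rw [e, div_mul_eq_mul_div, div_le_iff₀ hs]
  have h3 := (normF_add_le _ _).trans (add_le_add h1 h2)
  have : 0 ≤ n * a ^ 2 * radius n κ := mul_nonneg hs.le radius_nonneg
  nlinarith

end SmallNoise

/-! ### Conditioning of the blocks of C S. -/

namespace SmallNoise

variable {n d m : ℕ} {Z : Matrix (Fin n × Fin d) (Fin d) ℝ} {A : Matrix (Fin d) (Fin m) ℝ}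
  {N : Matrix (Fin n × Fin d) (Fin m) ℝ} {a κ : ℝ}

lemma gram_pos (h : SmallNoise Z A N a κ) : 0 < n * a ^ 2 := by
  have : (0 : ℝ) < n := by exact_mod_cast h.n_pos
  have := h.a_pos
  positivity

lemma norm_block_le (N : Matrix (Fin n × Fin d) (Fin m) ℝ) (i : Fin n) : ‖block N i‖ ≤ ‖N‖ :=
  opNorm_le_of_normF (norm_nonneg _) fun E =>
    (normF_block_le (N * E) i).trans (normF_mul_le_op N E)

lemma noise_mul_data_le (h : SmallNoise Z A N a κ) :
    ‖N‖ * √d * (2 * √n * (κ * a)) ≤ n * a ^ 2 / 512 := by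
  have := h.a_pos
  have hκ := h.one_le
  have hn : √(n : ℝ) ^ 2 = n := Real.sq_sqrt (Nat.cast_nonneg n)
  calc _ ≤ a * √n / (1024 * κ ^ 4) * (2 * √n * (κ * a)) := by gcongr; exact h.noise
    _ = √n ^ 2 * a ^ 2 / (512 * κ ^ 3) := by field_simp; ring
    _ ≤ n * a ^ 2 / 512 := by
      rw [hn]
      refine div_le_div_of_nonneg_left (by positivity) (by norm_num) ?_
      have := one_le_pow₀ hκ (n := 3)
      linarith

lemma noise_mul_data_le' (h : SmallNoise Z A N a κ) :
    ‖N‖ * (2 * √n * (κ * a)) ≤ n * a ^ 2 / 512 := by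
  refine le_trans ?_ h.noise_mul_data_le
  have := h.a_pos
  have hκ := h.one_le
  gcongr
  exact le_mul_of_one_le_right (norm_nonneg _) h.sqrt_d

/-- The blocks of `C S` are well-conditioned if the noise blocks are not aligned with `S`. -/
lemma block_lower (h : SmallNoise Z A N a κ) {S : Matrix (Fin n × Fin d) (Fin d) ℝ}
    (hS : S ∈ orthStack n d) (hSZ : dF S Z ≤ radius n κ)
    (hG : ∀ i, ‖block N i * ((Z * A + N)ᵀ * S)‖ ≤ n * a ^ 2 / 8) (i : Fin n) {k : ℕ}
    (E : Matrix (Fin d) (Fin k) ℝ) :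
    n * a ^ 2 / 2 * normF E ≤ normF (block ((Z * A + N) * (Z * A + N)ᵀ * S) i * E) := by
  have ha := h.a_pos
  have hκ := h.one_le
  have hn0 : (0 : ℝ) < n := by exact_mod_cast h.n_pos
  have hn : √(n : ℝ) * √n = n := Real.mul_self_sqrt (Nat.cast_nonneg n)
  have hE := normF_nonneg E
  obtain ⟨Q, hQ, -, hd⟩ := exists_align S Z
  set F := S - Z * Q with hF
  -- Signal, noise averaged by S, and the i-th noise block acting on DᵀS. Only the last needs the
  -- hypothesis `hG`: the estimate through ‖N‖, ‖D‖ and ‖S‖ ≤ √n would be too large by a factor √n.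
  have e : block ((Z * A + N) * (Z * A + N)ᵀ * S) i * E =
      block Z i * (A * Aᵀ * (Zᵀ * (S * E))) + (block Z i * (A * (Nᵀ * (S * E))) +
        block N i * ((Z * A + N)ᵀ * S) * E) := by
    rw [Matrix.mul_assoc (Z * A + N), block_mul, block_add, block_mul]
    simp only [transpose_add, transpose_mul, Matrix.mul_assoc, Matrix.add_mul, Matrix.mul_add]
    abel
  have hZS : Zᵀ * (S * E) = (n : ℝ) • (Q * E) - -(Zᵀ * (F * E)) := by
    have : S = Z * Q + F := by rw [hF]; abel
    rw [this, Matrix.add_mul, Matrix.mul_add, Matrix.mul_assoc Z, ← Matrix.mul_assoc Zᵀ Z,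
      transpose_mul_self_of_mem_orthStack h.mem]
    simp
  have h1 : n * (31 / 32) * normF E ≤ normF (Zᵀ * (S * E)) := by
    have e1 := normF_sub_triangle ((n : ℝ) • (Q * E)) (-(Zᵀ * (F * E))) 0
    rw [sub_zero, sub_zero, normF_smul, normF_orthogonal_mul hQ, abs_of_pos hn0, ← hZS,
      ← neg_one_smul ℝ, normF_smul, abs_neg, abs_one, one_mul] at e1
    have e2 : normF (Zᵀ * (F * E)) ≤ n / 32 * normF E := by
      calc normF (Zᵀ * (F * E)) ≤ √n * (radius n κ * normF E) := by
            refine (normF_mul_le_op _ _).trans ?_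
            rw [norm_transpose]
            gcongr
            · exact normF_nonneg _
            · exact norm_orthStack_le h.mem
            · exact (normF_mul_le _ _).trans (mul_le_mul_of_nonneg_right (hd ▸ hSZ) hE)
        _ ≤ √n * (√n / 32 * normF E) := by gcongr; exact h.radius_le
        _ = (√n * √n) / 32 * normF E := by ring
        _ = _ := by rw [hn]
    linarith
  have h2 : a ^ 2 * normF (Zᵀ * (S * E)) ≤ normF (block Z i * (A * Aᵀ * (Zᵀ * (S * E)))) := by
    rw [normF_orthogonal_mul (h.mem i)]
    exact normF_mul_ge_of_posSemidef (Q := 1) (one_mem _) (by simpa using h.lower) _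
  have h3 : normF (block Z i * (A * (Nᵀ * (S * E)))) ≤ n * a ^ 2 / 512 * normF E := by
    rw [normF_orthogonal_mul (h.mem i)]
    calc normF (A * (Nᵀ * (S * E))) ≤ κ * a * (‖N‖ * (√n * normF E)) := by
          refine (normF_mul_le_op _ _).trans ?_
          gcongr
          · exact normF_nonneg _
          · exact h.upper
          refine (normF_mul_le_op _ _).trans ?_
          rw [norm_transpose, normF_orthStack_mul hS]
      _ = ‖N‖ * (1 * √n * (κ * a)) * normF E := by ring
      _ ≤ ‖N‖ * (2 * √n * (κ * a)) * normF E := by gcongr; norm_num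
      _ ≤ _ := by gcongr; exact h.noise_mul_data_le'
  have h4 : normF (block N i * ((Z * A + N)ᵀ * S) * E) ≤ n * a ^ 2 / 8 * normF E :=
    (normF_mul_le_op _ _).trans (mul_le_mul_of_nonneg_right (hG i) hE)
  rw [e]
  set X₁ := block Z i * (A * Aᵀ * (Zᵀ * (S * E)))
  set X₂ := block Z i * (A * (Nᵀ * (S * E)))
  set X₃ := block N i * ((Z * A + N)ᵀ * S) * E
  have h5 := normF_sub_le (X₁ + (X₂ + X₃)) (X₂ + X₃)
  rw [add_sub_cancel_right] at h5
  have h6 := normF_add_le X₂ X₃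
  have h7 : n * a ^ 2 * (31 / 32) * normF E ≤ normF X₁ := by nlinarith
  have h8 : 0 ≤ n * a ^ 2 * normF E := by positivity
  linarith

lemma posSemidef_step (h : SmallNoise Z A N a κ) {S P : Matrix (Fin n × Fin d) (Fin d) ℝ}
    (hS : S ∈ orthStack n d) (hSZ : dF S Z ≤ radius n κ)
    (hG : ∀ i, ‖block N i * ((Z * A + N)ᵀ * S)‖ ≤ n * a ^ 2 / 8)
    (hP : IsPolarStack ((Z * A + N) * (Z * A + N)ᵀ * S) P) (i : Fin n) :
    ((block P i)ᵀ * block ((Z * A + N) * (Z * A + N)ᵀ * S) i - (n * a ^ 2 / 2) • 1).PosSemidef := by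
  rw [isPolarStack_iff] at hP
  exact posSemidef_sub_of_normF_mul_ge (hP.1 i) (hP.2 i) fun E => h.block_lower hS hSZ hG i E

/-- At distance 1, instead of √n, the crude bound ‖N‖‖D‖ on the difference is affordable. This is
why the leave-one-out runs are compared at distance 1. -/
lemma incoherent_of_close (h : SmallNoise Z A N a κ) {S T : Matrix (Fin n × Fin d) (Fin d) ℝ}
    (hST : dF S T ≤ 1) (i : Fin n) :
    ‖block N i * ((Z * A + N)ᵀ * S)‖ ≤ ‖block N i * ((Z * A + N)ᵀ * T)‖ + n * a ^ 2 / 512 := by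
  obtain ⟨Q, hQ, -, hd⟩ := exists_align S T
  have e : block N i * ((Z * A + N)ᵀ * S) = block N i * ((Z * A + N)ᵀ * T) * Q +
      block N i * ((Z * A + N)ᵀ * (S - T * Q)) := by
    simp only [Matrix.mul_sub, Matrix.mul_assoc]; abel
  have hQ1 : ‖Q‖ ≤ 1 := opNorm_le_of_normF zero_le_one fun E => by
    rw [normF_orthogonal_mul hQ, one_mul]
  have ha := h.a_pos
  have hκ := h.one_le
  have h1 : ‖block N i * ((Z * A + N)ᵀ * T) * Q‖ ≤ ‖block N i * ((Z * A + N)ᵀ * T)‖ :=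
    (l2_opNorm_mul _ _).trans (mul_le_of_le_one_right (norm_nonneg _) hQ1)
  have h2 : ‖block N i * ((Z * A + N)ᵀ * (S - T * Q))‖ ≤ ‖N‖ * (2 * √n * (κ * a)) := by
    refine (l2_opNorm_mul _ _).trans (mul_le_mul (norm_block_le N i) ?_ (norm_nonneg _)
      (norm_nonneg _))
    refine (l2_opNorm_mul _ _).trans ?_
    rw [norm_transpose]
    have : ‖S - T * Q‖ ≤ 1 := (opNorm_le_normF _).trans (hd ▸ hST)
    exact (mul_le_of_le_one_right (norm_nonneg _) this).trans h.norm_data_le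
  rw [e]
  exact (norm_add_le _ _).trans (add_le_add h1 (h2.trans h.noise_mul_data_le'))

end SmallNoise

/-! ### Leaving one block out -/

section LeaveOneOut

variable {n d m k : ℕ}

/-- The matrix `N` with its `i`-th block replaced by zero. -/
def zeroBlock (N : Matrix (Fin n × Fin d) (Fin m) ℝ) (i : Fin n) :
    Matrix (Fin n × Fin d) (Fin m) ℝ :=
  Matrix.of fun p b => if p.1 = i then 0 else N p b

lemma block_zeroBlock (N : Matrix (Fin n × Fin d) (Fin m) ℝ) (i j : Fin n) :
    block (zeroBlock N i) j = if j = i then 0 else block N j := by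
  ext x y
  by_cases hj : j = i <;> simp [block, zeroBlock, hj]

lemma norm_zeroBlock_le (N : Matrix (Fin n × Fin d) (Fin m) ℝ) (i : Fin n) :
    ‖zeroBlock N i‖ ≤ ‖N‖ := by
  refine opNorm_le_of_normF (norm_nonneg _) fun E => le_trans ?_ (normF_mul_le_op N E)
  rw [← one_mul (normF (N * E))]
  refine normF_le_of_block_le zero_le_one fun j => ?_
  rw [block_mul, block_mul, block_zeroBlock]
  split_ifs
  · rw [Matrix.zero_mul, normF_zero, one_mul]; exact normF_nonneg _
  · rw [one_mul]

lemma block_sub_zeroBlock (N : Matrix (Fin n × Fin d) (Fin m) ℝ) (i j : Fin n) :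
    block (N - zeroBlock N i) j = if j = i then block N i else 0 := by
  rw [block_sub, block_zeroBlock]
  split_ifs with hj
  · rw [hj, sub_zero]
  · rw [sub_self]

lemma normF_sub_zeroBlock_mul (N : Matrix (Fin n × Fin d) (Fin m) ℝ) (i : Fin n)
    (X : Matrix (Fin m) (Fin k) ℝ) : normF ((N - zeroBlock N i) * X) = normF (block N i * X) := by
  rw [← sq_eq_sq₀ (normF_nonneg _) (normF_nonneg _), normF_sq_eq_sum_block,
    Finset.sum_eq_single_of_mem i (Finset.mem_univ i)]
  · rw [block_mul, block_sub_zeroBlock, if_pos rfl]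
  · intro j _ hj
    rw [block_mul, block_sub_zeroBlock, if_neg hj, Matrix.zero_mul, normF_zero]
    norm_num

lemma sub_zeroBlock_transpose_mul (N : Matrix (Fin n × Fin d) (Fin m) ℝ) (i : Fin n)
    (X : Matrix (Fin n × Fin d) (Fin k) ℝ) :
    (N - zeroBlock N i)ᵀ * X = (block N i)ᵀ * block X i := by
  rw [transpose_mul_eq_sum_block, Finset.sum_eq_single_of_mem i (Finset.mem_univ i)]
  · rw [block_sub_zeroBlock, if_pos rfl]
  · intro j _ hj
    rw [block_sub_zeroBlock, if_neg hj, transpose_zero, Matrix.zero_mul]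

end LeaveOneOut

namespace SmallNoise

variable {n d m : ℕ} {Z : Matrix (Fin n × Fin d) (Fin d) ℝ} {A : Matrix (Fin d) (Fin m) ℝ}
  {N : Matrix (Fin n × Fin d) (Fin m) ℝ} {a κ : ℝ}

lemma zeroBlock (h : SmallNoise Z A N a κ) (i : Fin n) :
    SmallNoise Z A (zeroBlock N i) a κ :=
  { h with noise := (mul_le_mul_of_nonneg_right (norm_zeroBlock_le N i)
      (Real.sqrt_nonneg _)).trans h.noise }

/-- Restoring the i-th noise block adds N_i N_iᵀ T_i, which involves a single block of T and so
carries no factor √n. -/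
lemma norm_block_mul_data_le (h : SmallNoise Z A N a κ) (i : Fin n)
    {T : Matrix (Fin n × Fin d) (Fin d) ℝ} (hT : T ∈ orthStack n d) :
    ‖block N i * ((Z * A + N)ᵀ * T)‖ ≤
      ‖block N i * ((Z * A + Procrustes.zeroBlock N i)ᵀ * T)‖ + n * a ^ 2 / 512 := by
  have e : block N i * ((Z * A + N)ᵀ * T) =
      block N i * ((Z * A + Procrustes.zeroBlock N i)ᵀ * T) +
        block N i * ((block N i)ᵀ * block T i) := by
    rw [← sub_zeroBlock_transpose_mul, ← Matrix.mul_add, ← Matrix.add_mul, ← transpose_add]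
    congr 3; abel
  have hT1 : ‖block T i‖ ≤ 1 := opNorm_le_of_normF zero_le_one fun E => by
    rw [normF_orthogonal_mul (hT i), one_mul]
  have ha := h.a_pos
  have hκ := h.one_le
  have hn := h.sqrt_n
  rw [e]
  refine (norm_add_le _ _).trans (add_le_add le_rfl ?_)
  calc ‖block N i * ((block N i)ᵀ * block T i)‖ ≤ ‖N‖ * (‖N‖ * 1) := by
        refine (l2_opNorm_mul _ _).trans ?_
        gcongr
        · exact norm_block_le N i
        refine (l2_opNorm_mul _ _).trans ?_
        rw [norm_transpose]
        gcongr
        exact norm_block_le N i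
    _ ≤ ‖N‖ * (2 * √n * (κ * a)) := by
        refine mul_le_mul_of_nonneg_left ?_ (norm_nonneg _)
        rw [mul_one]
        refine h.noise_le.trans ?_
        have : 1 * (a * √n) ≤ κ * (a * √n) := by gcongr
        have : 0 < a * √n := by positivity
        linarith
    _ ≤ _ := h.noise_mul_data_le'

/-- One step of the power method, with and without the `i`-th noise block. -/
lemma normF_step_sub_leaveOneOut_le (h : SmallNoise Z A N a κ) (i : Fin n)
    {S T : Matrix (Fin n × Fin d) (Fin d) ℝ} (hS : S ∈ orthStack n d) (hT : T ∈ orthStack n d)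
    (hSZ : dF S Z ≤ radius n κ) (hTZ : dF T Z ≤ radius n κ) (hTS : dF T S ≤ 1)
    (hI : ‖block N i * ((Z * A + Procrustes.zeroBlock N i)ᵀ * T)‖ * √d ≤ n * a ^ 2 / 512) :
    ∃ Q ∈ Matrix.orthogonalGroup (Fin d) ℝ,
      normF ((Z * A + Procrustes.zeroBlock N i) * (Z * A + Procrustes.zeroBlock N i)ᵀ * T -
        (Z * A + N) * (Z * A + N)ᵀ * S * Q) ≤ n * a ^ 2 / 4 := by
  obtain ⟨Q, hQ, hH, hd⟩ := exists_align T S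
  refine ⟨Q, hQ, ?_⟩
  have ha := h.a_pos
  have hκ := h.one_le
  have h1 := h.normF_contract hT hS hQ hH hd hSZ
    ((dF_triangle T Z S).trans (by rw [dF_comm Z S]; linarith))
  set N' := Procrustes.zeroBlock N i with hN'
  -- The contraction of T - SQ costs 1/8 of na²; the deleted block enters once as a row, controlled
  -- by `hI`, and once as a column, controlled by ‖N‖√d, at 1/512 each.
  have e : (Z * A + N') * (Z * A + N')ᵀ * T - (Z * A + N) * (Z * A + N)ᵀ * S * Q =
      (Z * A + N) * (Z * A + N)ᵀ * (T - S * Q) - ((N - N') * ((Z * A + N')ᵀ * T) +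
        (Z * A + N) * ((N - N')ᵀ * T)) := by
    simp only [transpose_sub, transpose_add, Matrix.mul_sub, Matrix.sub_mul, Matrix.mul_add,
      Matrix.add_mul, Matrix.mul_assoc]
    abel
  have h2 : normF ((N - N') * ((Z * A + N')ᵀ * T)) ≤ n * a ^ 2 / 512 := by
    rw [hN', normF_sub_zeroBlock_mul]
    refine (normF_le_sqrt_mul_op _).trans ?_
    rwa [mul_comm]
  have h3 : normF ((Z * A + N) * ((N - N')ᵀ * T)) ≤ n * a ^ 2 / 512 := by
    rw [hN', sub_zeroBlock_transpose_mul]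
    calc _ ≤ 2 * √n * (κ * a) * (‖N‖ * √d) := by
          refine (normF_mul_le_op _ _).trans ?_
          gcongr
          · exact normF_nonneg _
          · exact h.norm_data_le
          refine (normF_mul_le_op _ _).trans ?_
          rw [norm_transpose, normF_orthogonal (hT i)]
          gcongr
          exact norm_block_le N i
      _ = ‖N‖ * √d * (2 * √n * (κ * a)) := by ring
      _ ≤ _ := h.noise_mul_data_le
  rw [e]
  have h4 := normF_sub_le ((Z * A + N) * (Z * A + N)ᵀ * (T - S * Q))
    ((N - N') * ((Z * A + N')ᵀ * T) + (Z * A + N) * ((N - N')ᵀ * T))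
  have h5 := normF_add_le ((N - N') * ((Z * A + N')ᵀ * T)) ((Z * A + N) * ((N - N')ᵀ * T))
  have h6 := h.gram_pos
  have h7 : n * a ^ 2 / 8 * dF T S ≤ n * a ^ 2 / 8 * 1 := by gcongr
  linarith

end SmallNoise

/-! ### The power method started at the ground truth -/

section OracleIteration

variable {n d m : ℕ}

/-- One step of the power method with the matrix `D Dᵀ`. -/
noncomputable def polarStep (D : Matrix (Fin n × Fin d) (Fin m) ℝ)
    (S : Matrix (Fin n × Fin d) (Fin d) ℝ) : Matrix (Fin n × Fin d) (Fin d) ℝ :=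
  stack fun i => polar (block (D * Dᵀ * S) i)

/-- The iterates of the power method started at `Z`. -/
noncomputable def polarIter (D : Matrix (Fin n × Fin d) (Fin m) ℝ)
    (Z : Matrix (Fin n × Fin d) (Fin d) ℝ) : ℕ → Matrix (Fin n × Fin d) (Fin d) ℝ
  | 0 => Z
  | t + 1 => polarStep D (polarIter D Z t)

lemma polarStep_mem (D : Matrix (Fin n × Fin d) (Fin m) ℝ)
    (S : Matrix (Fin n × Fin d) (Fin d) ℝ) : polarStep D S ∈ orthStack n d := by
  intro i
  rw [polarStep, block_stack]
  exact polar_mem _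

lemma polarIter_mem (D : Matrix (Fin n × Fin d) (Fin m) ℝ)
    {Z : Matrix (Fin n × Fin d) (Fin d) ℝ} (hZ : Z ∈ orthStack n d) (t : ℕ) :
    polarIter D Z t ∈ orthStack n d := by
  cases t
  · exact hZ
  · exact polarStep_mem _ _

lemma isPolarStack_polarStep {D : Matrix (Fin n × Fin d) (Fin m) ℝ}
    {S : Matrix (Fin n × Fin d) (Fin d) ℝ} (h : ∀ i, (block (D * Dᵀ * S) i).det ≠ 0) :
    IsPolarStack (D * Dᵀ * S) (polarStep D S) :=
  isPolarStack_iff.2 ⟨polarStep_mem D S, fun i => by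
    rw [polarStep, block_stack]; exact polar_posSemidef (h i)⟩

end OracleIteration

/-! ### The leave-one-out induction. -/

namespace SmallNoise

variable {n d m : ℕ} {Z : Matrix (Fin n × Fin d) (Fin d) ℝ} {A : Matrix (Fin d) (Fin m) ℝ}
  {N : Matrix (Fin n × Fin d) (Fin m) ℝ} {a κ : ℝ}

lemma isPolarStack_step (h : SmallNoise Z A N a κ) {S : Matrix (Fin n × Fin d) (Fin d) ℝ}
    (hS : S ∈ orthStack n d) (hSZ : dF S Z ≤ radius n κ)
    (hG : ∀ i, ‖block N i * ((Z * A + N)ᵀ * S)‖ ≤ n * a ^ 2 / 8) :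
    IsPolarStack ((Z * A + N) * (Z * A + N)ᵀ * S) (polarStep (Z * A + N) S) :=
  isPolarStack_polarStep fun i => det_ne_zero_of_normF_mul_ge (half_pos h.gram_pos)
    fun E => h.block_lower hS hSZ hG i E

/-- The full step is nondegenerate by na²/2 and the two matrices differ by at most na²/4, so the
polar bound returns distance at most 1 and the induction closes. -/
lemma leaveOneOut_step (h : SmallNoise Z A N a κ) (i : Fin n)
    {S T : Matrix (Fin n × Fin d) (Fin d) ℝ} (hS : S ∈ orthStack n d) (hT : T ∈ orthStack n d)
    (hSZ : dF S Z ≤ radius n κ) (hTZ : dF T Z ≤ radius n κ) (hTS : dF T S ≤ 1)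
    (hG : ∀ i, ‖block N i * ((Z * A + N)ᵀ * S)‖ ≤ n * a ^ 2 / 8)
    (hI : ‖block N i * ((Z * A + Procrustes.zeroBlock N i)ᵀ * T)‖ * √d ≤ n * a ^ 2 / 512) :
    dF (polarStep (Z * A + Procrustes.zeroBlock N i) T) (polarStep (Z * A + N) S) ≤ 1 ∧
      dF (polarStep (Z * A + Procrustes.zeroBlock N i) T) Z ≤ radius n κ := by
  obtain ⟨Q, hQ, hle⟩ := h.normF_step_sub_leaveOneOut_le i hS hT hSZ hTZ hTS hI
  have hpos := h.gram_pos
  set N' := Procrustes.zeroBlock N i with hN'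
  -- `polar` has a default value at singular matrices, so nondegeneracy of the leave-one-out step
  -- must be derived too: na²/2 - na²/4 remains.
  have hpol : IsPolarStack ((Z * A + N') * (Z * A + N')ᵀ * T) (polarStep (Z * A + N') T) := by
    refine isPolarStack_polarStep fun j =>
      det_ne_zero_of_normF_mul_ge (s := n * a ^ 2 / 4) (by linarith) fun E => ?_
    have h1 := h.block_lower hS hSZ hG j (Q * E)
    rw [normF_orthogonal_mul hQ, ← Matrix.mul_assoc, ← block_mul] at h1
    set X := (Z * A + N') * (Z * A + N')ᵀ * T
    set Y := (Z * A + N) * (Z * A + N)ᵀ * S * Q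
    have h2 : normF (block Y j * E) ≤ normF (block X j * E) + normF (block (X - Y) j * E) := by
      have := normF_sub_le (block X j * E) (block (X - Y) j * E)
      rwa [← Matrix.sub_mul, ← block_sub, sub_sub_cancel] at this
    have h3 : normF (block (X - Y) j * E) ≤ n * a ^ 2 / 4 * normF E :=
      (normF_mul_le _ _).trans (mul_le_mul_of_nonneg_right ((normF_block_le _ j).trans hle)
        (normF_nonneg _))
    linarith
  refine ⟨?_, (h.zeroBlock i).dF_step_truth hT hTZ hpol⟩
  have hS' := h.isPolarStack_step hS hSZ hG
  refine (dF_polarStack_le (half_pos hpos) hpol (polarStep_mem _ _)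
    (h.posSemidef_step hS hSZ hG hS') hQ).trans ?_
  rw [div_mul_eq_mul_div, div_le_one (half_pos hpos)]
  linarith

/-- The noise blocks are not aligned with the leave-one-out iterates. -/
def LeaveOneOutIncoherent (Z : Matrix (Fin n × Fin d) (Fin d) ℝ) (A : Matrix (Fin d) (Fin m) ℝ)
    (N : Matrix (Fin n × Fin d) (Fin m) ℝ) (a : ℝ) : Prop :=
  ∀ i : Fin n, ∀ t < n, ‖block N i * ((Z * A + Procrustes.zeroBlock N i)ᵀ *
    polarIter (Z * A + Procrustes.zeroBlock N i) Z t)‖ * √d ≤ n * a ^ 2 / 512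

lemma incoherent_of_leaveOneOut (h : SmallNoise Z A N a κ)
    {S : Matrix (Fin n × Fin d) (Fin d) ℝ} {t : ℕ} (ht : t < n)
    (hI : LeaveOneOutIncoherent Z A N a)
    (hTS : ∀ i, dF (polarIter (Z * A + Procrustes.zeroBlock N i) Z t) S ≤ 1) (i : Fin n) :
    ‖block N i * ((Z * A + N)ᵀ * S)‖ ≤ n * a ^ 2 / 16 := by
  have h1 := h.incoherent_of_close (by rw [dF_comm]; exact hTS i) i
  have h2 := h.norm_block_mul_data_le i
    (polarIter_mem (Z * A + Procrustes.zeroBlock N i) h.mem t)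
  have h3 := (le_mul_of_one_le_right (norm_nonneg _) h.sqrt_d).trans (hI i t ht)
  have := h.gram_pos
  linarith

/-- All three bounds must travel together: closeness of the runs transfers incoherence to the full
run, incoherence makes its blocks nondegenerate, and nondegeneracy keeps the runs close. At t = 0
all runs coincide with Z. -/
lemma polarIter_invariant (h : SmallNoise Z A N a κ) (hI : LeaveOneOutIncoherent Z A N a) :
    ∀ t < n, dF (polarIter (Z * A + N) Z t) Z ≤ radius n κ ∧
      ∀ i, dF (polarIter (Z * A + Procrustes.zeroBlock N i) Z t) Z ≤ radius n κ ∧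
        dF (polarIter (Z * A + Procrustes.zeroBlock N i) Z t) (polarIter (Z * A + N) Z t) ≤ 1 := by
  have h0 : dF Z Z = 0 := by
    refine le_antisymm ((dF_le Z Z (one_mem _)).trans ?_) (dF_nonneg _ _)
    rw [Matrix.mul_one, sub_self, normF_zero]
  intro t
  induction t with
  | zero =>
    intro _
    simp only [polarIter, h0]
    exact ⟨radius_nonneg, fun _ => ⟨radius_nonneg, zero_le_one⟩⟩
  | succ t ih =>
    intro ht
    have ht' : t < n := by omega
    obtain ⟨h1, h2⟩ := ih ht'
    have hpos := h.gram_pos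
    have hG : ∀ i, ‖block N i * ((Z * A + N)ᵀ * polarIter (Z * A + N) Z t)‖ ≤ n * a ^ 2 / 8 :=
      fun i => (h.incoherent_of_leaveOneOut ht' hI (fun i => (h2 i).2) i).trans (by linarith)
    have hmem := polarIter_mem (Z * A + N) h.mem t
    refine ⟨h.dF_step_truth hmem h1 (h.isPolarStack_step hmem h1 hG), fun i => ?_⟩
    have := h.leaveOneOut_step i hmem (polarIter_mem (Z * A + Procrustes.zeroBlock N i) h.mem t)
      h1 (h2 i).1 (h2 i).2 hG (hI i t ht')
    exact ⟨this.2, this.1⟩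

/-! ### The maximizer -/

/-- The objective ‖DᵀT‖² is convex, so replacing one block of S raises it by at least the linear
term. At a maximizer this term is never positive: S_i maximizes ⟨·, (CS)_i⟩ over O(d), and so is a
polar factor. -/
lemma isPolarStack_of_isMax {D : Matrix (Fin n × Fin d) (Fin m) ℝ}
    {S : Matrix (Fin n × Fin d) (Fin d) ℝ} (hS : S ∈ orthStack n d)
    (hmax : ∀ T ∈ orthStack n d, normF (Dᵀ * T) ≤ normF (Dᵀ * S)) :
    IsPolarStack (D * Dᵀ * S) S := by
  refine isPolarStack_iff.2 ⟨hS, fun i => posSemidef_of_forall_innerF_le' (hS i) fun R hR => ?_⟩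
  set T := stack (Function.update (fun j => block S j) i R) with hT
  have hTj : ∀ j, block T j = if j = i then R else block S j := fun j => by
    rw [hT, block_stack, Function.update_apply]
  have hTmem : T ∈ orthStack n d := fun j => by
    rw [hTj]; split_ifs
    · exact hR
    · exact hS j
  have h1 := hmax T hTmem
  rw [← sq_le_sq₀ (normF_nonneg _) (normF_nonneg _)] at h1
  have h2 : normF (Dᵀ * T) ^ 2 = normF (Dᵀ * S) ^ 2 + 2 * innerF (Dᵀ * S) (Dᵀ * (T - S)) +
      normF (Dᵀ * (T - S)) ^ 2 := by
    rw [← normF_add_sq, ← Matrix.mul_add, add_sub_cancel]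
  have h3 : innerF (Dᵀ * S) (Dᵀ * (T - S)) = innerF (T - S) (D * Dᵀ * S) := by
    rw [innerF_comm, innerF_mul_left, transpose_transpose, Matrix.mul_assoc]
  have h4 : innerF (T - S) (D * Dᵀ * S) = innerF (R - block S i) (block (D * Dᵀ * S) i) := by
    rw [innerF_eq_sum_block, Finset.sum_eq_single_of_mem i (Finset.mem_univ i)]
    · rw [block_sub, hTj, if_pos rfl]
    · intro j _ hj
      rw [block_sub, hTj, if_neg hj, sub_self]
      simp [innerF]
  rw [innerF_sub_left R] at h4
  have := sq_nonneg (normF (Dᵀ * (T - S)))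
  linarith

/-- Compare S with the aligned truth ZQ: the signal lost is at least a²(n/2)‖E‖² and the noise
gained at most 2‖Δ‖√d√n‖E‖. -/
lemma dF_max_le (h : SmallNoise Z A N a κ) {S : Matrix (Fin n × Fin d) (Fin d) ℝ}
    (hS : S ∈ orthStack n d)
    (hmax : ∀ T ∈ orthStack n d, normF ((Z * A + N)ᵀ * T) ≤ normF ((Z * A + N)ᵀ * S)) :
    dF S Z ≤ radius n κ := by
  obtain ⟨Q, hQ, hH, hd⟩ := exists_align S Z
  have ha := h.a_pos
  have hκ := h.one_le
  have hpos := h.gram_pos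
  have hn0 : (0 : ℝ) < n := by exact_mod_cast h.n_pos
  have hn : √(n : ℝ) * √n = n := Real.mul_self_sqrt (Nat.cast_nonneg n)
  have hZQ := mul_mem_orthStack h.mem hQ
  set E := S - Z * Q with hE
  set M := Zᵀ * S with hM
  set Δ := (Z * A + N) * (Z * A + N)ᵀ - Z * A * (Z * A)ᵀ with hΔ
  -- With H = QᵀM, the right side is n⟨n - H, 1⟩ + ⟨n - H, H⟩; the first term is (n/2)‖E‖² by
  -- alignment and the second is nonnegative.
  have hgap : n / 2 * normF E ^ 2 ≤ n ^ 2 * d - normF M ^ 2 := by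
    have e1 := transpose_mul_sub_align hS h.mem hQ hH
    rw [← hM, ← hE] at e1
    have e2 : 0 ≤ innerF ((n : ℝ) • 1 - Qᵀ * M) (Qᵀ * M) := by
      rw [e1, innerF_smul_left, innerF_mul_left, transpose_transpose, innerF_comm,
        ← innerF_transpose, transpose_mul, isHermitian_iff_transpose.1 hH.1]
      have := innerF_posSemidef_mul_nonneg hH Eᵀ
      linarith
    have e3 : innerF ((n : ℝ) • 1 - Qᵀ * M) 1 = 1 / 2 * normF E ^ 2 := by
      rw [e1, innerF_smul_left, innerF_mul_left, transpose_transpose, Matrix.mul_one, normF_sq]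
    have e4 : innerF (Qᵀ * M) (Qᵀ * M) = normF M ^ 2 := by
      rw [← normF_sq, normF_orthogonal_mul (transpose_mem_orthogonal hQ)]
    have e5 : innerF (1 : Matrix (Fin d) (Fin d) ℝ) 1 = d := by
      rw [← normF_sq, normF_one_fin, Real.sq_sqrt (Nat.cast_nonneg d)]
    rw [innerF_sub_left, innerF_smul_left] at e2 e3
    rw [innerF_comm 1] at e2
    rw [e4] at e2
    rw [e5] at e3
    nlinarith
  -- Split AAᵀ = BᵀB + a²: on BᵀB the inequality ‖M‖ ≤ n suffices, and the a² part retains the whole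
  -- deficit.
  have hsignal : normF (Aᵀ * M) ^ 2 ≤ n ^ 2 * normF Aᵀ ^ 2 - a ^ 2 * (n ^ 2 * d - normF M ^ 2) := by
    obtain ⟨r, B, hB⟩ := exists_eq_transpose_mul_self h.lower
    have hAA : A * Aᵀ = Bᵀ * B + a ^ 2 • 1 := by rw [← hB]; abel
    have e1 : ∀ X : Matrix (Fin d) (Fin d) ℝ,
        normF (Aᵀ * X) ^ 2 = normF (B * X) ^ 2 + a ^ 2 * normF X ^ 2 := by
      intro X
      rw [normF_sq, innerF_mul_left, transpose_transpose, ← Matrix.mul_assoc, hAA, Matrix.add_mul,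
        innerF_add_right, Matrix.mul_assoc, ← innerF_mul_left, ← normF_sq, smul_mul,
        Matrix.one_mul, innerF_smul_right, ← normF_sq]
    have e2 := e1 1
    rw [Matrix.mul_one, Matrix.mul_one, normF_one_fin, Real.sq_sqrt (Nat.cast_nonneg d)] at e2
    have hM1 : ‖M‖ ≤ n := by
      refine (l2_opNorm_mul _ _).trans ?_
      rw [norm_transpose, ← hn]
      exact mul_le_mul (norm_orthStack_le h.mem) (norm_orthStack_le hS) (norm_nonneg _)
        (Real.sqrt_nonneg _)
    have e3 : normF (B * M) ^ 2 ≤ n ^ 2 * normF B ^ 2 := by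
      rw [← mul_pow]
      have := normF_nonneg (B * M)
      gcongr
      refine (normF_mul_le_op' _ _).trans ?_
      rw [mul_comm]
      exact mul_le_mul_of_nonneg_right hM1 (normF_nonneg _)
    rw [e1 M, e2]
    nlinarith
  have hobj : ∀ T : Matrix (Fin n × Fin d) (Fin d) ℝ, normF ((Z * A + N)ᵀ * T) ^ 2 = normF (Aᵀ * (Zᵀ * T)) ^ 2 + innerF (Δ * T) T := by
    intro T
    have : (Z * A + N) * (Z * A + N)ᵀ = Z * A * (Z * A)ᵀ + Δ := by rw [hΔ]; abel
    rw [normF_transpose_mul_sq, this, Matrix.add_mul, innerF_add_left, ← normF_transpose_mul_sq,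
      transpose_mul, Matrix.mul_assoc Aᵀ]
  have h1 := hmax _ hZQ
  rw [← sq_le_sq₀ (normF_nonneg _) (normF_nonneg _), hobj, hobj, ← Matrix.mul_assoc Zᵀ Z,
    transpose_mul_self_of_mem_orthStack h.mem, smul_mul, Matrix.one_mul, Matrix.mul_smul,
    normF_smul, normF_mul_orthogonal hQ, abs_of_pos hn0, mul_pow] at h1
  have h2 : innerF (Δ * S) S - innerF (Δ * (Z * Q)) (Z * Q) ≤ 2 * (‖Δ‖ * √d * √n * normF E) := by
    have e1 : innerF (Δ * S) S - innerF (Δ * (Z * Q)) (Z * Q) =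
        innerF (Δ * E) S + innerF (Δ * (Z * Q)) E := by
      rw [hE, Matrix.mul_sub, innerF_sub_left, innerF_sub_right]; ring
    have e2 : innerF (Δ * E) S ≤ ‖Δ‖ * normF E * (√n * √d) := by
      refine (innerF_le _ _).trans ?_
      rw [normF_orthStack hS]
      gcongr
      exact normF_mul_le_op _ _
    have e3 : innerF (Δ * (Z * Q)) E ≤ ‖Δ‖ * (√n * √d) * normF E := by
      refine (innerF_le _ _).trans ?_
      rw [← normF_orthStack hZQ]
      exact mul_le_mul_of_nonneg_right (normF_mul_le_op _ _) (normF_nonneg _)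
    rw [e1]
    linarith
  have h3 : a ^ 2 * (n / 2 * normF E ^ 2) ≤ 2 * (‖Δ‖ * √d * √n * normF E) := by
    have := mul_le_mul_of_nonneg_left hgap (sq_nonneg a)
    linarith
  have h4 : ‖Δ‖ * √d * √n ≤ n * a ^ 2 / 4 * radius n κ := by
    refine (mul_le_mul_of_nonneg_right h.perturbation_le (Real.sqrt_nonneg _)).trans ?_
    have : n * a ^ 2 / 4 * radius n κ = 8 * (n * a ^ 2) / (1024 * κ ^ 2) * √n := by
      unfold radius; field_simp; norm_num
    rw [this]
    gcongr
    · norm_num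
    · norm_num
  rw [hd]
  rcases (normF_nonneg E).lt_or_eq with h0 | h0
  · have h5 : ‖Δ‖ * √d * √n * normF E ≤ n * a ^ 2 / 4 * radius n κ * normF E := by gcongr
    have h6 : (n * a ^ 2 / 2 * normF E) * normF E ≤ (n * a ^ 2 / 2 * normF E) * radius n κ := by
      nlinarith
    exact le_of_mul_le_mul_left h6 (by positivity)
  · rw [← h0]; exact radius_nonneg

/-- It fixes the length of the oracle run: n - 1 halvings bring the radius below 1, so incoherence
is needed at n times only. -/
lemma sqrt_le_two_pow_pred {n : ℕ} (hn : 1 ≤ n) : √(n : ℝ) ≤ 2 ^ (n - 1) := by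
  have h1 : n ≤ 2 ^ (n - 1) := by
    have := Nat.lt_two_pow_self (n := n - 1)
    omega
  have h2 : (n : ℝ) ≤ 2 ^ (n - 1) := by exact_mod_cast h1
  have h3 : (1 : ℝ) ≤ 2 ^ (n - 1) := one_le_pow₀ (by norm_num)
  rw [Real.sqrt_le_left (by positivity)]
  nlinarith

/-- S is its own step, compared with the step of the oracle iterate, where incoherence and hence
nondegeneracy is known. Nothing is yet known about the blocks at S. -/
lemma dF_iter_max_le (h : SmallNoise Z A N a κ) (hI : LeaveOneOutIncoherent Z A N a)
    {S : Matrix (Fin n × Fin d) (Fin d) ℝ} (hS : S ∈ orthStack n d) (hSZ : dF S Z ≤ radius n κ)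
    (hfix : IsPolarStack ((Z * A + N) * (Z * A + N)ᵀ * S) S) :
    ∀ t < n, dF S (polarIter (Z * A + N) Z t) * 2 ^ t ≤ radius n κ := by
  intro t
  induction t with
  | zero => intro _; simpa [polarIter] using hSZ
  | succ t ih =>
    intro ht
    have ht' : t < n := by omega
    have ih' := ih ht'
    have hpos := h.gram_pos
    obtain ⟨h1, h2⟩ := h.polarIter_invariant hI t ht'
    have hmem := polarIter_mem (Z * A + N) h.mem t
    have hG : ∀ i, ‖block N i * ((Z * A + N)ᵀ * polarIter (Z * A + N) Z t)‖ ≤ n * a ^ 2 / 8 :=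
      fun i => (h.incoherent_of_leaveOneOut ht' hI (fun i => (h2 i).2) i).trans (by linarith)
    obtain ⟨Q, hQ, hH, hd⟩ := exists_align S (polarIter (Z * A + N) Z t)
    have h3 := dF_polarStack_le (half_pos hpos) hfix (polarStep_mem _ _)
      (h.posSemidef_step hmem h1 hG (h.isPolarStack_step hmem h1 hG)) hQ
    have h4 := h.normF_contract hS hmem hQ hH hd h1
      ((dF_triangle S Z _).trans (by rw [dF_comm Z]; linarith))
    rw [Matrix.mul_assoc _ _ Q, ← Matrix.mul_sub, div_mul_eq_mul_div, le_div_iff₀ (half_pos hpos)]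
      at h3
    have h5 : dF S (polarIter (Z * A + N) Z (t + 1)) ≤
        dF S (polarIter (Z * A + N) Z t) / 2 := by
      have : n * a ^ 2 / 2 * dF S (polarStep (Z * A + N) (polarIter (Z * A + N) Z t)) ≤
        n * a ^ 2 / 2 * (dF S (polarIter (Z * A + N) Z t) / 2) := by linarith
      exact le_of_mul_le_mul_left this (half_pos hpos)
    have : (0 : ℝ) < 2 ^ t := by positivity
    rw [pow_succ]
    nlinarith

/-- Every block of `C S` is well-conditioned at a maximizer `S`. -/
lemma posSemidef_max (h : SmallNoise Z A N a κ) (hI : LeaveOneOutIncoherent Z A N a)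
    {S : Matrix (Fin n × Fin d) (Fin d) ℝ} (hS : S ∈ orthStack n d) (hSZ : dF S Z ≤ radius n κ)
    (hfix : IsPolarStack ((Z * A + N) * (Z * A + N)ᵀ * S) S) (i : Fin n) :
    ((block S i)ᵀ * block ((Z * A + N) * (Z * A + N)ᵀ * S) i - (n * a ^ 2 / 2) • 1).PosSemidef := by
  refine h.posSemidef_step hS hSZ (fun i => ?_) hfix i
  have hn := h.n_pos
  have ht : n - 1 < n := by omega
  obtain ⟨-, h2⟩ := h.polarIter_invariant hI (n - 1) ht
  have h3 := h.dF_iter_max_le hI hS hSZ hfix (n - 1) ht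
  have h4 : dF S (polarIter (Z * A + N) Z (n - 1)) ≤ 1 := by
    have e1 := h.radius_le
    have e2 := sqrt_le_two_pow_pred hn
    have e3 : (0 : ℝ) < 2 ^ (n - 1) := by positivity
    by_contra hlt
    push Not at hlt
    nlinarith
  have h5 := h.incoherent_of_close h4 i
  have h6 := h.incoherent_of_leaveOneOut ht hI (fun i => (h2 i).2) i
  have := h.gram_pos
  linarith

/-- Nondegeneracy is used at S alone, so T may depend on the noise in any way; this frees the
spectral runs from leave-one-out arguments. -/
lemma dF_step_max (h : SmallNoise Z A N a κ)
    {S T P : Matrix (Fin n × Fin d) (Fin d) ℝ} (hS : S ∈ orthStack n d) (hSZ : dF S Z ≤ radius n κ)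
    (hmax : ∀ i, ((block S i)ᵀ * block ((Z * A + N) * (Z * A + N)ᵀ * S) i -
      (n * a ^ 2 / 2) • 1).PosSemidef)
    (hT : T ∈ orthStack n d) (hTS : dF T S ≤ 2 * radius n κ)
    (hP : IsPolarStack ((Z * A + N) * (Z * A + N)ᵀ * T) P) : dF P S ≤ 1 / 2 * dF T S := by
  have hpos := h.gram_pos
  obtain ⟨Q, hQ, hH, hd⟩ := exists_align T S
  have h3 := dF_polarStack_le (half_pos hpos) hP hS hmax hQ
  have h4 := h.normF_contract hT hS hQ hH hd hSZ hTS
  rw [Matrix.mul_assoc _ _ Q, ← Matrix.mul_sub, div_mul_eq_mul_div, le_div_iff₀ (half_pos hpos)]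
    at h3
  have : n * a ^ 2 / 2 * dF P S ≤ n * a ^ 2 / 2 * (1 / 2 * dF T S) := by linarith
  exact le_of_mul_le_mul_left this (half_pos hpos)

end SmallNoise

/-! ### Tightness of the semidefinite relaxation -/

section Certificate

variable {n d m r : ℕ}

lemma block_mul_transpose_eq_submatrix (X : Matrix (Fin n × Fin d) (Fin r) ℝ) (i : Fin n) :
    block X i * (block X i)ᵀ =
      (X * Xᵀ).submatrix (fun a => (i, a)) (fun a => (i, a)) := rfl

lemma exists_factor_of_sdpFeasible {G : Matrix (Fin n × Fin d) (Fin n × Fin d) ℝ}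
    (hG : G ∈ sdpFeasible n d) : ∃ (r : ℕ) (X : Matrix (Fin n × Fin d) (Fin r) ℝ),
      G = X * Xᵀ ∧ ∀ i, block X i * (block X i)ᵀ = 1 := by
  obtain ⟨r, B, rfl⟩ := exists_eq_transpose_mul_self hG.1
  exact ⟨r, Bᵀ, by simp, fun i => by
    rw [block_mul_transpose_eq_submatrix, transpose_transpose]; exact hG.2 i⟩

lemma mul_transpose_mem_sdpFeasible {S : Matrix (Fin n × Fin d) (Fin d) ℝ}
    (hS : S ∈ orthStack n d) : S * Sᵀ ∈ sdpFeasible n d := by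
  refine ⟨?_, fun i => ?_⟩
  · have := posSemidef_self_mul_conjTranspose S
    rwa [conjTranspose_eq_transpose_of_trivial] at this
  · rw [← block_mul_transpose_eq_submatrix, mul_transpose_self_of_mem (hS i)]

lemma objSDP_mul_transpose (D : Matrix (Fin n × Fin d) (Fin m) ℝ)
    (X : Matrix (Fin n × Fin d) (Fin r) ℝ) : objSDP D (X * Xᵀ) = normF (Dᵀ * X) ^ 2 := by
  rw [objSDP, innerF_comm, innerF_mul_right, transpose_transpose, normF_sq, innerF_mul_left,
    transpose_transpose, Matrix.mul_assoc]

/-- The component of the columns of `X` orthogonal to the columns of `S`. -/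
noncomputable def orthPart (S : Matrix (Fin n × Fin d) (Fin d) ℝ)
    (X : Matrix (Fin n × Fin d) (Fin r) ℝ) : Matrix (Fin n × Fin d) (Fin r) ℝ :=
  X - S * ((n : ℝ)⁻¹ • (Sᵀ * X))

lemma transpose_mul_orthPart (hn : 1 ≤ n) {S : Matrix (Fin n × Fin d) (Fin d) ℝ}
    (hS : S ∈ orthStack n d) (X : Matrix (Fin n × Fin d) (Fin r) ℝ) :
    Sᵀ * orthPart S X = 0 := by
  have hn0 : (n : ℝ) ≠ 0 := by positivity
  rw [orthPart, Matrix.mul_sub, ← Matrix.mul_assoc, transpose_mul_self_of_mem_orthStack hS,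
    smul_mul, Matrix.one_mul, smul_smul, mul_inv_cancel₀ hn0, one_smul, sub_self]

/-- The duality gap of a feasible point of the relaxation. -/
lemma objSDP_add_gap_le {D : Matrix (Fin n × Fin d) (Fin m) ℝ}
    {S : Matrix (Fin n × Fin d) (Fin d) ℝ} (hS : S ∈ orthStack n d) {s : ℝ}
    (hmax : ∀ i, ((block S i)ᵀ * block (D * Dᵀ * S) i - s • 1).PosSemidef)
    {X : Matrix (Fin n × Fin d) (Fin r) ℝ} (hX : ∀ i, block X i * (block X i)ᵀ = 1) :
    normF (Dᵀ * X) ^ 2 + s * normF (orthPart S X) ^ 2 ≤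
      normF (Dᵀ * S) ^ 2 + normF (Dᵀ * orthPart S X) ^ 2 := by
  set C := D * Dᵀ with hC
  have hCT : Cᵀ = C := by rw [hC, transpose_mul, transpose_transpose]
  set H : Fin n → Matrix (Fin d) (Fin d) ℝ := fun i => (block S i)ᵀ * block (C * S) i with hH
  have hHT : ∀ i, (H i)ᵀ = H i := fun i => by
    have := isHermitian_iff_transpose.1 (hmax i).1
    rw [transpose_sub] at this
    simpa [hH] using this
  have hSH : ∀ i, block S i * H i = block (C * S) i := fun i => by
    rw [hH, ← Matrix.mul_assoc, mul_transpose_self_of_mem (hS i), Matrix.one_mul]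
  -- The Lagrange multiplier of the constraints G_ii = 1: block diagonal, symmetric, equal to C on
  -- the range of S, and at least s.
  set L : Matrix (Fin n × Fin d) (Fin r) ℝ → Matrix (Fin n × Fin d) (Fin r) ℝ := fun Y =>
    stack fun i => block S i * H i * (block S i)ᵀ * block Y i with hL
  have hLb : ∀ Y i, block (L Y) i = block S i * H i * (block S i)ᵀ * block Y i := fun _ _ => rfl
  have hLsymm : ∀ Y Y', innerF (L Y) Y' = innerF (L Y') Y := by
    intro Y Y'
    rw [innerF_eq_sum_block, innerF_eq_sum_block]
    refine Finset.sum_congr rfl fun i _ => ?_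
    rw [hLb, hLb, innerF_mul_left, innerF_comm]
    simp only [transpose_mul, transpose_transpose, hHT, Matrix.mul_assoc]
  have hLS : ∀ Y : Matrix (Fin d) (Fin r) ℝ, L (S * Y) = C * (S * Y) := by
    intro Y
    refine block_ext fun i => ?_
    rw [hLb, block_mul, ← Matrix.mul_assoc, Matrix.mul_assoc _ _ (block S i),
      transpose_mul_self_of_mem (hS i), Matrix.mul_one, hSH, ← Matrix.mul_assoc, block_mul (C * S)]
  have hLadd : ∀ Y Y', L (Y + Y') = L Y + L Y' := fun Y Y' => by
    refine block_ext fun i => ?_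
    rw [block_add, hLb, hLb, hLb, block_add, Matrix.mul_add]
  -- Weak duality: the multiplier pairs with X only through X_i X_iᵀ = 1, so its value is the same
  -- at every feasible point.
  have htrace : innerF (L X) X = normF (Dᵀ * S) ^ 2 := by
    rw [normF_transpose_mul_sq, innerF_eq_sum_block, innerF_eq_sum_block (D * Dᵀ * S)]
    refine Finset.sum_congr rfl fun i _ => ?_
    rw [hLb, innerF_comm, ← hC, ← hSH, ← transpose_transpose (block X i), ← innerF_mul_right,
      transpose_transpose, hX, innerF_comm, innerF_mul_right, transpose_transpose, Matrix.one_mul]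
  set V := orthPart S X with hV
  set Y := (n : ℝ)⁻¹ • (Sᵀ * X) with hY
  have hXY : X = S * Y + V := by rw [hV, orthPart, ← hY]; abel
  have hpos : s * normF V ^ 2 ≤ innerF (L V) V := by
    rw [normF_sq_eq_sum_block, Finset.mul_sum, innerF_eq_sum_block]
    refine Finset.sum_le_sum fun i _ => ?_
    have h1 := innerF_posSemidef_mul_nonneg (hmax i) ((block S i)ᵀ * block V i)
    rw [Matrix.sub_mul, innerF_sub_left, smul_mul, Matrix.one_mul, innerF_smul_left, ← normF_sq,
      normF_orthogonal_mul (transpose_mem_orthogonal (hS i))] at h1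
    have h2 : innerF (block (L V) i) (block V i) =
        innerF (H i * ((block S i)ᵀ * block V i)) ((block S i)ᵀ * block V i) := by
      rw [hLb, ← innerF_mul_left (block S i)]
      simp only [Matrix.mul_assoc]
    rw [h2]
    linarith
  have hcross : innerF (L V) (S * Y) = innerF (C * (S * Y)) V := by rw [hLsymm, hLS]
  have h1 : innerF (L X) X = innerF (C * (S * Y)) (S * Y) + 2 * innerF (C * (S * Y)) V +
      innerF (L V) V := by
    rw [hXY, hLadd, innerF_add_left, innerF_add_right, innerF_add_right, hcross, hLS]
    ring
  have h2 : normF (Dᵀ * X) ^ 2 = innerF (C * (S * Y)) (S * Y) + 2 * innerF (C * (S * Y)) V +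
      normF (Dᵀ * V) ^ 2 := by
    have e : innerF (C * V) (S * Y) = innerF (C * (S * Y)) V := by
      rw [innerF_mul_left, hCT, innerF_comm]
    rw [normF_transpose_mul_sq, normF_transpose_mul_sq, ← hC, hXY, Matrix.mul_add, innerF_add_left,
      innerF_add_right, innerF_add_right, e]
    ring
  linarith

end Certificate

/-! ### The two programs -/

section Programs

variable {n d m : ℕ}

lemma normF_sq_eq_objP (A : Fin n → Matrix (Fin d) (Fin m) ℝ)
    {S : Matrix (Fin n × Fin d) (Fin d) ℝ} (hS : S ∈ orthStack n d) :
    normF ((stack A)ᵀ * S) ^ 2 = ∑ i, (A i * (A i)ᵀ).trace + 2 * objP A S := by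
  set f : Fin n → Fin n → ℝ := fun i j => innerF (A i * (A j)ᵀ) (block S i * (block S j)ᵀ) with hf
  have hsymm : ∀ i j, f i j = f j i := fun i j => by
    simp only [hf]; rw [← innerF_transpose]; simp [transpose_mul]
  have h1 : normF ((stack A)ᵀ * S) ^ 2 = ∑ i, ∑ j, f i j := by
    rw [normF_transpose_mul_sq, innerF_eq_sum_block]
    refine Finset.sum_congr rfl fun i _ => ?_
    rw [Matrix.mul_assoc, block_mul, block_stack, transpose_mul_eq_sum_block, Matrix.mul_sum,
      innerF_comm, innerF, Matrix.mul_sum, trace_sum]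
    refine Finset.sum_congr rfl fun j _ => ?_
    simp only [hf, block_stack]
    rw [← innerF, ← Matrix.mul_assoc, innerF_comm, innerF_mul_right]
  have h2 : ∀ i, f i i = (A i * (A i)ᵀ).trace := fun i => by
    simp only [hf]
    rw [mul_transpose_self_of_mem (hS i), trace_eq_innerF_one, innerF_comm]
  have h3 : ∀ i, ∑ j, f i j = f i i + ∑ j ∈ Finset.Ioi i, f i j + ∑ j ∈ Finset.Iio i, f i j := by
    intro i
    have hu : (Finset.univ : Finset (Fin n)) = {i} ∪ Finset.Ioi i ∪ Finset.Iio i := by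
      ext j; simp; omega
    rw [hu, Finset.sum_union, Finset.sum_union, Finset.sum_singleton]
    · simp
    · rw [Finset.disjoint_left]; intro j; simp
  have h4 : ∑ i, ∑ j ∈ Finset.Iio i, f i j = ∑ i, ∑ j ∈ Finset.Ioi i, f i j := by
    rw [Finset.sum_comm' (t' := Finset.univ) (s' := fun j => Finset.Ioi j) (by simp)]
    exact Finset.sum_congr rfl fun i _ => Finset.sum_congr rfl fun j _ => hsymm _ _
  rw [h1, Finset.sum_congr rfl fun i _ => h3 i, Finset.sum_add_distrib, Finset.sum_add_distrib, h4,
    Finset.sum_congr rfl fun i _ => h2 i, objP]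
  ring

lemma objP_le_iff (A : Fin n → Matrix (Fin d) (Fin m) ℝ)
    {S T : Matrix (Fin n × Fin d) (Fin d) ℝ} (hS : S ∈ orthStack n d) (hT : T ∈ orthStack n d) :
    objP A T ≤ objP A S ↔ normF ((stack A)ᵀ * T) ^ 2 ≤ normF ((stack A)ᵀ * S) ^ 2 := by
  rw [normF_sq_eq_objP A hS, normF_sq_eq_objP A hT]
  constructor <;> intro h <;> linarith

lemma exists_isMaxOn_objP (A : Fin n → Matrix (Fin d) (Fin m) ℝ)
    {Z : Matrix (Fin n × Fin d) (Fin d) ℝ} (hZ : Z ∈ orthStack n d) :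
    ∃ S ∈ orthStack n d, IsMaxOn (objP A) (orthStack n d) S := by
  refine isCompact_orthStack.exists_isMaxOn ⟨Z, hZ⟩ (Continuous.continuousOn ?_)
  unfold objP innerF block
  fun_prop

lemma eq_mul_of_mul_transpose_eq (hn : 1 ≤ n) {S T : Matrix (Fin n × Fin d) (Fin d) ℝ}
    (hS : S ∈ orthStack n d) (hT : T ∈ orthStack n d) (h : T * Tᵀ = S * Sᵀ) :
    ∃ Q ∈ Matrix.orthogonalGroup (Fin d) ℝ, T = S * Q := by
  have hn0 : (n : ℝ) ≠ 0 := by positivity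
  have hTS : T = S * ((n : ℝ)⁻¹ • (Sᵀ * T)) := by
    rw [Matrix.mul_smul, ← Matrix.mul_assoc, ← h, Matrix.mul_assoc,
      transpose_mul_self_of_mem_orthStack hT, Matrix.mul_smul, smul_smul, inv_mul_cancel₀ hn0,
      one_smul, Matrix.mul_one]
  set Q := (n : ℝ)⁻¹ • (Sᵀ * T)
  refine ⟨Q, ?_, hTS⟩
  let i : Fin n := ⟨0, hn⟩
  have hQ : Q = (block S i)ᵀ * block T i := by
    rw [hTS, block_mul, ← Matrix.mul_assoc, transpose_mul_self_of_mem (hS i), Matrix.one_mul]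
  rw [hQ]
  exact mul_mem (transpose_mem_orthogonal (hS i)) (hT i)

end Programs

/-! ### The deterministic theorem. -/

namespace SmallNoise

variable {n d m : ℕ} {Z : Matrix (Fin n × Fin d) (Fin d) ℝ} {A : Matrix (Fin d) (Fin m) ℝ}
  {N : Matrix (Fin n × Fin d) (Fin m) ℝ} {a κ : ℝ}

/-- Columns orthogonal to S are almost orthogonal to Z, so the signal nearly vanishes on them and C
stays strictly below the multiplier bound na²/2. -/
lemma normF_data_orth_le (h : SmallNoise Z A N a κ) {S : Matrix (Fin n × Fin d) (Fin d) ℝ}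
    (hSZ : dF S Z ≤ radius n κ) {r : ℕ} {V : Matrix (Fin n × Fin d) (Fin r) ℝ} (hV : Sᵀ * V = 0) :
    normF ((Z * A + N)ᵀ * V) ^ 2 ≤ n * a ^ 2 / 4 * normF V ^ 2 := by
  have ha := h.a_pos
  have hκ := h.one_le
  have hn : √(n : ℝ) ^ 2 = n := Real.sq_sqrt (Nat.cast_nonneg n)
  obtain ⟨Q, hQ, -, hd⟩ := exists_align Z S
  have h1 : normF (Zᵀ * V) ≤ radius n κ * normF V := by
    have e : Zᵀ * V = (Z - S * Q)ᵀ * V := by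
      rw [transpose_sub, Matrix.sub_mul, transpose_mul, Matrix.mul_assoc, hV, Matrix.mul_zero,
        sub_zero]
    rw [e]
    refine (normF_mul_le _ _).trans ?_
    rw [normF_transpose, ← hd, dF_comm]
    exact mul_le_mul_of_nonneg_right hSZ (normF_nonneg _)
  have h2 : normF ((Z * A + N)ᵀ * V) ≤ a * √n / 2 * normF V := by
    have e : (Z * A + N)ᵀ * V = Aᵀ * (Zᵀ * V) + Nᵀ * V := by
      rw [transpose_add, Matrix.add_mul, transpose_mul, Matrix.mul_assoc]
    have e1 : normF (Aᵀ * (Zᵀ * V)) ≤ a * √n / 32 * normF V := by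
      calc _ ≤ κ * a * (radius n κ * normF V) := by
            refine (normF_mul_le_op _ _).trans ?_
            rw [norm_transpose]
            gcongr
            · exact normF_nonneg _
            · exact h.upper
        _ = a * √n / (32 * κ) * normF V := by unfold radius; field_simp
        _ ≤ a * √n / 32 * normF V := by
            refine mul_le_mul_of_nonneg_right ?_ (normF_nonneg _)
            exact div_le_div_of_nonneg_left (by positivity) (by norm_num) (by linarith)
    have e2 : normF (Nᵀ * V) ≤ a * √n / 1024 * normF V := by
      refine (normF_mul_le_op _ _).trans ?_
      rw [norm_transpose]
      exact mul_le_mul_of_nonneg_right h.noise_le (normF_nonneg _)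
    rw [e]
    refine (normF_add_le _ _).trans ?_
    have : 0 ≤ a * √n * normF V := mul_nonneg (by positivity) (normF_nonneg _)
    linarith
  calc _ ≤ (a * √n / 2 * normF V) ^ 2 := by
        have := normF_nonneg ((Z * A + N)ᵀ * V)
        gcongr
    _ = a ^ 2 * √n ^ 2 / 4 * normF V ^ 2 := by ring
    _ = _ := by rw [hn]; ring

theorem exists_isGPMSolution (h : SmallNoise Z A N a κ) (hI : LeaveOneOutIncoherent Z A N a)
    {B : Fin n → Matrix (Fin d) (Fin m) ℝ} (hB : stack B = Z * A + N)
    (hinit : ∀ U S, IsTopLeftSingular (Z * A + N) U → IsPolarStack U S → dF S Z ≤ radius n κ) :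
    ∃ S, IsGPMSolution B (1 / 2) S := by
  obtain ⟨S, hS, hSmax⟩ := exists_isMaxOn_objP B h.mem
  have hn := h.n_pos
  have hpos := h.gram_pos
  have hmaxF : ∀ T ∈ orthStack n d, normF ((Z * A + N)ᵀ * T) ≤ normF ((Z * A + N)ᵀ * S) :=
    fun T hT => by
      rw [← sq_le_sq₀ (normF_nonneg _) (normF_nonneg _), ← hB, ← objP_le_iff B hS hT]
      exact hSmax hT
  have hSZ := h.dF_max_le hS hmaxF
  have hfix := isPolarStack_of_isMax hS hmaxF
  have hblocks := h.posSemidef_max hI hS hSZ hfix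
  -- The multiplier contributes na²/2 on the orthogonal part and C at most na²/4; the strict
  -- difference yields uniqueness.
  have hgap : ∀ (r : ℕ) (X : Matrix (Fin n × Fin d) (Fin r) ℝ),
      (∀ i, block X i * (block X i)ᵀ = 1) →
      normF ((Z * A + N)ᵀ * X) ^ 2 + n * a ^ 2 / 4 * normF (orthPart S X) ^ 2 ≤
        normF ((Z * A + N)ᵀ * S) ^ 2 := by
    intro r X hX
    have h1 := objSDP_add_gap_le hS hblocks hX
    have h2 := h.normF_data_orth_le hSZ (transpose_mul_orthPart hn hS X)
    linarith
  have huniq : ∀ G ∈ sdpFeasible n d, IsMaxOn (objSDP (stack B)) (sdpFeasible n d) G →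
      G = S * Sᵀ := by
    intro G hG hGmax
    obtain ⟨r, X, rfl, hX⟩ := exists_factor_of_sdpFeasible hG
    have h1 : objSDP (stack B) (S * Sᵀ) ≤ objSDP (stack B) (X * Xᵀ) :=
      hGmax (mul_transpose_mem_sdpFeasible hS)
    rw [objSDP_mul_transpose, objSDP_mul_transpose, hB] at h1
    have h2 := hgap r X hX
    have h3 : normF (orthPart S X) ^ 2 ≤ 0 := by
      by_contra hlt
      push Not at hlt
      have : 0 < n * a ^ 2 / 4 * normF (orthPart S X) ^ 2 := by positivity
      linarith
    have h4 : orthPart S X = 0 :=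
      normF_eq_zero.1 (pow_eq_zero_iff two_ne_zero |>.1 (le_antisymm h3 (sq_nonneg _)))
    set Y := (n : ℝ)⁻¹ • (Sᵀ * X) with hY
    have hXY : X = S * Y := by rw [orthPart, ← hY, sub_eq_zero] at h4; exact h4
    let i : Fin n := ⟨0, hn⟩
    have h5 : Y * Yᵀ = 1 := by
      have h6 := hX i
      rw [hXY, block_mul, transpose_mul] at h6
      have h7 : (block S i)ᵀ * (block S i * Y * (Yᵀ * (block S i)ᵀ)) * block S i =
          (block S i)ᵀ * 1 * block S i := by rw [h6]
      rw [Matrix.mul_one, transpose_mul_self_of_mem (hS i)] at h7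
      rw [← h7]
      simp only [← Matrix.mul_assoc, transpose_mul_self_of_mem (hS i), Matrix.one_mul]
      rw [Matrix.mul_assoc _ _ (block S i), transpose_mul_self_of_mem (hS i), Matrix.mul_one]
    rw [hXY, transpose_mul, Matrix.mul_assoc, ← Matrix.mul_assoc Y, h5, Matrix.one_mul]
  have hmaxSDP : IsMaxOn (objSDP (stack B)) (sdpFeasible n d) (S * Sᵀ) := by
    intro G hG
    obtain ⟨r, X, rfl, hX⟩ := exists_factor_of_sdpFeasible hG
    have h2 := hgap r X hX
    have : 0 ≤ n * a ^ 2 / 4 * normF (orthPart S X) ^ 2 := by positivity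
    change objSDP (stack B) (X * Xᵀ) ≤ objSDP (stack B) (S * Sᵀ)
    rw [objSDP_mul_transpose, objSDP_mul_transpose, hB]
    linarith
  have hlin : ∀ T, IsSpectralGPM (stack B) T → ∀ t, T t ∈ orthStack n d ∧
      dF (T t) S ≤ (1 / 2) ^ t * dF (T 0) S := by
    intro T hT
    obtain ⟨⟨U, hU, hU0⟩, hstep⟩ := hT
    rw [hB] at hU
    -- Both the initialization and S lie within one radius of Z, hence the doubled basin in
    -- `dF_step_max`.
    have h0 : dF (T 0) S ≤ 2 * radius n κ := by
      refine (dF_triangle _ Z _).trans ?_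
      rw [dF_comm Z S]
      linarith [hinit U (T 0) hU hU0]
    intro t
    induction t with
    | zero => exact ⟨(isPolarStack_iff.1 hU0).1, by simp⟩
    | succ t ih =>
      have h1 := hstep t
      rw [IsGPMStep, hB] at h1
      refine ⟨(isPolarStack_iff.1 h1).1, ?_⟩
      have h2 : (1 / 2 : ℝ) ^ t ≤ 1 := pow_le_one₀ (by norm_num) (by norm_num)
      have h3 : (1 / 2 : ℝ) ^ t * dF (T 0) S ≤ dF (T 0) S :=
        mul_le_of_le_one_left (dF_nonneg _ _) h2
      have h4 := h.dF_step_max hS hSZ hblocks ih.1 (ih.2.trans (h3.trans h0)) h1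
      rw [pow_succ]
      linarith [ih.2]
  refine ⟨S, hS, fun T => ⟨fun hT => ?_, fun hT => ?_⟩, fun T hT t => (hlin T hT t).2, ?_, hSmax, ?_,
    mul_transpose_mem_sdpFeasible hS, hmaxSDP, huniq⟩
  · rw [IsGPMStep, hB] at hT
    have h1 := normF_polarStack_sub_le (half_pos hpos) hT hS hblocks
    rw [sub_self, normF_zero, mul_zero] at h1
    exact sub_eq_zero.1 (normF_eq_zero.1 (le_antisymm h1 (normF_nonneg _)))
  · rw [hT, IsGPMStep, hB]; exact hfix
  · intro T hT S' hS' hlim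
    have h1 : Tendsto (fun t => dF (T t) S) atTop (𝓝 0) := by
      refine squeeze_zero (fun _ => dF_nonneg _ _) (fun t => (hlin T hT t).2) ?_
      simpa using (tendsto_pow_atTop_nhds_zero_of_lt_one (by norm_num : (0 : ℝ) ≤ 1 / 2)
        (by norm_num)).mul_const (dF (T 0) S)
    have h2 : dF S' S ≤ 0 := by
      refine ge_of_tendsto' (by simpa using hlim.add h1) fun t => ?_
      rw [dF_comm (T t) S']
      exact dF_triangle _ _ _
    obtain ⟨Q, hQ, -, hd⟩ := exists_align S' S
    refine ⟨Q, hQ, sub_eq_zero.1 (normF_eq_zero.1 ?_)⟩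
    rw [← hd]
    exact le_antisymm h2 (dF_nonneg _ _)
  · intro S' hS' hmax'
    refine eq_mul_of_mul_transpose_eq hn hS hS' (huniq _ (mul_transpose_mem_sdpFeasible hS') ?_)
    intro G hG
    refine le_trans (b := objSDP (stack B) (S * Sᵀ)) (hmaxSDP hG) ?_
    change objSDP (stack B) (S * Sᵀ) ≤ objSDP (stack B) (S' * S'ᵀ)
    rw [objSDP_mul_transpose, objSDP_mul_transpose]
    exact (objP_le_iff B hS' hS).1 (hmax' hS)

end SmallNoise

/-! ### Singular values -/

section SingularValues

variable {ι κ : Type*} [Fintype ι] [Fintype κ] [DecidableEq ι] [DecidableEq κ]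
  {m d : ℕ}

/-- An orthonormal basis of right singular vectors. -/
noncomputable def rightBasis (X : Matrix ι (Fin m) ℝ) :
    OrthonormalBasis (Fin m) ℝ (EuclideanSpace ℝ (Fin m)) :=
  (toEuclideanLin X).isSymmetric_adjoint_comp_self.eigenvectorBasis finrank_euclideanSpace_fin

lemma inner_toEuclideanLin_rightBasis (X : Matrix ι (Fin m) ℝ) (i : Fin m)
    (x : EuclideanSpace ℝ (Fin m)) :
    inner ℝ (toEuclideanLin X (rightBasis X i)) (toEuclideanLin X x) =
      sv X i ^ 2 * inner ℝ (rightBasis X i) x := by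
  rw [← LinearMap.adjoint_inner_left, ← LinearMap.comp_apply, rightBasis,
    LinearMap.IsSymmetric.apply_eigenvectorBasis, real_inner_smul_left, sv,
    LinearMap.sq_singularValues_fin (toEuclideanLin X) finrank_euclideanSpace_fin i]
  rfl

lemma norm_toEuclideanLin_sq (X : Matrix ι (Fin m) ℝ) (x : EuclideanSpace ℝ (Fin m)) :
    ‖toEuclideanLin X x‖ ^ 2 = ∑ i : Fin m, sv X i ^ 2 * inner ℝ (rightBasis X i) x ^ 2 := by
  rw [← real_inner_self_eq_norm_sq]
  conv_lhs => enter [2]; rw [← (rightBasis X).sum_repr' x, map_sum]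
  rw [sum_inner, Finset.sum_congr rfl fun i _ => ?_]
  rw [map_smul, real_inner_smul_left, inner_toEuclideanLin_rightBasis]
  ring

lemma sv_nonneg (X : Matrix ι κ ℝ) (j : ℕ) : 0 ≤ sv X j := LinearMap.singularValues_nonneg _ j

lemma sv_antitone (X : Matrix ι κ ℝ) : Antitone (sv X) := LinearMap.singularValues_antitone _

lemma normF_replicateCol (x : EuclideanSpace ℝ ι) :
    normF (replicateCol (Fin 1) (x : ι → ℝ)) = ‖x‖ := by
  rw [← sq_eq_sq₀ (normF_nonneg _) (norm_nonneg _), normF_replicateCol_sq,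
    EuclideanSpace.norm_sq_eq]
  simp [dotProduct, ← pow_two]

lemma replicateCol_col (E : Matrix ι (Fin 1) ℝ) :
    replicateCol (Fin 1) (WithLp.toLp 2 (E.col 0) : EuclideanSpace ℝ ι) = E := by
  ext i j; fin_cases j; rfl

lemma normF_mul_replicateCol (X : Matrix ι κ ℝ) (x : EuclideanSpace ℝ κ) :
    normF (X * replicateCol (Fin 1) (x : κ → ℝ)) = ‖toEuclideanLin X x‖ := by
  rw [← replicateCol_mulVec, ← normF_replicateCol]
  rfl

lemma norm_le_sv_zero (X : Matrix ι (Fin m) ℝ) : ‖X‖ ≤ sv X 0 := by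
  refine opNorm_le_of_normF (sv_nonneg _ _) fun E => ?_
  rw [← replicateCol_col E, normF_mul_replicateCol, normF_replicateCol]
  set x : EuclideanSpace ℝ (Fin m) := WithLp.toLp 2 (E.col 0)
  refine le_of_sq_le_sq ?_ (mul_nonneg (sv_nonneg _ _) (norm_nonneg _))
  rw [norm_toEuclideanLin_sq, mul_pow, ← (rightBasis X).sum_sq_norm_inner_right x, Finset.mul_sum]
  refine Finset.sum_le_sum fun i _ => ?_
  have := sv_nonneg X i
  rw [Real.norm_eq_abs, sq_abs]
  gcongr
  exact sv_antitone X (Nat.zero_le _)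

/-- Lower bound on a singular value in terms of a large subspace. -/
lemma le_sv_of_forall {X : Matrix ι (Fin m) ℝ} {B : Matrix (Fin m) (Fin d) ℝ} {L : ℝ} {j : ℕ}
    (hj : j < d) (hB : ∀ y : EuclideanSpace ℝ (Fin d), y ≠ 0 → toEuclideanLin B y ≠ 0)
    (h : ∀ y : EuclideanSpace ℝ (Fin d),
      L * ‖toEuclideanLin B y‖ ≤ ‖toEuclideanLin X (toEuclideanLin B y)‖) : L ≤ sv X j := by
  by_contra! hlt
  have hL : 0 < L := (sv_nonneg _ _).trans_lt hlt
  -- Dimension count: the range of B has dimension d > j, so it contains a nonzero vector orthogonal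
  -- to the first j right singular vectors.
  let f : EuclideanSpace ℝ (Fin d) →ₗ[ℝ] ({i : Fin m // (i : ℕ) < j} → ℝ) :=
    LinearMap.pi fun i => (innerₛₗ ℝ (rightBasis X i)) ∘ₗ toEuclideanLin B
  have hrank : Module.finrank ℝ ({i : Fin m // (i : ℕ) < j} → ℝ) <
      Module.finrank ℝ (EuclideanSpace ℝ (Fin d)) := by
    rw [Module.finrank_fintype_fun_eq_card, finrank_euclideanSpace_fin]
    refine lt_of_le_of_lt ?_ hj
    conv_rhs => rw [← Fintype.card_fin j]
    exact Fintype.card_le_of_injective (fun i => (⟨i.1, i.2⟩ : Fin j)) fun i i' hi => by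
      simpa [Subtype.ext_iff, Fin.ext_iff] using hi
  obtain ⟨y, hy, hy0⟩ := Submodule.exists_mem_ne_zero_of_ne_bot
    (LinearMap.ker_ne_bot_of_finrank_lt (f := f) hrank)
  have hyi : ∀ i : Fin m, (i : ℕ) < j → inner ℝ (rightBasis X i) (toEuclideanLin B y) = 0 := by
    intro i hi
    exact congrFun (LinearMap.mem_ker.1 hy) ⟨i, hi⟩
  set x := toEuclideanLin B y with hx
  have hx0 : 0 < ‖x‖ := norm_pos_iff.2 (hB y hy0)
  have h1 : ‖toEuclideanLin X x‖ ^ 2 ≤ sv X j ^ 2 * ‖x‖ ^ 2 := by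
    rw [norm_toEuclideanLin_sq, ← (rightBasis X).sum_sq_norm_inner_right x, Finset.mul_sum]
    refine Finset.sum_le_sum fun i _ => ?_
    by_cases hi : (i : ℕ) < j
    · rw [hyi i hi]; simp
    · have := sv_nonneg X i
      rw [Real.norm_eq_abs, sq_abs]
      gcongr
      exact sv_antitone X (not_lt.1 hi)
  have h2 := h y
  rw [← hx] at h2
  have h3 : (L * ‖x‖) ^ 2 ≤ ‖toEuclideanLin X x‖ ^ 2 := by gcongr
  have h4 : (L * ‖x‖) ^ 2 ≤ (sv X j * ‖x‖) ^ 2 := by rw [mul_pow (sv X j)]; exact h3.trans h1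
  have h5 := le_of_sq_le_sq h4 (mul_nonneg (sv_nonneg _ _) hx0.le)
  exact absurd (le_of_mul_le_mul_right h5 hx0) (not_le.2 hlt)

/-- The normalized images of the first d right singular vectors form an orthonormal basis of ℝ^d
because their singular values are positive; Parseval in that basis gives |Aᵀy| ≥ σ_min |y|. -/
lemma posSemidef_sub_sigmaMin (hd : 1 ≤ d) (hdm : d ≤ m) (A : Matrix (Fin d) (Fin m) ℝ)
    (hA : 0 < sigmaMin A) : (A * Aᵀ - sigmaMin A ^ 2 • 1).PosSemidef := by
  have hsym : (A * Aᵀ - sigmaMin A ^ 2 • 1)ᵀ = A * Aᵀ - sigmaMin A ^ 2 • 1 := by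
    simp [transpose_sub, transpose_mul]
  refine posSemidef_of_innerF hsym fun E => ?_
  rw [Matrix.sub_mul, innerF_sub_left, smul_mul, Matrix.one_mul, innerF_smul_left, ← normF_sq,
    ← normF_transpose_mul_sq, ← replicateCol_col E, normF_mul_replicateCol,
    normF_replicateCol, sub_nonneg]
  set y : EuclideanSpace ℝ (Fin d) := WithLp.toLp 2 (E.col 0)
  let c : Fin d → Fin m := Fin.castLE hdm
  have hsv : ∀ j : Fin d, sigmaMin A ≤ sv A (c j) := fun j =>
    sv_antitone A (by simp [c]; omega)
  have hpos : ∀ j : Fin d, 0 < sv A (c j) := fun j => hA.trans_le (hsv j)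
  let u : Fin d → EuclideanSpace ℝ (Fin d) := fun j =>
    (sv A (c j))⁻¹ • toEuclideanLin A (rightBasis A (c j))
  have hu : Orthonormal ℝ u := by
    rw [orthonormal_iff_ite]
    intro i j
    simp only [u, real_inner_smul_left, real_inner_smul_right, inner_toEuclideanLin_rightBasis,
      orthonormal_iff_ite.1 (rightBasis A).orthonormal]
    have hc : c i = c j ↔ i = j := (Fin.castLE_injective hdm).eq_iff
    by_cases hij : i = j
    · subst hij
      have := (hpos i).ne'
      simp only [if_true]
      field_simp
    · simp [hc, hij]
  have : Nonempty (Fin d) := ⟨⟨0, hd⟩⟩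
  let b := OrthonormalBasis.mk hu (by
    rw [← hu.linearIndependent.span_eq_top_of_card_eq_finrank (by simp)])
  have hb : ∀ j, b j = u j := fun j => by simp [b]
  have h1 : ‖toEuclideanLin Aᵀ y‖ ^ 2 = ∑ i, inner ℝ (toEuclideanLin A (rightBasis A i)) y ^ 2 := by
    rw [← (rightBasis A).sum_sq_inner_right]
    refine Finset.sum_congr rfl fun i _ => ?_
    rw [← conjTranspose_eq_transpose_of_trivial, toEuclideanLin_conjTranspose_eq_adjoint,
      LinearMap.adjoint_inner_right]
  rw [h1, ← b.sum_sq_inner_right y, Finset.mul_sum]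
  calc ∑ j, sigmaMin A ^ 2 * inner ℝ (b j) y ^ 2
      ≤ ∑ j, inner ℝ (toEuclideanLin A (rightBasis A (c j))) y ^ 2 := by
        refine Finset.sum_le_sum fun j _ => ?_
        rw [hb, real_inner_smul_left, mul_pow, ← mul_assoc]
        refine mul_le_of_le_one_left (sq_nonneg _) ?_
        rw [← mul_pow, ← div_eq_mul_inv]
        exact pow_le_one₀ (div_nonneg hA.le (hpos j).le) ((div_le_one (hpos j)).2 (hsv j))
    _ ≤ _ := by
        rw [← Finset.sum_image (s := Finset.univ) (g := c)
          (f := fun i => inner ℝ (toEuclideanLin A (rightBasis A i)) y ^ 2)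
          ((Fin.castLE_injective hdm).injOn)]
        exact Finset.sum_le_sum_of_subset_of_nonneg (Finset.subset_univ _)
          fun _ _ _ => sq_nonneg _

lemma sigmaMin_le_sigmaMax (A : Matrix (Fin d) (Fin m) ℝ) : sigmaMin A ≤ sigmaMax A :=
  sv_antitone A (Nat.zero_le _)

end SingularValues

/-! ### Spectral initialization -/

namespace SmallNoise

variable {n d m : ℕ} {Z : Matrix (Fin n × Fin d) (Fin d) ℝ} {A : Matrix (Fin d) (Fin m) ℝ}
  {N : Matrix (Fin n × Fin d) (Fin m) ℝ} {a κ : ℝ}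

/-- Test on the range of Aᵀ, of dimension d, where ZA stretches by at least a√n and the noise is
negligible. -/
lemma sv_data_ge (h : SmallNoise Z A N a κ) {j : ℕ} (hj : j < d) :
    a * √n / 2 ≤ sv (Z * A + N) j := by
  have ha := h.a_pos
  have hn := h.sqrt_n
  have hAE : ∀ E : Matrix (Fin d) (Fin 1) ℝ, a ^ 2 * normF E ^ 2 ≤ normF (Aᵀ * E) ^ 2 := by
    intro E
    have := innerF_posSemidef_mul_nonneg h.lower E
    rw [Matrix.sub_mul, innerF_sub_left, smul_mul, Matrix.one_mul, innerF_smul_left, ← normF_sq,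
      ← normF_transpose_mul_sq] at this
    linarith
  refine le_sv_of_forall (B := Aᵀ) hj (fun y hy h0 => ?_) fun y => ?_
  · have h1 := hAE (replicateCol (Fin 1) y)
    rw [normF_mul_replicateCol, normF_replicateCol, h0, norm_zero] at h1
    have : 0 < ‖y‖ := norm_pos_iff.2 hy
    have : 0 < a ^ 2 * ‖y‖ ^ 2 := by positivity
    linarith
  · set E := replicateCol (Fin 1) (y : Fin d → ℝ)
    have e : replicateCol (Fin 1) (toEuclideanLin Aᵀ y : Fin m → ℝ) = Aᵀ * E := by
      rw [← replicateCol_mulVec]; rfl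
    rw [← normF_replicateCol (toEuclideanLin Aᵀ y), ← normF_mul_replicateCol, e]
    have h1 : a * normF (Aᵀ * E) ≤ normF (A * (Aᵀ * E)) := by
      have e1 : normF (Aᵀ * E) ^ 2 ≤ normF (A * (Aᵀ * E)) * normF E := by
        rw [normF_transpose_mul_sq, ← Matrix.mul_assoc]; exact innerF_le _ _
      have e2 : a * normF E ≤ normF (Aᵀ * E) := by
        refine le_of_sq_le_sq ?_ (normF_nonneg _)
        rw [mul_pow]; exact hAE E
      have e3 := normF_nonneg (A * (Aᵀ * E))
      rcases (normF_nonneg (Aᵀ * E)).lt_or_eq with h0 | h0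
      · have : a * normF (Aᵀ * E) * normF (Aᵀ * E) ≤ normF (A * (Aᵀ * E)) * normF (Aᵀ * E) := by
          nlinarith
        exact le_of_mul_le_mul_right this h0
      · rw [← h0, mul_zero]; exact e3
    have h2 : normF (N * (Aᵀ * E)) ≤ a * √n / 1024 * normF (Aᵀ * E) :=
      (normF_mul_le_op _ _).trans (mul_le_mul_of_nonneg_right h.noise_le (normF_nonneg _))
    have h3 := normF_sub_le ((Z * A + N) * (Aᵀ * E)) (N * (Aᵀ * E))
    rw [Matrix.add_mul, add_sub_cancel_right, Matrix.mul_assoc Z, normF_orthStack_mul h.mem] at h3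
    rw [Matrix.add_mul, Matrix.mul_assoc Z]
    have h4 : √n * (a * normF (Aᵀ * E)) ≤ √n * normF (A * (Aᵀ * E)) := by gcongr
    have : 0 ≤ a * √n * normF (Aᵀ * E) := mul_nonneg (by positivity) (normF_nonneg _)
    linarith

lemma normF_mul_diagonal_ge {ι : Type*} [Fintype ι] {s : Fin d → ℝ} {L : ℝ} (hL : 0 ≤ L)
    (hs : ∀ j, L ≤ s j) (X : Matrix ι (Fin d) ℝ) : L * normF X ≤ normF (X * diagonal s) := by
  refine le_of_sq_le_sq ?_ (normF_nonneg _)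
  rw [mul_pow, normF, normF, Real.sq_sqrt (by positivity), Real.sq_sqrt (by positivity),
    Finset.mul_sum]
  refine Finset.sum_le_sum fun i _ => ?_
  rw [Finset.mul_sum]
  refine Finset.sum_le_sum fun j _ => ?_
  rw [mul_diagonal, mul_pow, mul_comm]
  gcongr
  exact hs j

lemma normF_orthPart_le (h : SmallNoise Z A N a κ) {k : ℕ} (X : Matrix (Fin n × Fin d) (Fin k) ℝ) :
    normF (orthPart Z X) ≤ normF X := by
  have h1 := transpose_mul_orthPart h.n_pos h.mem X
  set Y := (n : ℝ)⁻¹ • (Zᵀ * X) with hY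
  have h2 : X = Z * Y + orthPart Z X := by rw [orthPart, ← hY]; abel
  refine le_of_sq_le_sq ?_ (normF_nonneg _)
  have h3 : innerF (Z * Y) (orthPart Z X) = 0 := by
    rw [innerF_mul_left, h1]; simp [innerF]
  have h4 := normF_add_sq (Z * Y) (orthPart Z X)
  rw [← h2, h3] at h4
  have := sq_nonneg (normF (Z * Y))
  linarith

/-- Wedin's argument: the part G of U off the range of Z, multiplied by the singular values, is the
projection of NV, and those singular values are at least a√n/2. So √n U is close in Frobenius norm
to some ZQ. Blockwise rounding preserves this up to a constant, since the blocks of ZQ are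
orthogonal; no blockwise control of U is needed. -/
lemma dF_spectral_le (h : SmallNoise Z A N a κ) {U S : Matrix (Fin n × Fin d) (Fin d) ℝ}
    (hU : IsTopLeftSingular (Z * A + N) U) (hS : IsPolarStack U S) : dF S Z ≤ radius n κ := by
  obtain ⟨hUU, V, hVV, hDV, -⟩ := hU
  have ha := h.a_pos
  have hκ := h.one_le
  have hn := h.sqrt_n
  have hn1 := h.n_pos
  have hn0 : (n : ℝ) ≠ 0 := by positivity
  have hnsq : √(n : ℝ) * √n = n := Real.mul_self_sqrt (Nat.cast_nonneg n)
  have hsq0 : √(n : ℝ) ≠ 0 := by positivity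
  set G := orthPart Z U with hG
  have hp : normF G ≤ 1 / (512 * κ ^ 4) := by
    have e1 := normF_mul_diagonal_ge (L := a * √n / 2) (by positivity)
      (fun j : Fin d => h.sv_data_ge j.2) G
    have e2 : G * diagonal (fun j : Fin d => sv (Z * A + N) j) = orthPart Z (N * V) := by
      rw [hG, orthPart, Matrix.sub_mul, ← hDV]
      have : U * diagonal (fun j : Fin d => sv (Z * A + N) j) = (Z * A + N) * V := hDV.symm
      rw [Matrix.mul_assoc Z, smul_mul, Matrix.mul_assoc Zᵀ, this, orthPart, Matrix.add_mul,
        Matrix.mul_add, ← Matrix.mul_assoc Zᵀ, ← Matrix.mul_assoc Zᵀ Z,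
        transpose_mul_self_of_mem_orthStack h.mem, smul_add, smul_mul, Matrix.one_mul, smul_mul,
        smul_smul, inv_mul_cancel₀ hn0, one_smul, Matrix.mul_add, Matrix.mul_assoc Z A V]
      abel
    have e3 : normF V = √d := by
      have := normF_isometry_mul (r := 1) (by simpa using hVV) zero_le_one
        (1 : Matrix (Fin d) (Fin d) ℝ)
      rwa [Matrix.mul_one, Real.sqrt_one, one_mul, normF_one_fin] at this
    have e4 := (h.normF_orthPart_le (N * V)).trans (normF_mul_le_op N V)
    rw [e3] at e4
    rw [e2] at e1
    have e5 := e1.trans (e4.trans h.noise)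
    have e6 : a * √n / (1024 * κ ^ 4) = a * √n / 2 * (1 / (512 * κ ^ 4)) := by
      field_simp; norm_num
    rw [e6] at e5
    exact le_of_mul_le_mul_left e5 (by positivity)
  have hp0 := normF_nonneg G
  have hp1 : normF G ≤ 1 := hp.trans (by
    rw [div_le_one (by positivity)]
    have := one_le_pow₀ hκ (n := 4)
    linarith)
  set M := (√n)⁻¹ • (Zᵀ * U) with hM
  obtain ⟨Q, hQ, hH⟩ := exists_polar M
  set H := Qᵀ * M with hHdef
  have hHT := isHermitian_iff_transpose.1 hH.1
  have hUG : √(n : ℝ) • U - Z * Q = √(n : ℝ) • G + Z * (M - Q) := by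
    have e : √(n : ℝ) * (n : ℝ)⁻¹ = (√(n : ℝ))⁻¹ := by
      rw [← div_eq_mul_inv, Real.sqrt_div_self', one_div]
    rw [hG, orthPart, hM, smul_sub, Matrix.mul_sub, Matrix.mul_smul, Matrix.mul_smul, smul_smul, e]
    abel
  -- Pythagoras for the orthonormal columns of U. Factoring the left side as (1 - H)(1 + H) with H ⪰
  -- 0 bounds 1 - H by G.
  have hMM : 1 - H * H = Gᵀ * G := by
    have e1 : H * H = Mᵀ * M := by
      nth_rewrite 1 [← hHT]
      rw [hHdef, transpose_mul, transpose_transpose, Matrix.mul_assoc, ← Matrix.mul_assoc Q,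
        mul_transpose_self_of_mem hQ, Matrix.one_mul]
    have e2 : Zᵀ * G = 0 := transpose_mul_orthPart h.n_pos h.mem U
    have e3 : Gᵀ * G = Uᵀ * G := by
      nth_rewrite 1 [hG]
      rw [orthPart, transpose_sub, Matrix.sub_mul, transpose_mul, Matrix.mul_assoc, e2,
        Matrix.mul_zero, sub_zero]
    rw [e1, e3, hG, orthPart, Matrix.mul_sub, hUU, hM]
    simp only [transpose_smul, transpose_mul, transpose_transpose, smul_mul, Matrix.mul_smul,
      smul_smul, Matrix.mul_assoc]
    rw [← mul_inv, hnsq]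
  have hHI : normF (1 - H) ≤ normF G := by
    have e1 : (1 - H) * (1 + H) = Gᵀ * G := by
      rw [← hMM]; noncomm_ring
    have e2 : normF (1 - H) ^ 2 ≤ innerF ((1 - H) * (1 + H)) (1 - H) := by
      have := innerF_mul_posSemidef_nonneg hH (1 - H)
      rw [Matrix.mul_add, Matrix.mul_one, innerF_add_left, ← normF_sq]
      linarith
    rw [e1] at e2
    have e3 := e2.trans (innerF_le _ _)
    have e4 : normF (Gᵀ * G) ≤ normF G := by
      refine (normF_mul_le _ _).trans ?_
      rw [normF_transpose]
      exact mul_le_of_le_one_left hp0 hp1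
    rcases (normF_nonneg (1 - H)).lt_or_eq with h0 | h0
    · rw [pow_two] at e3
      exact (le_of_mul_le_mul_right e3 h0).trans e4
    · rw [← h0]; exact hp0
  have hMQ : normF (M - Q) = normF (1 - H) := by
    rw [← normF_orthogonal_mul (transpose_mem_orthogonal hQ) (M - Q), Matrix.mul_sub,
      transpose_mul_self_of_mem hQ, ← hHdef, normF_sub_comm]
  have hdist : normF (√(n : ℝ) • U - Z * Q) ≤ 2 * √n * (1 / (512 * κ ^ 4)) := by
    rw [hUG]
    refine (normF_add_le _ _).trans ?_
    rw [normF_smul, abs_of_nonneg (Real.sqrt_nonneg _), normF_orthStack_mul h.mem, hMQ]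
    have : √n * normF G ≤ √n * (1 / (512 * κ ^ 4)) := by gcongr
    have : √n * normF (1 - H) ≤ √n * normF G := by gcongr
    linarith
  have hZQ := mul_mem_orthStack h.mem hQ
  have hSU : IsPolarStack (√(n : ℝ) • U) S := by
    rw [isPolarStack_iff] at hS ⊢
    refine ⟨hS.1, fun i => ?_⟩
    rw [block_smul, Matrix.mul_smul]
    exact (hS.2 i).smul (Real.sqrt_nonneg _)
  have hle := normF_polarStack_sub_le zero_lt_one hSU hZQ (Y := Z * Q) fun i => by
    rw [transpose_mul_self_of_mem (hZQ i), one_smul, sub_self]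
    exact PosSemidef.zero
  refine (dF_le S Z hQ).trans (hle.trans ?_)
  rw [div_one]
  calc 2 * normF (√(n : ℝ) • U - Z * Q) ≤ 2 * (2 * √n * (1 / (512 * κ ^ 4))) := by gcongr
    _ = √n / (128 * κ ^ 4) := by ring
    _ ≤ √n / (32 * κ ^ 2) := by
        gcongr <;> norm_num

end SmallNoise

/-! ### Nets -/

section Nets

/-- A `1/2`-net of the unit ball of cardinality at most `5 ^ dim`. -/
lemma exists_half_net (E : Type*) [NormedAddCommGroup E] [NormedSpace ℝ E]
    [FiniteDimensional ℝ E] : ∃ s : Finset E, s.card ≤ 5 ^ Module.finrank ℝ E ∧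
      (∀ x ∈ s, ‖x‖ ≤ 1) ∧ ∀ x : E, ‖x‖ ≤ 1 → ∃ y ∈ s, ‖x - y‖ ≤ 1 / 2 := by
  classical
  -- A largest 1-separated set in the ball of radius 2; halved, it is a 1/2-net of the unit ball.
  let P : ℕ → Prop := fun N => ∃ s : Finset E, s.card = N ∧ (∀ c ∈ s, ‖c‖ ≤ 2) ∧
    ∀ c ∈ s, ∀ d ∈ s, c ≠ d → 1 ≤ ‖c - d‖
  have h0 : P 0 := ⟨∅, by simp⟩
  have hb : ∀ N, P N → N ≤ 5 ^ Module.finrank ℝ E := by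
    rintro N ⟨s, rfl, h1, h2⟩
    exact Besicovitch.card_le_of_separated s h1 h2
  obtain ⟨s, hs, h1, h2⟩ := Nat.findGreatest_spec (P := P) (Nat.zero_le (5 ^ Module.finrank ℝ E)) h0
  have hmax : ∀ N, P N → N ≤ s.card := fun N hN => by
    rw [hs]; exact Nat.le_findGreatest (hb N hN) hN
  refine ⟨s.image fun x => (1 / 2 : ℝ) • x, ?_, ?_, fun x hx => ?_⟩
  · exact Finset.card_image_le.trans (hb _ ⟨s, rfl, h1, h2⟩)
  · intro x hx
    obtain ⟨y, hy, rfl⟩ := Finset.mem_image.1 hx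
    rw [norm_smul, Real.norm_eq_abs, abs_of_pos (by norm_num)]
    linarith [h1 y hy]
  · by_contra! hlt
    have hfar : ∀ c ∈ s, 1 < ‖(2 : ℝ) • x - c‖ := by
      intro c hc
      have h3 := hlt _ (Finset.mem_image_of_mem (fun x => (1 / 2 : ℝ) • x) hc)
      have h4 : (2 : ℝ) • x - c = (2 : ℝ) • (x - (1 / 2 : ℝ) • c) := by
        rw [smul_sub, smul_smul]; norm_num
      rw [h4, norm_smul, Real.norm_eq_abs, abs_of_pos (by norm_num)]
      linarith
    have hnot : (2 : ℝ) • x ∉ s := fun h => by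
      have := hfar _ h
      rw [sub_self, norm_zero] at this
      linarith
    have := hmax (s.card + 1) ⟨insert ((2 : ℝ) • x) s, Finset.card_insert_of_notMem hnot, ?_, ?_⟩
    · omega
    · intro c hc
      rcases Finset.mem_insert.1 hc with rfl | hc
      · rw [norm_smul, Real.norm_eq_abs, abs_of_pos (by norm_num)]; linarith
      · exact h1 c hc
    · intro c hc e he hne
      rcases Finset.mem_insert.1 hc with rfl | hc <;> rcases Finset.mem_insert.1 he with rfl | he
      · exact absurd rfl hne
      · exact (hfar e he).le
      · rw [norm_sub_rev]; exact (hfar c hc).le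
      · exact h2 c hc e he hne

/-- The operator norm is controlled by finitely many values of the bilinear form. -/
lemma exists_norm_le_of_net (ι κ : Type*) [Fintype ι] [Fintype κ] [DecidableEq ι]
    [DecidableEq κ] :
    ∃ (s : Finset (EuclideanSpace ℝ ι)) (t : Finset (EuclideanSpace ℝ κ)),
      s.card ≤ 5 ^ Fintype.card ι ∧ t.card ≤ 5 ^ Fintype.card κ ∧
      (∀ x ∈ s, ‖x‖ ≤ 1) ∧ (∀ y ∈ t, ‖y‖ ≤ 1) ∧
      ∀ (X : Matrix ι κ ℝ) (τ : ℝ), 0 ≤ τ →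
        (∀ x ∈ s, ∀ y ∈ t, (x : ι → ℝ) ⬝ᵥ X *ᵥ (y : κ → ℝ) ≤ τ) → ‖X‖ ≤ 4 * τ := by
  obtain ⟨s, hs1, hs2, hs3⟩ := exists_half_net (EuclideanSpace ℝ ι)
  obtain ⟨t, ht1, ht2, ht3⟩ := exists_half_net (EuclideanSpace ℝ κ)
  rw [finrank_euclideanSpace] at hs1 ht1
  refine ⟨s, t, hs1, ht1, hs2, ht2, fun X τ hτ h => ?_⟩
  set T := (toEuclideanLin X).toContinuousLinearMap with hT
  have hXT : ‖X‖ = ‖T‖ := l2_opNorm_def X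
  have hin : ∀ x y, inner ℝ x (T y) = (x : ι → ℝ) ⬝ᵥ X *ᵥ (y : κ → ℝ) := by
    intro x y
    rw [dotProduct_comm, PiLp.inner_apply]
    simp [hT, dotProduct, toLpLin_apply]
  have h1 : ∀ y ∈ t, ‖T y‖ ≤ 2 * τ := by
    intro y hy
    by_cases h0 : T y = 0
    · rw [h0, norm_zero]; linarith
    have hn : 0 < ‖T y‖ := norm_pos_iff.2 h0
    set u := (‖T y‖)⁻¹ • T y with hu
    have hu1 : ‖u‖ ≤ 1 := by
      rw [hu, norm_smul, norm_inv, norm_norm, inv_mul_cancel₀ hn.ne']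
    obtain ⟨x, hx, hxu⟩ := hs3 u hu1
    have e1 : inner ℝ u (T y) = ‖T y‖ := by
      rw [hu, real_inner_smul_left, real_inner_self_eq_norm_sq]; field_simp
    have e2 : inner ℝ u (T y) = inner ℝ x (T y) + inner ℝ (u - x) (T y) := by
      rw [inner_sub_left]; ring
    have e3 : inner ℝ (u - x) (T y) ≤ 1 / 2 * ‖T y‖ :=
      (real_inner_le_norm _ _).trans (mul_le_mul_of_nonneg_right hxu (norm_nonneg _))
    have e4 := h x hx y hy
    rw [← hin] at e4
    linarith
  rw [hXT]
  have h2 : ‖T‖ ≤ 2 * τ + 1 / 2 * ‖T‖ := by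
    refine T.opNorm_le_of_unit_norm (by positivity) fun v hv => ?_
    obtain ⟨y, hy, hyv⟩ := ht3 v hv.le
    have e1 : T v = T y + T (v - y) := by rw [map_sub]; abel
    have e2 : ‖T (v - y)‖ ≤ ‖T‖ * (1 / 2) := (T.le_opNorm _).trans (by gcongr)
    rw [e1]
    linarith [norm_add_le (T y) (T (v - y)), h1 y hy]
  linarith

end Nets

/-! ### Tail bounds -/

section Tails

variable {Ω : Type*} [MeasurableSpace Ω] {μ : Measure Ω}

lemma hasSubgaussianMGF_of_hasLaw {X : Ω → ℝ} (h : HasLaw X (gaussianReal 0 1) μ) :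
    HasSubgaussianMGF X 1 μ where
  integrable_exp_mul t := by
    have h1 : Integrable (fun x => Real.exp (t * x)) (μ.map X) := by
      rw [h.map_eq]; exact integrable_exp_mul_gaussianReal t
    exact h1.comp_aemeasurable h.aemeasurable
  mgf_le t := by
    rw [mgf_gaussianReal h.map_eq]; simp

lemma hasSubgaussianMGF_mono {X : Ω → ℝ} {c c' : NNReal} (h : HasSubgaussianMGF X c μ)
    (hc : c ≤ c') : HasSubgaussianMGF X c' μ :=
  ⟨h.integrable_exp_mul, fun t => (h.mgf_le t).trans (by gcongr)⟩

variable {n d m : ℕ} {W : Ω → Fin n → Matrix (Fin d) (Fin m) ℝ}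

/-- Tail bound for linear combinations of the noise entries. -/
lemma measure_linear_ge_le [IsProbabilityMeasure μ] (hW : IsGaussianNoise μ W)
    (c : Fin n × Fin d × Fin m → ℝ) (hc : ∑ p, c p ^ 2 ≤ 1) {t : ℝ} (ht : 0 ≤ t) :
    μ {ω | t ≤ ∑ p, c p * W ω p.1 p.2.1 p.2.2} ≤ ENNReal.ofReal (Real.exp (-t ^ 2 / 2)) := by
  have h1 : ∀ p : Fin n × Fin d × Fin m,
      HasSubgaussianMGF (fun ω => c p * W ω p.1 p.2.1 p.2.2) (⟨c p ^ 2, sq_nonneg _⟩ * 1) μ :=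
    fun p => (hasSubgaussianMGF_of_hasLaw (hW.law p.1 p.2.1 p.2.2)).const_mul (c p)
  have h2 := HasSubgaussianMGF.sum_of_iIndepFun (s := Finset.univ)
    (hW.indep.comp (fun p x => c p * x) fun p => measurable_const_mul (c p)) (fun p _ => h1 p)
  have h3 := hasSubgaussianMGF_mono (c' := 1) h2 (by
    rw [← NNReal.coe_le_coe]; push_cast
    refine le_trans (le_of_eq (Finset.sum_congr rfl fun p _ => ?_)) hc
    exact mul_one (c p ^ 2))
  have h4 := h3.measure_ge_le ht
  rw [← ofReal_measureReal]
  refine ENNReal.ofReal_le_ofReal ?_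
  simpa using h4

/-- A tail bound uniform in an independent variable. -/
lemma measure_pair_le_of_indepFun [IsProbabilityMeasure μ] {α β : Type*} [MeasurableSpace α]
    [MeasurableSpace β] {X : Ω → α} {Y : Ω → β} (hXY : IndepFun X Y μ) (hX : AEMeasurable X μ)
    (hY : AEMeasurable Y μ) {B : Set (α × β)} (hB : MeasurableSet B) {ε : ENNReal}
    (h : ∀ y, μ {ω | (X ω, y) ∈ B} ≤ ε) : μ {ω | (X ω, Y ω) ∈ B} ≤ ε := by
  have h1 : μ {ω | (X ω, Y ω) ∈ B} = ((μ.map X).prod (μ.map Y)) B := by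
    rw [← (indepFun_iff_map_prod_eq_prod_map_map hX hY).1 hXY,
      Measure.map_apply_of_aemeasurable (hX.prodMk hY) hB]
    rfl
  have : IsProbabilityMeasure (μ.map Y) := Measure.isProbabilityMeasure_map hY
  have : IsProbabilityMeasure (μ.map X) := Measure.isProbabilityMeasure_map hX
  rw [h1, Measure.prod_apply_symm hB]
  calc _ ≤ ∫⁻ _, ε ∂(μ.map Y) := by
        refine lintegral_mono fun y => ?_
        rw [Measure.map_apply_of_aemeasurable hX (measurable_prodMk_right hB)]
        exact h y
    _ = ε := by simp

end Tails

/-! ### Measurability of the leave-one-out iterates -/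

section Measurability

variable {α : Type*} [MeasurableSpace α] {ι κ l : Type*}

/-- All entries of a matrix-valued function are measurable. -/
def MeasurableEntries (M : α → Matrix ι κ ℝ) : Prop := ∀ i j, Measurable fun x => M x i j

lemma MeasurableEntries.mul [Fintype κ] {M : α → Matrix ι κ ℝ} {N : α → Matrix κ l ℝ}
    (hM : MeasurableEntries M) (hN : MeasurableEntries N) :
    MeasurableEntries fun x => M x * N x := fun i j => by
  simp only [mul_apply]
  exact Finset.measurable_fun_sum _ fun k _ => (hM i k).mul (hN k j)

lemma MeasurableEntries.transpose {M : α → Matrix ι κ ℝ} (hM : MeasurableEntries M) :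
    MeasurableEntries fun x => (M x)ᵀ := fun i j => hM j i

lemma measurableEntries_const (M : Matrix ι κ ℝ) : MeasurableEntries fun _ : α => M :=
  fun _ _ => measurable_const

variable {n d m : ℕ}

lemma abs_entry_le_normF {ι κ : Type*} [Fintype ι] [Fintype κ] (X : Matrix ι κ ℝ) (i : ι) (j : κ) :
    |X i j| ≤ normF X := by
  rw [normF, ← Real.sqrt_sq_eq_abs]
  refine Real.sqrt_le_sqrt ?_
  calc X i j ^ 2 ≤ ∑ j, X i j ^ 2 :=
        Finset.single_le_sum (f := fun j => X i j ^ 2) (fun _ _ => sq_nonneg _) (Finset.mem_univ j)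
    _ ≤ _ := Finset.single_le_sum (f := fun i => ∑ j, X i j ^ 2)
        (fun _ _ => Finset.sum_nonneg fun _ _ => sq_nonneg _) (Finset.mem_univ i)

/-- The perturbation bound with the limit point as the nondegenerate matrix. With the constant
default on the closed singular set it gives measurability. -/
lemma continuousOn_polar (i j : Fin d) :
    ContinuousOn (fun X : Fin d → Fin d → ℝ => polar (Matrix.of X) i j)
      {X | (Matrix.of X).det ≠ 0} := by
  intro X hX
  obtain ⟨s, hs, hlow⟩ := exists_pos_normF_mul_ge hX
  have hY := posSemidef_sub_of_normF_mul_ge (polar_mem _) (polar_posSemidef hX) hlow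
  rw [ContinuousWithinAt, tendsto_iff_dist_tendsto_zero]
  have hcont : Tendsto (fun X' : Fin d → Fin d → ℝ => 2 / s * normF (Matrix.of X' - Matrix.of X))
      (𝓝[{X | (Matrix.of X).det ≠ 0}] X) (𝓝 0) := by
    have : Continuous fun X' : Fin d → Fin d → ℝ =>
        2 / s * normF (Matrix.of X' - Matrix.of X) := by
      simp only [normF, Matrix.sub_apply, Matrix.of_apply]
      fun_prop
    have h0 := (this.tendsto X).mono_left (nhdsWithin_le_nhds (s := {X | (Matrix.of X).det ≠ 0}))
    simpa [normF_zero] using h0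
  refine squeeze_zero' (Eventually.of_forall fun _ => dist_nonneg) ?_ hcont
  filter_upwards [self_mem_nhdsWithin] with X' hX'
  rw [Real.dist_eq]
  exact (abs_entry_le_normF (polar (Matrix.of X') - polar (Matrix.of X)) i j).trans
    (normF_polar_sub_le hs (polar_mem _) (polar_posSemidef hX') (polar_mem _) hY)

lemma measurable_polar (i j : Fin d) :
    Measurable fun X : Fin d → Fin d → ℝ => polar (Matrix.of X) i j := by
  classical
  have hopen : IsOpen {X : Fin d → Fin d → ℝ | (Matrix.of X).det ≠ 0} := by
    refine isOpen_ne_fun ?_ continuous_const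
    exact Continuous.matrix_det continuous_id
  have h1 := (continuousOn_polar i j).measurable_piecewise
    (g := fun _ => (1 : Matrix (Fin d) (Fin d) ℝ) i j) continuousOn_const hopen.measurableSet
  convert h1 using 1
  ext X
  by_cases hX : (Matrix.of X).det ≠ 0
  · rw [Set.piecewise_eq_of_mem _ _ _ hX]
  · rw [Set.piecewise_eq_of_notMem _ _ _ hX, polar, if_pos (not_not.1 hX)]

lemma MeasurableEntries.polar {M : α → Matrix (Fin d) (Fin d) ℝ} (hM : MeasurableEntries M) :
    MeasurableEntries fun x => polar (M x) := fun i j =>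
  (measurable_polar i j).comp (measurable_pi_lambda (fun x => (M x : Fin d → Fin d → ℝ))
    fun a => measurable_pi_lambda _ fun b => hM a b)

lemma MeasurableEntries.polarIter {D : α → Matrix (Fin n × Fin d) (Fin m) ℝ}
    (hD : MeasurableEntries D) (Z : Matrix (Fin n × Fin d) (Fin d) ℝ) (t : ℕ) :
    MeasurableEntries fun x => polarIter (D x) Z t := by
  induction t with
  | zero => exact measurableEntries_const Z
  | succ t ih =>
    intro p b
    have h1 : MeasurableEntries fun x =>
        block (D x * (D x)ᵀ * Procrustes.polarIter (D x) Z t) p.1 :=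
      fun a b => ((hD.mul hD.transpose).mul ih) (p.1, a) b
    exact h1.polar p.2 b

end Measurability

/-! ### Gaussian noise is small and incoherent -/

section NoiseEvents

variable {Ω : Type*} [MeasurableSpace Ω] {μ : Measure Ω} {n d m : ℕ}
  {W : Ω → Fin n → Matrix (Fin d) (Fin m) ℝ}

/-- The operator norm of a random matrix is controlled by a tail bound for its bilinear form. -/
lemma measure_norm_gt_le {ι κ : Type*} [Fintype ι] [Fintype κ] [DecidableEq ι] [DecidableEq κ]
    (M : Ω → Matrix ι κ ℝ) (G : Set Ω) {τ : ℝ} (hτ : 0 ≤ τ) {ε : ENNReal}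
    (h : ∀ (x : ι → ℝ) (y : κ → ℝ), ∑ i, x i ^ 2 ≤ 1 → ‖WithLp.toLp 2 y‖ ≤ 1 →
      μ (G ∩ {ω | τ ≤ x ⬝ᵥ M ω *ᵥ y}) ≤ ε) :
    μ (G ∩ {ω | 4 * τ < ‖M ω‖}) ≤ 5 ^ (Fintype.card ι + Fintype.card κ) * ε := by
  obtain ⟨s, t, hs, ht, hs1, ht1, hnet⟩ := exists_norm_le_of_net ι κ
  have hsub : G ∩ {ω | 4 * τ < ‖M ω‖} ⊆
      ⋃ p ∈ s ×ˢ t, (G ∩ {ω | τ ≤ (p.1 : ι → ℝ) ⬝ᵥ M ω *ᵥ (p.2 : κ → ℝ)}) := by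
    rintro ω ⟨hG, hω⟩
    by_contra hno
    simp only [Set.mem_iUnion, not_exists] at hno
    refine absurd (hnet (M ω) τ hτ fun x hx y hy => ?_) (not_le.2 hω)
    have := hno (x, y) (Finset.mk_mem_product hx hy)
    by_contra hlt
    exact this ⟨hG, (not_le.1 hlt).le⟩
  refine (measure_mono hsub).trans ((measure_biUnion_finset_le _ _).trans ?_)
  calc ∑ p ∈ s ×ˢ t, μ (G ∩ {ω | τ ≤ (p.1 : ι → ℝ) ⬝ᵥ M ω *ᵥ (p.2 : κ → ℝ)})
      ≤ ∑ p ∈ s ×ˢ t, ε := by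
        refine Finset.sum_le_sum fun p hp => h _ _ ?_ ?_
        · have h1 := hs1 p.1 (Finset.mem_product.1 hp).1
          rw [← EuclideanSpace.real_norm_sq_eq]
          exact pow_le_one₀ (norm_nonneg _) h1
        · exact ht1 p.2 (Finset.mem_product.1 hp).2
    _ = ((s.card * t.card : ℕ) : ENNReal) * ε := by
        rw [Finset.sum_const, Finset.card_product, nsmul_eq_mul]
    _ ≤ _ := by
        gcongr
        rw [pow_add]
        calc ((s.card * t.card : ℕ) : ENNReal)
            ≤ ((5 ^ Fintype.card ι * 5 ^ Fintype.card κ : ℕ) : ENNReal) := by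
              exact_mod_cast Nat.mul_le_mul hs ht
          _ = _ := by push_cast; rfl

lemma sum_sq_le_one {κ : Type*} [Fintype κ] {y : κ → ℝ} (hy : ‖WithLp.toLp 2 y‖ ≤ 1) :
    ∑ i, y i ^ 2 ≤ 1 := by
  have := EuclideanSpace.real_norm_sq_eq (WithLp.toLp 2 y)
  simp only at this
  rw [← this]
  exact pow_le_one₀ (norm_nonneg _) hy

lemma stack_bilinear_eq (x : Fin n × Fin d → ℝ) (y : Fin m → ℝ)
    (V : Fin n → Matrix (Fin d) (Fin m) ℝ) :
    x ⬝ᵥ stack V *ᵥ y =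
      ∑ p : Fin n × Fin d × Fin m, (x (p.1, p.2.1) * y p.2.2) * V p.1 p.2.1 p.2.2 := by
  simp only [dotProduct, mulVec, stack, Matrix.of_apply, Fintype.sum_prod_type, Finset.mul_sum]
  exact Finset.sum_congr rfl fun i _ => Finset.sum_congr rfl fun a _ =>
    Finset.sum_congr rfl fun b _ => by ring

lemma measure_norm_stack_gt_le [IsProbabilityMeasure μ] (hW : IsGaussianNoise μ W) {R : ℝ}
    (hR : 0 ≤ R) :
    μ {ω | 16 * R < ‖stack (W ω)‖} ≤
      5 ^ (n * d + m) * ENNReal.ofReal (Real.exp (-(4 * R) ^ 2 / 2)) := by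
  have h := measure_norm_gt_le (μ := μ) (fun ω => stack (W ω)) Set.univ (τ := 4 * R) (by positivity)
    (ε := ENNReal.ofReal (Real.exp (-(4 * R) ^ 2 / 2))) fun x y hx hy => ?_
  · simpa [← mul_assoc, show (4 : ℝ) * 4 = 16 by norm_num] using h
  · rw [Set.univ_inter]
    simp only [stack_bilinear_eq]
    refine measure_linear_ge_le hW _ ?_ (by positivity)
    have hy' := sum_sq_le_one hy
    calc ∑ p : Fin n × Fin d × Fin m, (x (p.1, p.2.1) * y p.2.2) ^ 2
        = (∑ p, x p ^ 2) * ∑ b, y b ^ 2 := by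
          rw [Finset.sum_mul, ← Fintype.sum_equiv (Equiv.prodAssoc (Fin n) (Fin d) (Fin m))
            (fun p => (x p.1 * y p.2) ^ 2) _ fun _ => rfl, Fintype.sum_prod_type]
          simp only [mul_pow, Finset.mul_sum]
      _ ≤ 1 * 1 := mul_le_mul hx hy' (Finset.sum_nonneg fun _ _ => sq_nonneg _) zero_le_one
      _ = 1 := one_mul 1

/-- A noise block is independent of all the others. -/
lemma indepFun_block_update (hW : IsGaussianNoise μ W) (i : Fin n) :
    IndepFun (fun ω (q : Fin d × Fin m) => W ω i q.1 q.2)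
      (fun ω (p : Fin n × Fin d × Fin m) =>
        if p.1 = i then (0 : ℝ) else W ω p.1 p.2.1 p.2.2) μ := by
  have h := hW.indep.indepFun_finset₀ (Finset.univ.filter fun p => p.1 = i)
    (Finset.univ.filter fun p => ¬ p.1 = i) (Finset.disjoint_filter_filter_not _ _ _)
    fun p => (hW.law p.1 p.2.1 p.2.2).aemeasurable
  refine h.comp (φ := fun w (q : Fin d × Fin m) => w ⟨(i, q.1, q.2), by simp⟩)
    (ψ := fun w (p : Fin n × Fin d × Fin m) =>
      if hp : p.1 = i then (0 : ℝ) else w ⟨p, by simp [hp]⟩) ?_ ?_ |>.congr ?_ ?_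
  · exact measurable_pi_lambda _ fun q => measurable_pi_apply _
  · refine measurable_pi_lambda _ fun p => ?_
    by_cases hp : p.1 = i
    · simp only [hp, dif_pos]; exact measurable_const
    · simp only [hp, dif_neg, not_false_iff]; exact measurable_pi_apply _
  · exact Filter.EventuallyEq.rfl
  · refine Filter.Eventually.of_forall fun ω => ?_
    ext p
    by_cases hp : p.1 = i <;> simp [hp]

/-- Conditionally on the other blocks, a bilinear form of a noise block is Gaussian. -/
lemma measure_block_bilinear_le [IsProbabilityMeasure μ] (hW : IsGaussianNoise μ W) (i : Fin n)
    {x : Fin d → ℝ} (hx : ∑ a, x a ^ 2 ≤ 1)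
    {v : (Fin n × Fin d × Fin m → ℝ) → Fin m → ℝ} (hv : Measurable v) {L t : ℝ} (hL : 0 < L)
    (ht : 0 ≤ t) :
    μ {ω | ∑ b, v (fun p => if p.1 = i then 0 else W ω p.1 p.2.1 p.2.2) b ^ 2 ≤ L ^ 2 ∧
        t * L ≤ x ⬝ᵥ W ω i *ᵥ v (fun p => if p.1 = i then 0 else W ω p.1 p.2.1 p.2.2)} ≤
      ENNReal.ofReal (Real.exp (-t ^ 2 / 2)) := by
  have hvb : ∀ b, Measurable fun w => v w b := fun b => (measurable_pi_apply b).comp hv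
  refine measure_pair_le_of_indepFun (indepFun_block_update hW i)
    (B := {q | ∑ b, v q.2 b ^ 2 ≤ L ^ 2 ∧ t * L ≤ ∑ a, x a * ∑ b, q.1 (a, b) * v q.2 b})
    ?_ ?_ ?_ fun w => ?_
  · exact aemeasurable_pi_lambda _ fun q => (hW.law i q.1 q.2).aemeasurable
  · refine aemeasurable_pi_lambda _ fun p => ?_
    by_cases hp : p.1 = i
    · simp only [hp, if_true]; exact aemeasurable_const
    · simp only [hp, if_false]; exact (hW.law p.1 p.2.1 p.2.2).aemeasurable
  · rw [Set.ofPred_and]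
    refine MeasurableSet.inter (measurableSet_le ?_ measurable_const)
      (measurableSet_le measurable_const ?_)
    · exact Finset.measurable_fun_sum _ fun b _ => ((hvb b).comp measurable_snd).pow_const 2
    · refine Finset.measurable_fun_sum _ fun a _ => Measurable.const_mul ?_ _
      exact Finset.measurable_fun_sum _ fun b _ =>
        ((measurable_pi_apply (a, b)).comp measurable_fst).mul ((hvb b).comp measurable_snd)
  · by_cases hw : ∑ b, v w b ^ 2 ≤ L ^ 2
    swap
    · simp [hw]
    refine (measure_mono ?_).trans (measure_linear_ge_le hW
      -- With the other blocks frozen, the form divided by L is a linear combination of the entries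
      -- of W_i with these coefficients, whose squares sum to at most 1.
      (fun p => if p.1 = i then x p.2.1 * (v w p.2.2 / L) else 0) ?_ ht)
    · rintro ω ⟨-, hω⟩
      simp only at hω
      simp only [Set.mem_ofPred_eq, Fintype.sum_prod_type, ite_mul, zero_mul]
      rw [Finset.sum_eq_single i (fun j _ hj => by simp [hj]) (by simp)]
      rw [← mul_le_mul_iff_left₀ hL]
      refine hω.trans (le_of_eq ?_)
      simp only [if_true, Finset.sum_mul, Finset.mul_sum]
      refine Finset.sum_congr rfl fun a _ => Finset.sum_congr rfl fun b _ => ?_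
      field_simp
    · simp only [Fintype.sum_prod_type, ite_pow, mul_pow, div_pow]
      rw [Finset.sum_eq_single i (fun j _ hj => by simp [hj]) (by simp)]
      simp only [if_true]
      calc ∑ a, ∑ b, x a ^ 2 * (v w b ^ 2 / L ^ 2) = (∑ a, x a ^ 2) * ((∑ b, v w b ^ 2) / L ^ 2) := by
            rw [Finset.sum_div, Finset.sum_mul_sum]
        _ ≤ 1 * 1 := by
            refine mul_le_mul hx ((div_le_one (by positivity)).2 hw) ?_ zero_le_one
            exact div_nonneg (Finset.sum_nonneg fun _ _ => sq_nonneg _) (sq_nonneg _)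
        _ = 1 := one_mul 1

/-- The matrix `(Z A + Nᵢ)ᵀ Tₜ`, where `Nᵢ` is the noise without its `i`-th block and `Tₜ` is
the `t`-th iterate for the data `Z A + Nᵢ`. -/
noncomputable def leaveOneOutIterate (Z : Matrix (Fin n × Fin d) (Fin d) ℝ)
    (A : Matrix (Fin d) (Fin m) ℝ) (N : Matrix (Fin n × Fin d) (Fin m) ℝ) (i : Fin n) (t : ℕ) :
    Matrix (Fin m) (Fin d) ℝ :=
  (Z * A + zeroBlock N i)ᵀ * polarIter (Z * A + zeroBlock N i) Z t

/-- The iterate is a measurable function of the other blocks, since its start Z is deterministic.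
Conditionally the product is Gaussian, and a net in dimension d + d, rather than nd + m, suffices:
this saves the factor √n. The factor 16 is 4 from the net times 4 in the threshold. -/
lemma measure_block_mul_iterate_gt_le [IsProbabilityMeasure μ] (hW : IsGaussianNoise μ W)
    (Z : Matrix (Fin n × Fin d) (Fin d) ℝ) (A : Matrix (Fin d) (Fin m) ℝ) (σ : ℝ) (i : Fin n)
    (t : ℕ) {L r : ℝ} (hL : 0 < L) (hr : 0 ≤ r) :
    μ ({ω | ‖leaveOneOutIterate Z A (σ • stack (W ω)) i t‖ ≤ L} ∩
        {ω | 16 * r * L < ‖W ω i * leaveOneOutIterate Z A (σ • stack (W ω)) i t‖}) ≤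
      5 ^ (d + d) * ENNReal.ofReal (Real.exp (-(4 * r) ^ 2 / 2)) := by
  -- The data as a function of the whole noise array; inserting the array with block i set to zero
  -- gives the leave-one-out data.
  let D : (Fin n × Fin d × Fin m → ℝ) → Matrix (Fin n × Fin d) (Fin m) ℝ := fun w =>
    Z * A + Matrix.of fun p b => σ * w (p.1, p.2, b)
  have hD : MeasurableEntries D := fun p b => by
    simp only [D, Matrix.add_apply, Matrix.of_apply]
    exact measurable_const.add ((measurable_pi_apply _).const_mul _)
  let Y : (Fin n × Fin d × Fin m → ℝ) → Matrix (Fin m) (Fin d) ℝ := fun w =>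
    (D w)ᵀ * polarIter (D w) Z t
  have hY : MeasurableEntries Y := hD.transpose.mul (hD.polarIter Z t)
  have hYW : ∀ ω, leaveOneOutIterate Z A (σ • stack (W ω)) i t =
      Y (fun p => if p.1 = i then 0 else W ω p.1 p.2.1 p.2.2) := by
    intro ω
    have : Z * A + zeroBlock (σ • stack (W ω)) i =
        D (fun p => if p.1 = i then 0 else W ω p.1 p.2.1 p.2.2) := by
      simp only [D]
      congr 1
      ext p b
      by_cases hp : p.1 = i <;> simp [zeroBlock, stack, hp]
    simp only [leaveOneOutIterate, Y, this]
  have h := measure_norm_gt_le (μ := μ)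
    (fun ω => W ω i * leaveOneOutIterate Z A (σ • stack (W ω)) i t)
    {ω | ‖leaveOneOutIterate Z A (σ • stack (W ω)) i t‖ ≤ L} (τ := 4 * r * L) (by positivity)
    (ε := ENNReal.ofReal (Real.exp (-(4 * r) ^ 2 / 2))) fun x y hx hy => ?_
  · simpa [← mul_assoc, show (4 : ℝ) * 4 = 16 by norm_num] using h
  · refine (measure_mono ?_).trans (measure_block_bilinear_le hW i hx
      (v := fun w => Y w *ᵥ y) ?_ hL (t := 4 * r) (by positivity))
    · rintro ω ⟨h1, h2⟩
      simp only [Set.mem_ofPred_eq, hYW] at h1 h2 ⊢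
      refine ⟨?_, by rwa [mulVec_mulVec]⟩
      have h3 := l2_opNorm_mulVec
        (Y fun p => if p.1 = i then 0 else W ω p.1 p.2.1 p.2.2) (WithLp.toLp 2 y)
      have h4 : ‖(EuclideanSpace.equiv (Fin m) ℝ).symm
          ((Y fun p => if p.1 = i then 0 else W ω p.1 p.2.1 p.2.2) *ᵥ y)‖ ≤ L :=
        h3.trans ((mul_le_mul h1 hy (norm_nonneg _) hL.le).trans (mul_one L).le)
      have h5 := pow_le_pow_left₀ (norm_nonneg _) h4 2
      rw [EuclideanSpace.real_norm_sq_eq] at h5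
      exact h5
    · refine measurable_pi_lambda _ fun b => ?_
      simp only [mulVec, dotProduct]
      exact Finset.measurable_fun_sum _ fun a _ => (hY b a).mul_const _

/-- Since 5 ≤ e², the cardinality of the nets is absorbed by 2k in the exponent. -/
lemma five_pow_mul_exp_le {k : ℕ} {R γ : ℝ} (hn : 1 ≤ n)
    (h : 2 * k + γ * Real.log n ≤ 8 * R ^ 2) :
    (5 : ENNReal) ^ k * ENNReal.ofReal (Real.exp (-(4 * R) ^ 2 / 2)) ≤
      ENNReal.ofReal ((n : ℝ) ^ (-γ)) := by
  have h5 : (5 : ENNReal) = ENNReal.ofReal 5 := by norm_num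
  rw [h5, ← ENNReal.ofReal_pow (by norm_num), ← ENNReal.ofReal_mul (by positivity)]
  refine ENNReal.ofReal_le_ofReal ?_
  have he : (5 : ℝ) ≤ Real.exp 2 := by
    have := Real.exp_one_gt_d9
    have h2 : Real.exp 2 = Real.exp 1 * Real.exp 1 := by rw [← Real.exp_add]; norm_num
    rw [h2]; nlinarith
  have hn' : (0 : ℝ) < n := by exact_mod_cast hn
  calc (5 : ℝ) ^ k * Real.exp (-(4 * R) ^ 2 / 2)
      ≤ Real.exp 2 ^ k * Real.exp (-(4 * R) ^ 2 / 2) := by gcongr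
    _ = Real.exp (k * 2 + -(4 * R) ^ 2 / 2) := by rw [← Real.exp_nat_mul, Real.exp_add]
    _ ≤ Real.exp (Real.log n * -γ) := Real.exp_le_exp.2 (by nlinarith)
    _ = _ := (Real.rpow_def_of_pos hn' _).symm

end NoiseEvents

/-! ### The main event -/

section Main

variable {Ω : Type*} [MeasurableSpace Ω] {μ : Measure Ω} {n d m : ℕ}
  {W : Ω → Fin n → Matrix (Fin d) (Fin m) ℝ}

lemma stack_data (A : Matrix (Fin d) (Fin m) ℝ) (O : Fin n → Matrix (Fin d) (Fin d) ℝ) (σ : ℝ)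
    (V : Fin n → Matrix (Fin d) (Fin m) ℝ) :
    stack (data A O σ V) = stack O * A + σ • stack V :=
  block_ext fun i => by
    rw [block_stack, block_add, block_mul, block_smul, block_stack, block_stack, data]

/-- The noise level multiplied by the scale of the noise. -/
lemma noise_scale_le {a κ σ R c : ℝ} (hd : 1 ≤ d) (hR : 0 < R)
    (hσ : σ ≤ c * (a / κ ^ 4 * (√(n : ℝ) / (√(d : ℝ) * R)))) :
    σ * R * √d ≤ c * (a * √n / κ ^ 4) := by
  have hd' : 0 < √(d : ℝ) := Real.sqrt_pos.2 (by exact_mod_cast hd)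
  calc σ * R * √d ≤ c * (a / κ ^ 4 * (√(n : ℝ) / (√(d : ℝ) * R))) * R * √d := by gcongr
    _ = _ := by field_simp

/-- The constant 16384 = 16 · 1024 converts ‖stack V‖ ≤ 16R into the noise bound of `SmallNoise`.
The scale r of a single block is R/√n at most, and 2nκa bounds every leave-one-out iterate
deterministically, so the premise of `hI` always holds. -/
lemma exists_isGPMSolution_of_noise (hn : 1 ≤ n) (hd : 1 ≤ d) (hdm : d ≤ m)
    {A : Matrix (Fin d) (Fin m) ℝ} (hA : 0 < sigmaMin A) {O : Fin n → Matrix (Fin d) (Fin d) ℝ}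
    (hO : ∀ i, O i ∈ Matrix.orthogonalGroup (Fin d) ℝ) {σ R r : ℝ} (hσ0 : 0 ≤ σ)
    (hrR : √n * r ≤ R)
    (hσ : σ * R * √d ≤ 1 / 16384 * (sigmaMin A * √n / condNumber A ^ 4))
    {V : Fin n → Matrix (Fin d) (Fin m) ℝ} (hV : ‖stack V‖ ≤ 16 * R)
    (hI : ∀ i, ∀ t < n, ‖leaveOneOutIterate (stack O) A (σ • stack V) i t‖ ≤
        2 * n * (condNumber A * sigmaMin A) →
      ‖V i * leaveOneOutIterate (stack O) A (σ • stack V) i t‖ ≤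
        16 * r * (2 * n * (condNumber A * sigmaMin A))) :
    ∃ S, IsGPMSolution (data A O σ V) (1 / 2) S := by
  set a := sigmaMin A with ha
  set κ := condNumber A with hκ
  have hκa : κ * a = sigmaMax A := div_mul_cancel₀ _ hA.ne'
  have hκ1 : 1 ≤ κ := (one_le_div hA).2 (sigmaMin_le_sigmaMax A)
  have hn0 : (0 : ℝ) < n := by exact_mod_cast hn
  have hsn : 0 < √(n : ℝ) := Real.sqrt_pos.2 hn0
  have hsn2 : √(n : ℝ) * √n = n := Real.mul_self_sqrt hn0.le
  have h : SmallNoise (stack O) A (σ • stack V) a κ :=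
    { n_pos := hn
      d_pos := hd
      a_pos := hA
      one_le := hκ1
      mem := fun i => by rw [block_stack]; exact hO i
      lower := posSemidef_sub_sigmaMin hd hdm A hA
      upper := by rw [hκa]; exact norm_le_sv_zero A
      noise := by
        rw [norm_smul, Real.norm_eq_abs, abs_of_nonneg hσ0]
        calc σ * ‖stack V‖ * √d ≤ σ * (16 * R) * √d := by gcongr
          _ = 16 * (σ * R * √d) := by ring
          _ ≤ 16 * (1 / 16384 * (a * √n / κ ^ 4)) := by gcongr
          _ = _ := by field_simp; norm_num }
  have hscale : σ * r * √d ≤ 1 / 16384 * (a / κ ^ 4) := by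
    rw [← mul_le_mul_iff_right₀ hsn]
    calc √n * (σ * r * √d) = σ * (√n * r) * √d := by ring
      _ ≤ σ * R * √d := by gcongr
      _ ≤ 1 / 16384 * (a * √n / κ ^ 4) := hσ
      _ = _ := by ring
  refine h.exists_isGPMSolution (fun i t ht => ?_) (stack_data A O σ V)
    fun U S hU hS => h.dF_spectral_le hU hS
  have hY : ‖leaveOneOutIterate (stack O) A (σ • stack V) i t‖ ≤ 2 * n * (κ * a) := by
    have h0 := h.zeroBlock i
    calc _ ≤ ‖(stack O * A + zeroBlock (σ • stack V) i)ᵀ‖ *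
          ‖polarIter (stack O * A + zeroBlock (σ • stack V) i) (stack O) t‖ := l2_opNorm_mul _ _
      _ ≤ (2 * √n * (κ * a)) * √n := by
          rw [norm_transpose]
          exact mul_le_mul h0.norm_data_le (norm_orthStack_le (polarIter_mem _ h.mem t))
            (norm_nonneg _) (by positivity)
      _ = 2 * (√n * √n) * (κ * a) := by ring
      _ = _ := by rw [hsn2]
  have hκ3 : 1 ≤ κ ^ 3 := one_le_pow₀ hκ1
  have hblock : block (σ • stack V) i = σ • V i := by rw [block_smul, block_stack]
  change ‖block (σ • stack V) i * leaveOneOutIterate (stack O) A (σ • stack V) i t‖ * √d ≤ _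
  rw [hblock, Matrix.smul_mul, norm_smul, Real.norm_eq_abs, abs_of_nonneg hσ0]
  calc _ ≤ σ * (16 * r * (2 * n * (κ * a))) * √d := by gcongr; exact hI i t ht hY
    _ = 32 * n * (κ * a) * (σ * r * √d) := by ring
    _ ≤ 32 * n * (κ * a) * (1 / 16384 * (a / κ ^ 4)) := by gcongr
    _ = n * a ^ 2 / 512 / κ ^ 3 := by field_simp; norm_num
    _ ≤ _ := div_le_self (by positivity) hκ3

/-- The good event. -/
lemma exists_event [IsProbabilityMeasure μ] (hW : IsGaussianNoise μ W) (hn : 1 ≤ n)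
    (Z : Matrix (Fin n × Fin d) (Fin d) ℝ) (A : Matrix (Fin d) (Fin m) ℝ) (σ : ℝ) {γ L R r : ℝ}
    (hL : 0 < L) (hR : 0 ≤ R) (hr : 0 ≤ r)
    (hR2 : 2 * ((n * d + m : ℕ) : ℝ) + γ * Real.log n ≤ 8 * R ^ 2)
    (hr2 : 2 * ((d + d : ℕ) : ℝ) + γ * Real.log n ≤ 8 * r ^ 2) :
    ∃ E : Set Ω, MeasurableSet E ∧ ENNReal.ofReal (1 - 2 * (n : ℝ) ^ (-γ + 2)) ≤ μ E ∧
      ∀ ω ∈ E, ‖stack (W ω)‖ ≤ 16 * R ∧ ∀ i, ∀ t < n,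
        ‖leaveOneOutIterate Z A (σ • stack (W ω)) i t‖ ≤ L →
        ‖W ω i * leaveOneOutIterate Z A (σ • stack (W ω)) i t‖ ≤ 16 * r * L := by
  let B₁ : Set Ω := {ω | 16 * R < ‖stack (W ω)‖}
  let B₂ : Fin n × Fin n → Set Ω := fun q =>
    {ω | ‖leaveOneOutIterate Z A (σ • stack (W ω)) q.1 q.2‖ ≤ L} ∩
      {ω | 16 * r * L < ‖W ω q.1 * leaveOneOutIterate Z A (σ • stack (W ω)) q.1 q.2‖}
  have h1 : μ B₁ ≤ ENNReal.ofReal ((n : ℝ) ^ (-γ)) :=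
    (measure_norm_stack_gt_le hW hR).trans (five_pow_mul_exp_le hn hR2)
  have h2 : ∀ q, μ (B₂ q) ≤ ENNReal.ofReal ((n : ℝ) ^ (-γ)) := fun q =>
    (measure_block_mul_iterate_gt_le hW Z A σ q.1 q.2 hL hr).trans (five_pow_mul_exp_le hn hr2)
  have hn1 : (1 : ℝ) ≤ n := by exact_mod_cast hn
  -- There are 1 + n² ≤ 2n² bad events, each of probability at most n^(-γ).
  have hbad : μ (B₁ ∪ ⋃ q, B₂ q) ≤ ENNReal.ofReal (2 * (n : ℝ) ^ (-γ + 2)) := by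
    refine (measure_union_le _ _).trans ((add_le_add h1 (measure_iUnion_fintype_le _ _)).trans ?_)
    refine (add_le_add le_rfl (Finset.sum_le_sum fun q _ => h2 q)).trans ?_
    rw [Finset.sum_const, Finset.card_univ, Fintype.card_prod, Fintype.card_fin, ← one_nsmul
      (ENNReal.ofReal ((n : ℝ) ^ (-γ))), ← ENNReal.ofReal_nsmul, ← ENNReal.ofReal_nsmul,
      ← ENNReal.ofReal_add (by positivity) (by positivity)]
    refine ENNReal.ofReal_le_ofReal ?_
    rw [Real.rpow_add (by positivity), Real.rpow_two]
    simp only [nsmul_eq_mul]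
    push_cast
    have hp : 0 ≤ (n : ℝ) ^ (-γ) := by positivity
    nlinarith [mul_le_mul_of_nonneg_left (one_le_pow₀ hn1 (n := 2)) hp]
  -- A measurable hull of the same measure, so that measurability of the bad events need not be
  -- shown.
  refine ⟨(toMeasurable μ (B₁ ∪ ⋃ q, B₂ q))ᶜ, (measurableSet_toMeasurable _ _).compl, ?_, ?_⟩
  · rw [prob_compl_eq_one_sub (measurableSet_toMeasurable _ _), measure_toMeasurable,
      ENNReal.ofReal_sub _ (by positivity), ENNReal.ofReal_one]
    exact tsub_le_tsub_left hbad 1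
  · intro ω hω
    have hω' : ω ∉ B₁ ∪ ⋃ q, B₂ q := fun h => hω (subset_toMeasurable _ _ h)
    simp only [Set.mem_union, Set.mem_iUnion, not_or, not_exists] at hω'
    refine ⟨not_lt.1 hω'.1, fun i t ht hY => ?_⟩
    by_contra hlt
    exact hω'.2 (i, ⟨t, ht⟩) ⟨hY, not_le.1 hlt⟩

end Main

end Procrustes

/-! ### The theorem: choice of constants and noise scales. -/

theorem theorem3p2 :
    ∃ c C ρ : ℝ, 0 < c ∧ 0 < C ∧ 0 < ρ ∧ ρ < 1 ∧
      ∀ (n d m : ℕ), 1 ≤ n → 1 ≤ d → d ≤ m →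
      ∀ (A : Matrix (Fin d) (Fin m) ℝ), 0 < Procrustes.sigmaMin A →
      ∀ (O : Fin n → Matrix (Fin d) (Fin d) ℝ),
        (∀ i, O i ∈ Matrix.orthogonalGroup (Fin d) ℝ) →
      ∀ (σ γ : ℝ), 0 ≤ σ → 0 < γ →
        σ ≤ c * (Procrustes.sigmaMin A / Procrustes.condNumber A ^ 4 *
          (√(n : ℝ) / (√(d : ℝ) *
            (√((n : ℝ) * d) + √(m : ℝ) + √(2 * γ * n * Real.log n))))) →
      ∀ (Ω : Type*) [MeasurableSpace Ω] (μ : Measure Ω) [IsProbabilityMeasure μ]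
        (W : Ω → Fin n → Matrix (Fin d) (Fin m) ℝ), Procrustes.IsGaussianNoise μ W →
      ∃ E : Set Ω, MeasurableSet E ∧
        ENNReal.ofReal (1 - C * (n : ℝ) ^ (-γ + 2)) ≤ μ E ∧
        ∀ ω ∈ E, ∃ Sinf : Matrix (Fin n × Fin d) (Fin d) ℝ,
          Procrustes.IsGPMSolution (Procrustes.data A O σ (W ω)) ρ Sinf := by
  refine ⟨1 / 16384, 2, 1 / 2, by norm_num, by norm_num, by norm_num, by norm_num, ?_⟩
  intro n d m hn hd hdm A hA O hO σ γ hσ0 hγ hσ Ω _ μ _ W hW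
  have hn1 : (1 : ℝ) ≤ n := by exact_mod_cast hn
  have hd1 : (1 : ℝ) ≤ d := by exact_mod_cast hd
  have hlog : 0 ≤ Real.log n := Real.log_nonneg hn1
  set R := √((n : ℝ) * d) + √(m : ℝ) + √(2 * γ * n * Real.log n) with hR
  -- The fluctuation scale of one block against an independent d-column matrix; √n r is R without
  -- the term √m.
  set r := √(d : ℝ) + √(2 * γ * Real.log n) with hr
  have hR0 : 0 < R := by
    have : 0 < √((n : ℝ) * d) := Real.sqrt_pos.2 (by positivity)
    positivity
  have hr0 : 0 ≤ r := by positivity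
  have hrR : √n * r ≤ R := by
    have h1 : √(n : ℝ) * √d = √((n : ℝ) * d) := (Real.sqrt_mul (by positivity) _).symm
    have h2 : √(n : ℝ) * √(2 * γ * Real.log n) = √(2 * γ * n * Real.log n) := by
      rw [← Real.sqrt_mul (by positivity)]; congr 1; ring
    rw [hr, mul_add, h1, h2, hR]
    linarith [Real.sqrt_nonneg (m : ℝ)]
  have hR2 : 2 * ((n * d + m : ℕ) : ℝ) + γ * Real.log n ≤ 8 * R ^ 2 := by
    have e1 := Real.sq_sqrt (x := (n : ℝ) * d) (by positivity)
    have e2 := Real.sq_sqrt (x := (m : ℝ)) (by positivity)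
    have e3 := Real.sq_sqrt (x := 2 * γ * n * Real.log n) (by positivity)
    have e4 : √((n : ℝ) * d) ^ 2 + √(m : ℝ) ^ 2 + √(2 * γ * n * Real.log n) ^ 2 ≤ R ^ 2 := by
      have p1 := Real.sqrt_nonneg ((n : ℝ) * d)
      have p2 := Real.sqrt_nonneg (m : ℝ)
      have p3 := Real.sqrt_nonneg (2 * γ * n * Real.log n)
      have := mul_nonneg p1 p2
      have := mul_nonneg p1 p3
      have := mul_nonneg p2 p3
      rw [hR]; linarith
    have e5 : γ * Real.log n ≤ γ * n * Real.log n := by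
      have := mul_le_mul_of_nonneg_left hn1 (mul_nonneg hγ.le hlog)
      linarith
    have : 0 ≤ γ * Real.log n := by positivity
    have : 0 ≤ (n : ℝ) * d := by positivity
    have : 0 ≤ (m : ℝ) := by positivity
    push_cast
    linarith
  have hr2 : 2 * ((d + d : ℕ) : ℝ) + γ * Real.log n ≤ 8 * r ^ 2 := by
    have e1 := Real.sq_sqrt (x := (d : ℝ)) (by positivity)
    have e2 := Real.sq_sqrt (x := 2 * γ * Real.log n) (by positivity)
    have e3 := mul_nonneg (Real.sqrt_nonneg (d : ℝ)) (Real.sqrt_nonneg (2 * γ * Real.log n))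
    have : 0 ≤ γ * Real.log n := by positivity
    push_cast
    rw [hr]
    linarith
  have hκ : 0 < Procrustes.condNumber A :=
    div_pos (hA.trans_le (Procrustes.sigmaMin_le_sigmaMax A)) hA
  obtain ⟨E, hE, hμ, hgood⟩ := Procrustes.exists_event hW hn (Procrustes.stack O) A σ (γ := γ)
    (L := 2 * n * (Procrustes.condNumber A * Procrustes.sigmaMin A)) (by positivity) hR0.le hr0
    hR2 hr2
  exact ⟨E, hE, hμ, fun ω hω => Procrustes.exists_isGPMSolution_of_noise hn hd hdm hA hO hσ0 hrR
    (Procrustes.noise_scale_le hd hR0 hσ) (hgood ω hω).1 (hgood ω hω).2⟩
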